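/- Let $U\subset\mathbb R^n$ be open with coordinates $u^1,\dots,u^n$, and let all functions below be $C^\infty$ on $U$. Let $g=(g_{ij})$ be a flat (pseudo-Riemannian) metric on $U$ with inverse $g^{ij}$, Levi-Civita connection $\nabla$ and Christoffel symbols $\Gamma$, and write $\nabla^i\nabla_jF=g^{is}\nabla_s\nabla_jF$, $F_i=\partial F/\partial u^i$ and $(\nabla F,\nabla G)=g^{ij}F_iG_j$. Consider the Hamiltonian system $u^i_t=v^i_j(u)u^j_x$, $v^i_j=\nabla^i\nabla_jh$, generated by the local operator $J^{ij}=g^{ij}\frac{d}{dx}-g^{is}\Gamma^j_{sk}u^k_x$ and the density $h$. Call $E$ a flux of $F$ along a system $u_s=w(u)u_x$ if $F_iw^i_j=\partial_jE$, i.e. if the one-form $F\,dx+E\,ds$ is closed by virtue of the system. Let $A$ and $M$ be fluxes of $B$ and $N$ along $u_t=vu_x$, with $BM-AN\ne0$ and $\det(M-Nv)\neq 0$ on $U$, and consider the reciprocal transformation $d\tilde x=B\,dx+A\,dt$, $d\tilde t=N\,dx+M\,dt$, which takes the system to $u_{\tilde t}=\tilde v u_{\tilde x}$, $\tilde v=(Bv-A)(M-Nv)^{-1}$.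 Let $$\tilde g_{ij}=\frac{(M\delta^s_i-Nv^s_i)(M\delta^r_j-Nv^r_j)}{(BM-AN)^2}\,g_{sr}.$$ Let $u^i_\tau=(\nabla^i\nabla_jN)u^j_x$ and $u^i_\zeta=(\nabla^i\nabla_jB)u^j_x$ be the Hamiltonian flows with densities $N$ and $B$. Suppose that $P$ is a flux of $B$ along the $\tau$-flow and $S$ a flux of $N$ along the $\zeta$-flow, normalized by $P+S=(\nabla B,\nabla N)$, and put $Q=\frac12(\nabla B,\nabla B)$, $R=\frac12(\nabla N,\nabla N)$. Define the matrices $$\lambda^i_j=B\nabla^i\nabla_jB-Q\delta^i_j+N\tilde v^k_j\nabla^i\nabla_kB-S\tilde v^i_j,\qquad \mu^i_j=B\nabla^i\nabla_jN-P\delta^i_j+N\tilde v^k_j\nabla^i\nabla_kN-R\tilde v^i_j .$$ Then: 1. $\tilde g$ is a metric on $U$. After the extended transformation $d\tilde x=B\,dx+A\,dt+P\,d\tau+Q\,d\zeta$, $d\tilde t=N\,dx+M\,dt+R\,d\tau+S\,d\zeta$, every common solution $u(x,t,\tau,\zeta)$ of the three flows, as a function of $(\tilde x,\tilde t,\tau,\zeta)$,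 satisfies $u_{\tilde t}=\tilde vu_{\tilde x}$, $u_\tau=\mu u_{\tilde x}$, $u_\zeta=\lambda u_{\tilde x}$. The last two flows commute with the first one. 2. The operator $$\tilde J^{ij}=\tilde g^{ij}\tfrac{d}{d\tilde x}-\tilde g^{is}\tilde\Gamma^j_{sk}u^k_{\tilde x}+\lambda^i_ku^k_{\tilde x}\left(\tfrac{d}{d\tilde x}\right)^{-1}u^j_{\tilde x}+u^i_{\tilde x}\left(\tfrac{d}{d\tilde x}\right)^{-1}\lambda^j_ku^k_{\tilde x}+\mu^i_ku^k_{\tilde x}\left(\tfrac{d}{d\tilde x}\right)^{-1}\tilde v^j_nu^n_{\tilde x}+\tilde v^i_nu^n_{\tilde x}\left(\tfrac{d}{d\tilde x}\right)^{-1}\mu^j_ku^k_{\tilde x},$$ where $\tilde\Gamma$ is the Levi-Civita connection of $\tilde g$, is Hamiltonian: with $\left(\frac{d}{dx}\right)^{-1}=\frac12\left(\int_{-\infty}^x-\int_x^{\infty}\right)$, its bracket on the functionals $\int\xi_iu^i\,dx$ ($\xi$ smooth with compact support) is skew-symmetric and satisfies the Jacobi identity at every smooth curve $u:\mathbb R\to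 U$. 3. $\tilde J$ is the transform of $J$. The system $u_{\tilde t}=\tilde vu_{\tilde x}$ is Hamiltonian, $u^i_{\tilde t}=\tilde J^{ij}\,\partial\tilde h/\partial u^j$ with $\tilde h=\frac{hM-\frac12(\nabla h,\nabla h)N}{BM-AN}$. More generally, let $u_s=wu_x$ be the flow generated by $J$ and a density $H$, and let $F$ be a flux of $H$ along $u_t=vu_x$ and $E$, $G$ fluxes of $B$, $N$ along $u_s=wu_x$. Then the transformed flow with matrix $Bw-E+Nw\tilde v-G\tilde v$ (obtained from $d\tilde x=B\,dx+A\,dt+E\,ds$, $d\tilde t=N\,dx+M\,dt+G\,ds$) is generated by $\tilde J$ and the density $\frac{HM-FN}{BM-AN}$. In both statements $\left(\frac{d}{d\tilde x}\right)^{-1}$ of the $\tilde x$-derivative of a flux is that flux, with a suitable constant of integration. 4. The curvature tensor of $\tilde g$, with the sign for which constant curvature $c$ means $R^{ij}_{kl}=c(\delta^i_k\delta^j_l-\delta^i_l\delta^j_k)$, is $$\tilde R^{ij}_{kl}=\lambda^i_k\delta^j_l+\lambda^j_l\delta^i_k-\lambda^j_k\delta^i_l-\lambda^i_l\delta^j_k+\mu^i_k\tilde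 v^j_l+\mu^j_l\tilde v^i_k-\mu^j_k\tilde v^i_l-\mu^i_l\tilde v^j_k .$$ -/

import Mathlib

open scoped ContDiff Matrix

noncomputable section

namespace HydroType

/-- A field of `n × n` matrices in the coordinates `u = (u¹, …, uⁿ)`. It stands for a metric
`g_{ij}(u)` (lower indices) or for an affinor `w^i_j(u)` (row `i`, column `j`). -/
abbrev MatField (n : ℕ) := (Fin n → ℝ) → Matrix (Fin n) (Fin n) ℝ

/-- A function of the coordinates `u¹, …, uⁿ`. -/
abbrev ScalarField (n : ℕ) := (Fin n → ℝ) → ℝ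

/-- The partial derivative `∂f/∂y^k` of a function of the variables `y`. -/
def pd {m : ℕ} {E : Type*} [NormedAddCommGroup E] [NormedSpace ℝ E]
    (k : Fin m) (f : (Fin m → ℝ) → E) (y : Fin m → ℝ) : E :=
  fderiv ℝ f y (Pi.single k 1)

/-! ### Pseudo-Riemannian geometry in a coordinate domain -/

/-- `g` is a smooth (pseudo-Riemannian) metric with components `g_{ij}` on `U`. -/
structure IsMetricOn {n : ℕ} (U : Set (Fin n → ℝ)) (g : MatField n) : Prop where
  smooth : ∀ i j, ContDiffOn ℝ ∞ (fun u => g u i j) U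
  symm : ∀ u ∈ U, (g u).IsSymm
  nondeg : ∀ u ∈ U, (g u).det ≠ 0

/-- The Christoffel symbol `Γ^j_{sk}` of the Levi-Civita connection of `g`. -/
def christoffel {n : ℕ} (g : MatField n) (j s k : Fin n) (u : Fin n → ℝ) : ℝ :=
  (1 / 2) * ∑ l, (g u)⁻¹ j l *
    (pd s (fun y => g y l k) u + pd k (fun y => g y l s) u - pd l (fun y => g y s k) u)

/-- The Riemann tensor `R^i_{skl}`, where `R(∂_k, ∂_l) ∂_s = R^i_{skl} ∂_i`. -/
def riemann {n : ℕ} (g : MatField n) (i s k l : Fin n) (u : Fin n → ℝ) : ℝ :=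
  pd k (christoffel g i l s) u - pd l (christoffel g i k s) u
    + ∑ m, (christoffel g i k m u * christoffel g m l s u
      - christoffel g i l m u * christoffel g m k s u)

/-- The curvature tensor with two upper indices, `R^{ij}_{kl} = g^{js} R^i_{skl}`; for constant
curvature `c` it is `c (δ^i_k δ^j_l - δ^i_l δ^j_k)`. -/
def curvature {n : ℕ} (g : MatField n) (i j k l : Fin n) (u : Fin n → ℝ) : ℝ :=
  ∑ s, (g u)⁻¹ j s * riemann g i s k l u

/-- The metric is flat on `U`. -/
def IsFlatOn {n : ℕ} (U : Set (Fin n → ℝ)) (g : MatField n) : Prop :=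
  ∀ u ∈ U, ∀ i s k l, riemann g i s k l u = 0

/-- The affinor `∇^i ∇_j F = g^{is} (∂_s ∂_j F - Γ^m_{sj} ∂_m F)`. -/
def hess {n : ℕ} (g : MatField n) (F : ScalarField n) : MatField n := fun u =>
  Matrix.of fun i j => ∑ s, (g u)⁻¹ i s *
    (pd s (pd j F) u - ∑ m, christoffel g m s j u * pd m F u)

/-- The scalar product of gradients `(∇F, ∇G) = g^{ij} F_i G_j`. -/
def gradInner {n : ℕ} (g : MatField n) (F G : ScalarField n) : ScalarField n := fun u =>
  ∑ i, ∑ j, (g u)⁻¹ i j * pd i F u * pd j G u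

/-! ### Systems of hydrodynamic type -/

/-- The right-hand side `w^i_j(u) u^j_x` of the system `u_s = w(u) u_x`, at the point `x` of the
curve `u`. -/
def flow {n : ℕ} (w : MatField n) (u : ℝ → Fin n → ℝ) (x : ℝ) : Fin n → ℝ :=
  w (u x) *ᵥ deriv u x

/-- `F` is a conserved density with flux `E` of the system `u_s = w(u) u_x`, that is
`∂_s F(u) = ∂_x E(u)` by virtue of the system: `F_i w^i_j = E_j`. Equivalently the one-form
`F dx + E ds` is closed by virtue of the system. -/
def IsFlux {n : ℕ} (U : Set (Fin n → ℝ)) (w : MatField n) (F E : ScalarField n) : Prop :=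
  ∀ u ∈ U, ∀ j, ∑ i, pd i F u * w u i j = pd j E u

/-- A smooth curve `x ↦ u(x)` with values in `U`. -/
structure IsCurveIn {n : ℕ} (U : Set (Fin n → ℝ)) (u : ℝ → Fin n → ℝ) : Prop where
  smooth : ContDiff ℝ ∞ u
  mem : ∀ x, u x ∈ U

/-- The flows `u_s = v(u) u_x` and `u_r = w(u) u_x` commute: the derivative of the second vector
field along the first one equals the derivative of the first one along the second one. -/
def FlowsCommute {n : ℕ} (U : Set (Fin n → ℝ)) (v w : MatField n) : Prop :=
  ∀ u : ℝ → Fin n → ℝ, IsCurveIn U u → ∀ x : ℝ, ∃ a : Fin n → ℝ,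
    HasDerivAt (fun ε : ℝ => flow w (u + ε • flow v u) x) a 0 ∧
    HasDerivAt (fun ε : ℝ => flow v (u + ε • flow w u) x) a 0

/-! ### Nonlocal operators of hydrodynamic type -/

/-- The operator
`J^{ij} = g^{ij} d/dx - g^{is} Γ^j_{sk} u^k_x + ∑_α a_{(α)k}^i u^k_x (d/dx)⁻¹ b_{(α)l}^j u^l_x`
with `m` nonlocal tails; `metric` has the components `g_{ij}`, `left α = a_{(α)}` and
`right α = b_{(α)}`. -/
structure NonlocalOp (n m : ℕ) where
  metric : MatField n
  left : Fin m → MatField n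
  right : Fin m → MatField n

namespace NonlocalOp

variable {n m : ℕ}

/-- The local part `g^{ij} dξ_j/dx - g^{is} Γ^j_{sk} u^k_x ξ_j`. -/
def localPart (J : NonlocalOp n m) (u ξ : ℝ → Fin n → ℝ) (x : ℝ) : Fin n → ℝ := fun i =>
  ∑ j, ((J.metric (u x))⁻¹ i j * deriv ξ x j
    - ∑ s, ∑ k, (J.metric (u x))⁻¹ i s * christoffel J.metric j s k (u x) * deriv u x k * ξ x j)

/-- The function `b_{(α)l}^j u^l_x ξ_j`, to which `(d/dx)⁻¹` is applied in the tail `α`. -/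
def tailDensity (J : NonlocalOp n m) (u ξ : ℝ → Fin n → ℝ) (α : Fin m) (x : ℝ) : ℝ :=
  flow (J.right α) u x ⬝ᵥ ξ x

/-- The value of `J` on `ξ` when `c α` is used as the antiderivative of `tailDensity α`. -/
def applyWith (J : NonlocalOp n m) (u ξ : ℝ → Fin n → ℝ) (c : Fin m → ℝ → ℝ) (x : ℝ) :
    Fin n → ℝ :=
  J.localPart u ξ x + ∑ α, c α x • flow (J.left α) u x

/-- The skew-symmetric antiderivative `(d/dx)⁻¹ f = ½ (∫_{-∞}^x f - ∫_x^∞ f)`. -/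
def antideriv (f : ℝ → ℝ) (x : ℝ) : ℝ :=
  (1 / 2) * ((∫ y in Set.Iic x, f y) - ∫ y in Set.Ici x, f y)

/-- The value of the operator `J`, at the curve `u`, on a compactly supported covector `ξ`. -/
def apply (J : NonlocalOp n m) (u ξ : ℝ → Fin n → ℝ) : ℝ → Fin n → ℝ :=
  J.applyWith u ξ fun α => antideriv (J.tailDensity u ξ α)

/-- `∫ ξ_i J^{ij} η_j dx`, which is the bracket, at the curve `u`, of the functionals
`∫ ξ_i u^i dx` and `∫ η_j u^j dx`. -/
def bracket (J : NonlocalOp n m) (u ξ η : ℝ → Fin n → ℝ) : ℝ :=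
  ∫ x, ξ x ⬝ᵥ J.apply u η x

/-- A smooth compactly supported covector. -/
structure IsTest (ξ : ℝ → Fin n → ℝ) : Prop where
  smooth : ContDiff ℝ ∞ ξ
  compact : HasCompactSupport ξ

/-- `J` is a Hamiltonian operator: its bracket is skew-symmetric and satisfies the Jacobi identity
`{{ξ, ζ}, η} + {{η, ξ}, ζ} + {{ζ, η}, ξ} = 0` (vanishing of the Schouten bracket), where
`{F, η}` is the derivative of the functional `F` of `u` in the direction of the vector field
`J η`. -/
structure IsHamiltonian (J : NonlocalOp n m) (U : Set (Fin n → ℝ)) : Prop where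
  skew : ∀ u ξ η : ℝ → Fin n → ℝ, IsCurveIn U u → IsTest ξ → IsTest η →
    J.bracket u ξ η = -J.bracket u η ξ
  jacobi : ∀ u ξ η ζ : ℝ → Fin n → ℝ, IsCurveIn U u → IsTest ξ → IsTest η → IsTest ζ →
    ∃ a b c : ℝ,
      HasDerivAt (fun ε : ℝ => J.bracket (u + ε • J.apply u η) ξ ζ) a 0 ∧
      HasDerivAt (fun ε : ℝ => J.bracket (u + ε • J.apply u ζ) η ξ) b 0 ∧
      HasDerivAt (fun ε : ℝ => J.bracket (u + ε • J.apply u ξ) ζ η) c 0 ∧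
      a + b + c = 0

/-- The system `u_s = w(u) u_x` has the form `u^i_s = J^{ij} ∂H/∂u^j`. The antiderivatives of
`b_{(α)l}^j u^l_x ∂H/∂u^j` are the fluxes `φ_α(u)` of the density `H` along the flows
`b_{(α)}`. -/
def Generates (J : NonlocalOp n m) (U : Set (Fin n → ℝ)) (H : ScalarField n)
    (w : MatField n) : Prop :=
  ∃ φ : Fin m → ScalarField n,
    (∀ α, ContDiffOn ℝ ∞ (φ α) U) ∧ (∀ α, IsFlux U (J.right α) H (φ α)) ∧
    ∀ u : ℝ → Fin n → ℝ, IsCurveIn U u → ∀ x : ℝ,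
      flow w u x = J.applyWith u (fun y j => pd j H (u y)) (fun α y => φ α (u y)) x

end NonlocalOp

/-- The local operator `g^{ij} d/dx - g^{is} Γ^j_{sk} u^k_x`. -/
def localOp {n : ℕ} (g : MatField n) : NonlocalOp n 0 where
  metric := g
  left := Fin.elim0
  right := Fin.elim0

/-! ### Reciprocal transformations `dX = B dx + A dt`, `dT = N dx + M dt` -/

/-- The matrix `(B v - A E) (M E - N v)⁻¹` of the transformed system. -/
def newVelocity {n : ℕ} (B A N M : ScalarField n) (v : MatField n) : MatField n := fun u =>
  (B u • v u - A u • 1) * (M u • 1 - N u • v u)⁻¹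

/-- The transformed metric, with the lower components
`(M δ^s_i - N v^s_i) (M δ^r_j - N v^r_j) g_{sr} / (B M - A N)²`. -/
def newMetric {n : ℕ} (B A N M : ScalarField n) (v g : MatField n) : MatField n := fun u =>
  ((B u * M u - A u * N u) ^ 2)⁻¹ •
    ((M u • 1 - N u • v u)ᵀ * g u * (M u • 1 - N u • v u))

/-- The matrix `B w - E + N w ṽ - G ṽ` of the flow `u_s = w u_x` after the transformation
`dX = B dx + A dt + E ds`, `dT = N dx + M dt + G ds`, where `ṽ` is the matrix `vt`. -/
def newFlow {n : ℕ} (B N : ScalarField n) (vt w : MatField n) (E G : ScalarField n) :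
    MatField n := fun u =>
  B u • w u - E u • 1 + N u • (w u * vt u) - G u • vt u

/-- The operator
`g̃^{ij} d/dX - g̃^{is} Γ̃^j_{sk} u^k_X + λ^i_k u^k_X (d/dX)⁻¹ u^j_X + u^i_X (d/dX)⁻¹ λ^j_k u^k_X
+ μ^i_k u^k_X (d/dX)⁻¹ ṽ^j_n u^n_X + ṽ^i_n u^n_X (d/dX)⁻¹ μ^j_k u^k_X`. -/
def fourTailOp {n : ℕ} (gt lam mu vt : MatField n) : NonlocalOp n 4 where
  metric := gt
  left := ![lam, 1, mu, vt]
  right := ![1, lam, vt, mu]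

/-- If `u(x, t, τ, ζ)` solves `u_t = v u_x`, `u_τ = w₁ u_x`, `u_ζ = w₂ u_x`, and if
`dX = B dx + A dt + P dτ + Q dζ`, `dT = N dx + M dt + R dτ + S dζ`, then `u` as a function `ut` of
the new independent variables `(X, T, τ, ζ)` solves `u_T = vt u_X`, `u_τ = mu u_X`,
`u_ζ = lam u_X`. The coordinates `0, 1, 2, 3` are `x, t, τ, ζ` or `X, T, τ, ζ`. -/
def TransformsFlows {n : ℕ} (U : Set (Fin n → ℝ)) (B A P Q N M R S : ScalarField n)
    (v w₁ w₂ vt mu lam : MatField n) : Prop :=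
  ∀ (Ω : Set (Fin 4 → ℝ)) (u ut : (Fin 4 → ℝ) → Fin n → ℝ) (X T : (Fin 4 → ℝ) → ℝ),
    IsOpen Ω → DifferentiableOn ℝ u Ω → DifferentiableOn ℝ X Ω → DifferentiableOn ℝ T Ω →
    (∀ p ∈ Ω, u p ∈ U) →
    (∀ p ∈ Ω, pd 1 u p = v (u p) *ᵥ pd 0 u p ∧ pd 2 u p = w₁ (u p) *ᵥ pd 0 u p ∧
      pd 3 u p = w₂ (u p) *ᵥ pd 0 u p) →
    (∀ p ∈ Ω, pd 0 X p = B (u p) ∧ pd 1 X p = A (u p) ∧ pd 2 X p = P (u p) ∧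
      pd 3 X p = Q (u p)) →
    (∀ p ∈ Ω, pd 0 T p = N (u p) ∧ pd 1 T p = M (u p) ∧ pd 2 T p = R (u p) ∧
      pd 3 T p = S (u p)) →
    (∀ p ∈ Ω, DifferentiableAt ℝ ut ![X p, T p, p 2, p 3] ∧ u p = ut ![X p, T p, p 2, p 3]) →
    ∀ p ∈ Ω, ∀ q, q = ![X p, T p, p 2, p 3] →
      pd 1 ut q = vt (ut q) *ᵥ pd 0 ut q ∧ pd 2 ut q = mu (ut q) *ᵥ pd 0 ut q ∧
        pd 3 ut q = lam (ut q) *ᵥ pd 0 ut q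

end HydroType

end

/-!
Along a solution `u_X = K u_x` and `u_T = L u_x` with affinors `K`, `L` built from `v`, and
`g̃ = Kᵀ g K`. The conservation laws of `B` and `N` say that `K` and `L` satisfy the Codazzi
equations for the `g`-skew deformation `ρ_X = ∇B ∧ K X + ∇N ∧ L X` of the flat connection, so that
in the frame `K` the Levi-Civita connection of `g̃` is `∇ + ρ`. Its curvature contains only
`∇²B ∧ K`, `∇²N ∧ L` and the scalar products of `∇B` and `∇N`, and these assemble to the tails of
`J̃`.

A flow commuting with the system is taken to a Codazzi tensor of `g̃`, hence the tails of `J̃` are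
commuting Codazzi tensors whose wedge products sum up to the curvature of `g̃`. Any such operator is
Hamiltonian: the derivative of its bracket along `V` is, up to a total derivative, the integral of
an expression whose cyclic sum vanishes pointwise, because the connection is torsion-free and the
tails are self-adjoint.
-/

noncomputable section

namespace HydroType

open Matrix MeasureTheory
open scoped Matrix.Norms.Operator

/-! ### Calculus of matrix fields -/

/-- The topology of the operator norm on matrices. Mathlib's product topology agrees with it only
after unfolding, which would keep the calculus of normed spaces from applying to matrix fields. -/
local instance matrixTopology {n : ℕ} : TopologicalSpace (Matrix (Fin n) (Fin n) ℝ) :=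
  (inferInstance : PseudoMetricSpace (Matrix (Fin n) (Fin n) ℝ)).toUniformSpace.toTopologicalSpace

section Calculus

variable {V : Type*} [NormedAddCommGroup V] [NormedSpace ℝ V]

section Bilinear

variable {E₁ E₂ E₃ : Type*} [NormedAddCommGroup E₁] [NormedSpace ℝ E₁] [FiniteDimensional ℝ E₁]
  [NormedAddCommGroup E₂] [NormedSpace ℝ E₂] [FiniteDimensional ℝ E₂]
  [NormedAddCommGroup E₃] [NormedSpace ℝ E₃] (β : E₁ →ₗ[ℝ] E₂ →ₗ[ℝ] E₃)

lemma contDiffOn_bilinear {k : ℕ∞ω} {s : Set V} {a : V → E₁} {b : V → E₂}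
    (ha : ContDiffOn ℝ k a s) (hb : ContDiffOn ℝ k b s) :
    ContDiffOn ℝ k (fun z => β (a z) (b z)) s :=
  (β.toContinuousBilinearMap.contDiff.comp_contDiffOn ha).clm_apply hb

lemma differentiableAt_bilinear {u : V} {a : V → E₁} {b : V → E₂} (ha : DifferentiableAt ℝ a u)
    (hb : DifferentiableAt ℝ b u) : DifferentiableAt ℝ (fun z => β (a z) (b z)) u :=
  (β.toContinuousBilinearMap.differentiableAt.comp u ha).clm_apply hb

lemma fderiv_bilinear {u : V} {a : V → E₁} {b : V → E₂} (ha : DifferentiableAt ℝ a u)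
    (hb : DifferentiableAt ℝ b u) (X : V) :
    fderiv ℝ (fun z => β (a z) (b z)) u X =
      β (fderiv ℝ a u X) (b u) + β (a u) (fderiv ℝ b u X) := by
  have h := congrArg (· X) (β.toContinuousBilinearMap.fderiv_of_bilinear ha hb)
  simpa [add_comm] using h

lemma hasDerivAt_bilinear {a : ℝ → E₁} {b : ℝ → E₂} {a' : E₁} {b' : E₂} {t : ℝ}
    (ha : HasDerivAt a a' t) (hb : HasDerivAt b b' t) :
    HasDerivAt (fun s => β (a s) (b s)) (β a' (b t) + β (a t) b') t := by
  simpa using (β.toContinuousBilinearMap.hasFDerivAt.comp_hasDerivAt t ha).clm_apply hb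

end Bilinear

variable {n : ℕ}

lemma hasDerivAt_mulVec {W : ℝ → Matrix (Fin n) (Fin n) ℝ} {x : ℝ → Fin n → ℝ}
    {W' : Matrix (Fin n) (Fin n) ℝ} {x' : Fin n → ℝ} {t : ℝ} (hW : HasDerivAt W W' t)
    (hx : HasDerivAt x x' t) : HasDerivAt (fun s => W s *ᵥ x s) (W' *ᵥ x t + W t *ᵥ x') t :=
  hasDerivAt_bilinear (mulVecBilin ℝ ℝ) hW hx

lemma hasDerivAt_dotProduct {x y : ℝ → Fin n → ℝ} {x' y' : Fin n → ℝ} {t : ℝ}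
    (hx : HasDerivAt x x' t) (hy : HasDerivAt y y' t) :
    HasDerivAt (fun s => x s ⬝ᵥ y s) (x' ⬝ᵥ y t + x t ⬝ᵥ y') t :=
  hasDerivAt_bilinear (dotProductBilin ℝ ℝ) hx hy

variable {U : Set V} {u : V}
  {W C : V → Matrix (Fin n) (Fin n) ℝ} {x y : V → Fin n → ℝ}

lemma contDiffOn_matrix {k : ℕ∞ω} :
    ContDiffOn ℝ k W U ↔ ∀ i j, ContDiffOn ℝ k (fun z => W z i j) U :=
  ⟨fun h i j => (entryLinearMap ℝ ℝ i j).toContinuousLinearMap.contDiff.comp_contDiffOn h,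
    fun h => (ofLinearEquiv ℝ : (Fin n → Fin n → ℝ) ≃ₗ[ℝ] _).toLinearMap.toContinuousLinearMap
      |>.contDiff.comp_contDiffOn (contDiffOn_pi.2 fun i => contDiffOn_pi.2 (h i))⟩

lemma contDiffOn_matrix_mul {k : ℕ∞ω} (hW : ContDiffOn ℝ k W U) (hC : ContDiffOn ℝ k C U) :
    ContDiffOn ℝ k (fun z => W z * C z) U :=
  contDiffOn_bilinear (LinearMap.mul ℝ _) hW hC

lemma contDiffOn_transpose {k : ℕ∞ω} (hW : ContDiffOn ℝ k W U) :
    ContDiffOn ℝ k (fun z => (W z)ᵀ) U :=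
  contDiffOn_matrix.2 fun i j => contDiffOn_matrix.1 hW j i

lemma contDiffOn_mulVec {k : ℕ∞ω} (hW : ContDiffOn ℝ k W U) (hx : ContDiffOn ℝ k x U) :
    ContDiffOn ℝ k (fun z => W z *ᵥ x z) U :=
  contDiffOn_bilinear (mulVecBilin ℝ ℝ) hW hx

lemma contDiffOn_dotProduct {k : ℕ∞ω} (hx : ContDiffOn ℝ k x U) (hy : ContDiffOn ℝ k y U) :
    ContDiffOn ℝ k (fun z => x z ⬝ᵥ y z) U :=
  contDiffOn_bilinear (dotProductBilin ℝ ℝ) hx hy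

lemma contDiffOn_matrix_inv {k : ℕ∞ω} (hW : ContDiffOn ℝ k W U) (h : ∀ z ∈ U, (W z).det ≠ 0) :
    ContDiffOn ℝ k (fun z => (W z)⁻¹) U := fun z hz => by
  simp only [nonsing_inv_eq_ringInverse]
  exact (contDiffAt_ringInverse ℝ ((isUnit_iff_isUnit_det _).2
    (isUnit_iff_ne_zero.2 (h z hz))).unit).comp_contDiffWithinAt z (hW z hz)

lemma fderiv_matrix_entry (hW : DifferentiableAt ℝ W u) (X : V) (i j : Fin n) :
    fderiv ℝ (fun z => W z i j) u X = fderiv ℝ W u X i j :=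
  congrArg (· X) ((entryLinearMap ℝ ℝ i j).toContinuousLinearMap.hasFDerivAt.comp u
    hW.hasFDerivAt).fderiv

lemma fderiv_pi_entry (hx : DifferentiableAt ℝ x u) (X : V) (i : Fin n) :
    fderiv ℝ (fun z => x z i) u X = fderiv ℝ x u X i := by
  rw [fderiv_apply hx]; rfl

lemma fderiv_transpose (hW : DifferentiableAt ℝ W u) (X : V) :
    fderiv ℝ (fun z => (W z)ᵀ) u X = (fderiv ℝ W u X)ᵀ :=
  congrArg (· X) ((transposeLinearEquiv (Fin n) (Fin n) ℝ ℝ).toLinearMap.toContinuousLinearMap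
    |>.hasFDerivAt.comp u hW.hasFDerivAt).fderiv

lemma fderiv_matrix_mul (hW : DifferentiableAt ℝ W u) (hC : DifferentiableAt ℝ C u) (X : V) :
    fderiv ℝ (fun z => W z * C z) u X = fderiv ℝ W u X * C u + W u * fderiv ℝ C u X :=
  fderiv_bilinear (LinearMap.mul ℝ _) hW hC X

lemma fderiv_mulVec (hW : DifferentiableAt ℝ W u) (hx : DifferentiableAt ℝ x u) (X : V) :
    fderiv ℝ (fun z => W z *ᵥ x z) u X = fderiv ℝ W u X *ᵥ x u + W u *ᵥ fderiv ℝ x u X :=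
  fderiv_bilinear (mulVecBilin ℝ ℝ) hW hx X

lemma fderiv_dotProduct (hx : DifferentiableAt ℝ x u) (hy : DifferentiableAt ℝ y u) (X : V) :
    fderiv ℝ (fun z => x z ⬝ᵥ y z) u X = fderiv ℝ x u X ⬝ᵥ y u + x u ⬝ᵥ fderiv ℝ y u X :=
  fderiv_bilinear (dotProductBilin ℝ ℝ) hx hy X

lemma fderiv_vecMulVec (hx : DifferentiableAt ℝ x u) (hy : DifferentiableAt ℝ y u) (X : V) :
    fderiv ℝ (fun z => vecMulVec (x z) (y z)) u X =
      vecMulVec (fderiv ℝ x u X) (y u) + vecMulVec (x u) (fderiv ℝ y u X) :=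
  fderiv_bilinear (vecMulVecBilin ℝ ℝ) hx hy X

variable {F : Type*} [NormedAddCommGroup F] [NormedSpace ℝ F] {f f' : V → F}

lemma differentiableAt_of_smoothOn (hU : IsOpen U) (hf : ContDiffOn ℝ ∞ f U) (hu : u ∈ U) :
    DifferentiableAt ℝ f u :=
  (hf.contDiffAt (hU.mem_nhds hu)).differentiableAt (by simp)

lemma fderiv_congr_of_eqOn (hU : IsOpen U) (h : Set.EqOn f f' U) (hu : u ∈ U) :
    fderiv ℝ f u = fderiv ℝ f' u :=
  (h.eventuallyEq_of_mem (hU.mem_nhds hu)).fderiv_eq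

lemma smoothOn_fderiv_apply (hU : IsOpen U) (hf : ContDiffOn ℝ ∞ f U) (X : V) :
    ContDiffOn ℝ ∞ (fun z => fderiv ℝ f z X) U :=
  (hf.fderiv_of_isOpen hU (by simp)).clm_apply contDiffOn_const

lemma fderiv_fderiv_comm (hU : IsOpen U) (hf : ContDiffOn ℝ ∞ f U) (hu : u ∈ U) (X Y : V) :
    fderiv ℝ (fun z => fderiv ℝ f z Y) u X = fderiv ℝ (fun z => fderiv ℝ f z X) u Y := by
  have h : DifferentiableAt ℝ (fderiv ℝ f) u :=
    differentiableAt_of_smoothOn hU (hf.fderiv_of_isOpen hU (by simp)) hu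
  have hs := (hf.contDiffAt (hU.mem_nhds hu)).isSymmSndFDerivAt
    (by simpa using WithTop.coe_le_coe.2 (le_top : (2 : ℕ∞) ≤ ⊤))
  simpa [fderiv_clm_apply h (differentiableAt_const _)] using hs X Y

lemma fderiv_eq_sum_pd {m : ℕ} (f : (Fin m → ℝ) → F) (u X : Fin m → ℝ) :
    fderiv ℝ f u X = ∑ k, X k • pd k f u := by
  conv_lhs => rw [pi_eq_sum_univ' X]
  simp only [map_sum, map_smul, pd]

end Calculus

/-! ### The Levi-Civita connection, Hessians and Codazzi tensors -/

section LeviCivita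

variable {n : ℕ}

/-- The Levi-Civita connection of `g` as a matrix-valued one-form: `∇_X ξ = ∂_X ξ + ω_X ξ`. -/
def connectionForm (g : MatField n) (u : Fin n → ℝ) :
    (Fin n → ℝ) →L[ℝ] Matrix (Fin n) (Fin n) ℝ :=
  ∑ k, (ContinuousLinearMap.proj k).smulRight (of fun i j => christoffel g i k j u)

/-- The curvature two-form `dθ + θ ∧ θ` of a matrix-valued one-form `θ`. -/
def curvatureForm (θ : (Fin n → ℝ) → (Fin n → ℝ) →L[ℝ] Matrix (Fin n) (Fin n) ℝ)
    (u : Fin n → ℝ) : (Fin n → ℝ) →ₗ[ℝ] (Fin n → ℝ) →ₗ[ℝ] Matrix (Fin n) (Fin n) ℝ :=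
  LinearMap.mk₂ ℝ
    (fun X Y => fderiv ℝ θ u X Y - fderiv ℝ θ u Y X + θ u X * θ u Y - θ u Y * θ u X)
    (fun X X' Y => by simp only [map_add, add_mul, mul_add, _root_.add_apply]; abel)
    (fun c X Y => by
      simp only [map_smul, smul_mul_assoc, mul_smul_comm, _root_.smul_apply,
        smul_sub, smul_add])
    (fun X Y Y' => by simp only [map_add, add_mul, mul_add, _root_.add_apply]; abel)
    (fun c X Y => by
      simp only [map_smul, smul_mul_assoc, mul_smul_comm, _root_.smul_apply,
        smul_sub, smul_add])

lemma connectionForm_apply (g : MatField n) (u X : Fin n → ℝ) (i j : Fin n) :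
    connectionForm g u X i j = ∑ k, X k * christoffel g i k j u := by
  simp [connectionForm, Matrix.sum_apply]

lemma connectionForm_single (g : MatField n) (u : Fin n → ℝ) (i j k : Fin n) :
    connectionForm g u (Pi.single k 1) i j = christoffel g i k j u := by
  simp [connectionForm_apply, Pi.single_apply]

lemma connectionForm_mulVec_apply (g : MatField n) (u X Y : Fin n → ℝ) (i : Fin n) :
    (connectionForm g u X *ᵥ Y) i = ∑ k, ∑ j, X k * christoffel g i k j u * Y j := by
  simp only [mulVec, dotProduct, connectionForm_apply, Finset.sum_mul]
  exact Finset.sum_comm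

variable {U : Set (Fin n → ℝ)} {g : MatField n} {u : Fin n → ℝ}

lemma IsMetricOn.isUnit_det (hg : IsMetricOn U g) (hu : u ∈ U) : IsUnit (g u).det :=
  isUnit_iff_ne_zero.2 (hg.nondeg u hu)

lemma IsMetricOn.smoothOn (hg : IsMetricOn U g) : ContDiffOn ℝ ∞ g U :=
  contDiffOn_matrix.2 hg.smooth

lemma IsMetricOn.smoothOn_inv (hg : IsMetricOn U g) : ContDiffOn ℝ ∞ (fun y => (g y)⁻¹) U :=
  contDiffOn_matrix_inv hg.smoothOn hg.nondeg

lemma IsMetricOn.mulVec_dotProduct (hg : IsMetricOn U g) (hu : u ∈ U) (X Y : Fin n → ℝ) :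
    (g u *ᵥ X) ⬝ᵥ Y = X ⬝ᵥ (g u *ᵥ Y) := by
  rw [dotProduct_mulVec, ← mulVec_transpose, (hg.symm u hu).eq]

lemma IsMetricOn.pd_symm (hg : IsMetricOn U g) (hU : IsOpen U) (hu : u ∈ U) (k i j : Fin n) :
    pd k (fun y => g y i j) u = pd k (fun y => g y j i) u := by
  rw [pd, fderiv_congr_of_eqOn hU (fun y hy => (hg.symm y hy).apply j i) hu, pd]

lemma christoffel_symm (hU : IsOpen U) (hg : IsMetricOn U g) (hu : u ∈ U) (i k j : Fin n) :
    christoffel g i k j u = christoffel g i j k u := by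
  unfold christoffel
  congr 1
  refine Finset.sum_congr rfl fun l _ => ?_
  rw [hg.pd_symm hU hu l k j]
  ring

lemma sum_metric_mul_christoffel (hg : IsMetricOn U g) (hu : u ∈ U) (i k j : Fin n) :
    ∑ l, g u i l * christoffel g l k j u = (1 / 2) * (pd k (fun y => g y i j) u +
      pd j (fun y => g y i k) u - pd i (fun y => g y k j) u) := by
  let c : Fin n → ℝ := fun l =>
    pd k (fun y => g y l j) u + pd j (fun y => g y l k) u - pd l (fun y => g y k j) u
  calc ∑ l, g u i l * christoffel g l k j u = (1 / 2) * (g u *ᵥ ((g u)⁻¹ *ᵥ c)) i := by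
        simp only [mulVec, dotProduct, christoffel, Finset.mul_sum, c]
        exact Finset.sum_congr rfl fun l _ => Finset.sum_congr rfl fun m _ => by ring
    _ = _ := by rw [mulVec_mulVec, mul_nonsing_inv _ (hg.isUnit_det hu), one_mulVec]

lemma connectionForm_mulVec_comm (hU : IsOpen U) (hg : IsMetricOn U g) (hu : u ∈ U)
    (X Y : Fin n → ℝ) : connectionForm g u X *ᵥ Y = connectionForm g u Y *ᵥ X := by
  ext i
  rw [connectionForm_mulVec_apply, connectionForm_mulVec_apply, Finset.sum_comm]
  refine Finset.sum_congr rfl fun j _ => Finset.sum_congr rfl fun k _ => ?_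
  rw [christoffel_symm hU hg hu i k j]
  ring

lemma fderiv_metric (hU : IsOpen U) (hg : IsMetricOn U g) (hu : u ∈ U) (X : Fin n → ℝ) :
    fderiv ℝ g u X = (connectionForm g u X)ᵀ * g u + g u * connectionForm g u X := by
  have lower : ∀ i j, (g u * connectionForm g u X) i j =
      ∑ k, X k * ∑ l, g u i l * christoffel g l k j u := fun i j => by
    simp only [mul_apply, connectionForm_apply, Finset.mul_sum]
    rw [Finset.sum_comm]
    exact Finset.sum_congr rfl fun k _ => Finset.sum_congr rfl fun l _ => by ring
  have transpose_mul_metric : (connectionForm g u X)ᵀ * g u = (g u * connectionForm g u X)ᵀ := by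
    rw [transpose_mul, (hg.symm u hu).eq]
  ext i j
  rw [transpose_mul_metric, Matrix.add_apply, transpose_apply, lower, lower,
    ← fderiv_matrix_entry (differentiableAt_of_smoothOn hU hg.smoothOn hu), fderiv_eq_sum_pd,
    ← Finset.sum_add_distrib]
  refine Finset.sum_congr rfl fun k _ => ?_
  rw [sum_metric_mul_christoffel hg hu, sum_metric_mul_christoffel hg hu, hg.pd_symm hU hu k j i,
    hg.pd_symm hU hu j k i, hg.pd_symm hU hu i k j, smul_eq_mul]
  ring

/-- Bilinear forms symmetric in two arguments and skew in two others vanish. This is why the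
Levi-Civita connection is unique. -/
lemma eq_connectionForm (hU : IsOpen U) (hg : IsMetricOn U g) (hu : u ∈ U)
    {θ : (Fin n → ℝ) → Matrix (Fin n) (Fin n) ℝ} (torsion : ∀ X Y, θ X *ᵥ Y = θ Y *ᵥ X)
    (compat : ∀ X, fderiv ℝ g u X = (θ X)ᵀ * g u + g u * θ X) (X : Fin n → ℝ) :
    θ X = connectionForm g u X := by
  let T : (Fin n → ℝ) → (Fin n → ℝ) → (Fin n → ℝ) → ℝ := fun X Y Z =>
    Z ⬝ᵥ (g u *ᵥ ((θ X - connectionForm g u X) *ᵥ Y))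
  have symm : ∀ X Y Z, T X Y Z = T Y X Z := fun X Y Z => by
    simp only [T, sub_mulVec, torsion X Y, connectionForm_mulVec_comm hU hg hu X Y]
  have skew : ∀ X Y Z, T X Y Z = -T X Z Y := fun X Y Z => by
    have h : g u * (θ X - connectionForm g u X) = -((θ X - connectionForm g u X)ᵀ * g u) := by
      rw [mul_sub, transpose_sub, sub_mul, neg_sub, sub_eq_sub_iff_add_eq_add, add_comm,
        ← compat, fderiv_metric hU hg hu, add_comm]
    simp only [T]
    rw [mulVec_mulVec, h, neg_mulVec, dotProduct_neg, ← mulVec_mulVec, mulVec_transpose,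
      dotProduct_comm, ← dotProduct_mulVec, hg.mulVec_dotProduct hu]
  have zero : ∀ X Y Z, T X Y Z = 0 := fun X Y Z => by
    linarith [symm X Y Z, skew X Y Z, symm X Z Y, skew Y X Z, skew Z X Y, symm Y Z X]
  have h : g u * (θ X - connectionForm g u X) = 0  :=
    ext_iff_mulVec.2 fun Y => by
    rw [← mulVec_mulVec, zero_mulVec]
    exact dotProduct_eq_zero _ fun Z => (dotProduct_comm _ _).trans (zero X Y Z)
  have := congrArg ((g u)⁻¹ * ·) h
  simpa [← mul_assoc, nonsing_inv_mul _ (hg.isUnit_det hu), sub_eq_zero] using this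

lemma fderiv_inv_metric (hU : IsOpen U) (hg : IsMetricOn U g) (hu : u ∈ U) (X : Fin n → ℝ) :
    fderiv ℝ (fun y => (g y)⁻¹) u X =
      -(connectionForm g u X * (g u)⁻¹ + (g u)⁻¹ * (connectionForm g u X)ᵀ) := by
  have h : fderiv ℝ (fun y => g y * (g y)⁻¹) u X = 0 := by
    rw [fderiv_congr_of_eqOn (f' := fun _ => 1) hU
      (fun y hy => mul_nonsing_inv _ (hg.isUnit_det hy)) hu]
    simp
  rw [fderiv_matrix_mul (differentiableAt_of_smoothOn hU hg.smoothOn hu)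
    (differentiableAt_of_smoothOn hU hg.smoothOn_inv hu), fderiv_metric hU hg hu] at h
  have hg' := hg.isUnit_det hu
  rw [← nonsing_inv_mul_cancel_left _ (fderiv ℝ (fun y => (g y)⁻¹) u X) hg',
    eq_neg_of_add_eq_zero_right h, add_mul, mul_nonsing_inv_cancel_right _ _ hg', mul_neg, mul_add,
    mul_assoc (g u), nonsing_inv_mul_cancel_left _ _ hg', add_comm]

lemma smoothOn_pd {f : ScalarField n} (hU : IsOpen U) (hf : ContDiffOn ℝ ∞ f U) (k : Fin n) :
    ContDiffOn ℝ ∞ (pd k f) U :=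
  smoothOn_fderiv_apply hU hf _

lemma smoothOn_christoffel (hU : IsOpen U) (hg : IsMetricOn U g) (i k j : Fin n) :
    ContDiffOn ℝ ∞ (christoffel g i k j) U :=
  contDiffOn_const.mul <| ContDiffOn.sum fun l _ =>
    (contDiffOn_matrix.1 hg.smoothOn_inv i l).mul <|
      ((smoothOn_pd hU (hg.smooth l j) k).add (smoothOn_pd hU (hg.smooth l k) j)).sub
        (smoothOn_pd hU (hg.smooth k j) l)

lemma smoothOn_connectionForm (hU : IsOpen U) (hg : IsMetricOn U g) :
    ContDiffOn ℝ ∞ (connectionForm g) U := by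
  refine contDiffOn_clm_apply.2 fun X => contDiffOn_matrix.2 fun i j => ?_
  simp only [connectionForm_apply]
  exact ContDiffOn.sum fun k _ => contDiffOn_const.mul (smoothOn_christoffel hU hg i k j)

lemma curvatureForm_apply (θ : (Fin n → ℝ) → (Fin n → ℝ) →L[ℝ] Matrix (Fin n) (Fin n) ℝ)
    (u X Y : Fin n → ℝ) : curvatureForm θ u X Y =
      fderiv ℝ θ u X Y - fderiv ℝ θ u Y X + θ u X * θ u Y - θ u Y * θ u X := rfl

lemma fderiv_form_apply {θ : (Fin n → ℝ) → (Fin n → ℝ) →L[ℝ] Matrix (Fin n) (Fin n) ℝ}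
    (hθ : DifferentiableAt ℝ θ u) (X Y : Fin n → ℝ) :
    fderiv ℝ θ u X Y = fderiv ℝ (fun y => θ y Y) u X := by
  simp [fderiv_clm_apply hθ (differentiableAt_const _)]

lemma riemann_eq_curvatureForm (hU : IsOpen U) (hg : IsMetricOn U g) (hu : u ∈ U)
    (i s k l : Fin n) : riemann g i s k l u =
      curvatureForm (connectionForm g) u (Pi.single k 1) (Pi.single l 1) i s := by
  have hω := smoothOn_connectionForm hU hg
  have pd_christoffel : ∀ k l, pd k (christoffel g i l s) u =
      fderiv ℝ (connectionForm g) u (Pi.single k 1) (Pi.single l 1) i s := fun k l => by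
    rw [fderiv_form_apply (differentiableAt_of_smoothOn hU hω hu), ← fderiv_matrix_entry
      (differentiableAt_of_smoothOn hU (contDiffOn_clm_apply.1 hω _) hu)]
    simp only [connectionForm_single, pd]
  simp only [riemann, curvatureForm_apply, Matrix.sub_apply, Matrix.add_apply, mul_apply,
    connectionForm_single,
    pd_christoffel, Finset.sum_sub_distrib]
  ring

lemma curvatureForm_eq_zero (hU : IsOpen U) (hg : IsMetricOn U g) (hflat : IsFlatOn U g)
    (hu : u ∈ U) : curvatureForm (connectionForm g) u = 0 :=
  LinearMap.ext_basis (Pi.basisFun ℝ _) (Pi.basisFun ℝ _) fun k l => by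
    ext i s
    simpa [riemann_eq_curvatureForm hU hg hu] using hflat u hu i s k l

end LeviCivita

section Hessian

variable {n : ℕ}

/-- The differential `dF`, as the covector of the partial derivatives of `F`. -/
def differential (F : ScalarField n) (u : Fin n → ℝ) : Fin n → ℝ := fun i => pd i F u

/-- The gradient `∇^i F = g^{ij} F_j`. -/
def gradient (g : MatField n) (F : ScalarField n) (u : Fin n → ℝ) : Fin n → ℝ :=
  (g u)⁻¹ *ᵥ differential F u

/-- The exterior covariant derivative `∇_X (W Y) - ∇_Y (W X)`, for constant `X` and `Y`, of the
affinor `W` with respect to the connection form `θ`. -/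
def extCovDeriv (θ : (Fin n → ℝ) → (Fin n → ℝ) →L[ℝ] Matrix (Fin n) (Fin n) ℝ) (W : MatField n)
    (u X Y : Fin n → ℝ) : Fin n → ℝ :=
  fderiv ℝ W u X *ᵥ Y + θ u X *ᵥ (W u *ᵥ Y) - (fderiv ℝ W u Y *ᵥ X + θ u Y *ᵥ (W u *ᵥ X))

variable {U : Set (Fin n → ℝ)} {g W K : MatField n} {F G E : ScalarField n} {u : Fin n → ℝ}
  {θ θ' : (Fin n → ℝ) → (Fin n → ℝ) →L[ℝ] Matrix (Fin n) (Fin n) ℝ}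

lemma differential_dotProduct (F : ScalarField n) (u X : Fin n → ℝ) :
    differential F u ⬝ᵥ X = fderiv ℝ F u X := by
  simp [fderiv_eq_sum_pd F u X, dotProduct, differential, mul_comm]

lemma smoothOn_differential (hU : IsOpen U) (hF : ContDiffOn ℝ ∞ F U) :
    ContDiffOn ℝ ∞ (differential F) U :=
  contDiffOn_pi.2 fun i => smoothOn_pd hU hF i

lemma smoothOn_gradient (hU : IsOpen U) (hg : IsMetricOn U g) (hF : ContDiffOn ℝ ∞ F U) :
    ContDiffOn ℝ ∞ (gradient g F) U :=
  contDiffOn_mulVec hg.smoothOn_inv (smoothOn_differential hU hF)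

lemma fderiv_differential_dotProduct (hU : IsOpen U) (hF : ContDiffOn ℝ ∞ F U) (hu : u ∈ U)
    (X Y : Fin n → ℝ) :
    fderiv ℝ (differential F) u X ⬝ᵥ Y = fderiv ℝ (fun y => fderiv ℝ F y Y) u X := by
  simp only [← differential_dotProduct F _ Y]
  rw [fderiv_dotProduct (differentiableAt_of_smoothOn hU (smoothOn_differential hU hF) hu)
    (differentiableAt_const _)]
  simp

lemma fderiv_differential_symm (hU : IsOpen U) (hF : ContDiffOn ℝ ∞ F U) (hu : u ∈ U)
    (X Y : Fin n → ℝ) :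
    fderiv ℝ (differential F) u X ⬝ᵥ Y = fderiv ℝ (differential F) u Y ⬝ᵥ X := by
  rw [fderiv_differential_dotProduct hU hF hu, fderiv_differential_dotProduct hU hF hu,
    fderiv_fderiv_comm hU hF hu]

lemma metric_mulVec_gradient (hg : IsMetricOn U g) (hu : u ∈ U) :
    g u *ᵥ gradient g F u = differential F u := by
  rw [gradient, mulVec_mulVec, mul_nonsing_inv _ (hg.isUnit_det hu), one_mulVec]

lemma gradInner_eq (g : MatField n) (F G : ScalarField n) (u : Fin n → ℝ) :
    gradInner g F G u = differential F u ⬝ᵥ gradient g G u := by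
  simp only [gradInner, gradient, differential, dotProduct, mulVec, Finset.mul_sum]
  exact Finset.sum_congr rfl fun i _ => Finset.sum_congr rfl fun j _ => by ring

lemma isFlux_iff : IsFlux U W F E ↔ ∀ u ∈ U, differential F u ᵥ* W u = differential E u :=
  forall₂_congr fun _ _ => funext_iff.symm

lemma IsFlux.differential_dotProduct_mulVec (h : IsFlux U W F E) (hu : u ∈ U) (X : Fin n → ℝ) :
    differential F u ⬝ᵥ (W u *ᵥ X) = differential E u ⬝ᵥ X := by
  rw [dotProduct_mulVec, isFlux_iff.1 h u hu]

lemma metric_mulVec_hess (hU : IsOpen U) (hg : IsMetricOn U g) (hF : ContDiffOn ℝ ∞ F U)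
    (hu : u ∈ U) (X : Fin n → ℝ) : g u *ᵥ (hess g F u *ᵥ X) =
      fderiv ℝ (differential F) u X - (connectionForm g u X)ᵀ *ᵥ differential F u := by
  let C : Matrix (Fin n) (Fin n) ℝ :=
    of fun s j => pd s (pd j F) u - ∑ m, christoffel g m s j u * pd m F u
  have fderiv_entry : ∀ s, fderiv ℝ (differential F) u X s = ∑ j, pd s (pd j F) u * X j :=
    fun s => by
      rw [← dotProduct_single_one (fderiv ℝ _ u X), fderiv_differential_symm hU hF hu, dotProduct]
      refine Finset.sum_congr rfl fun j _ => ?_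
      rw [← fderiv_pi_entry (differentiableAt_of_smoothOn hU (smoothOn_differential hU hF) hu)]
      rfl
  have hess_eq : hess g F u = (g u)⁻¹ * C := by
    ext i j
    simp only [hess, mul_apply, C, of_apply]
  have C_mulVec : C *ᵥ X =
      fderiv ℝ (differential F) u X - (connectionForm g u X)ᵀ *ᵥ differential F u := by
    ext s
    simp only [C, mulVec, dotProduct, of_apply, Pi.sub_apply, fderiv_entry, transpose_apply,
      connectionForm_apply, differential, sub_mul, Finset.sum_sub_distrib, Finset.sum_mul]
    rw [Finset.sum_comm]
    congr! 3 with m _ j _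
    rw [christoffel_symm hU hg hu]
    ring
  rw [hess_eq, mulVec_mulVec, mul_nonsing_inv_cancel_left _ _ (hg.isUnit_det hu), C_mulVec]

lemma isSelfAdjoint_iff {J A : Matrix (Fin n) (Fin n) ℝ} (hJ : J.IsSymm) : J.IsSelfAdjoint A ↔
    ∀ X Y, (J *ᵥ (A *ᵥ X)) ⬝ᵥ Y = (J *ᵥ (A *ᵥ Y)) ⬝ᵥ X := by
  have h : ∀ X Y, (J *ᵥ (A *ᵥ X)) ⬝ᵥ Y = ((Aᵀ * J) *ᵥ Y) ⬝ᵥ X := fun X Y => by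
    rw [mulVec_mulVec, ← vecMul_transpose, ← dotProduct_mulVec, transpose_mul, hJ.eq,
      dotProduct_comm]
  refine ⟨fun hA X Y => by rw [h, hA, ← mulVec_mulVec],
    fun hA => ext_iff_mulVec.2 fun Y => dotProduct_eq _ _ fun X => ?_⟩
  rw [← h, hA, mulVec_mulVec]

lemma isSelfAdjoint_dotProduct_comm {J A C : Matrix (Fin n) (Fin n) ℝ} (hJ : J.IsSymm)
    (hA : J.IsSelfAdjoint A) (hC : J.IsSelfAdjoint C) (h : Commute A C) (X Y : Fin n → ℝ) :
    (A *ᵥ X) ⬝ᵥ (J *ᵥ (C *ᵥ Y)) = (A *ᵥ Y) ⬝ᵥ (J *ᵥ (C *ᵥ X)) := by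
  rw [dotProduct_mulVec, ← mulVec_transpose, hJ.eq, (isSelfAdjoint_iff hJ).1 hA,
    mulVec_mulVec Y A, h.eq, ← mulVec_mulVec, (isSelfAdjoint_iff hJ).1 hC, dotProduct_comm]

lemma hess_isSelfAdjoint (hU : IsOpen U) (hg : IsMetricOn U g) (hF : ContDiffOn ℝ ∞ F U)
    (hu : u ∈ U) : (g u).IsSelfAdjoint (hess g F u) := by
  refine (isSelfAdjoint_iff (hg.symm u hu)).2 fun X Y => ?_
  simp only [metric_mulVec_hess hU hg hF hu, sub_dotProduct, mulVec_transpose,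
    ← dotProduct_mulVec, connectionForm_mulVec_comm hU hg hu X Y,
    fderiv_differential_symm hU hF hu X Y]

lemma hess_mulVec (hU : IsOpen U) (hg : IsMetricOn U g) (hF : ContDiffOn ℝ ∞ F U)
    (hu : u ∈ U) (X : Fin n → ℝ) : hess g F u *ᵥ X =
      fderiv ℝ (gradient g F) u X + connectionForm g u X *ᵥ gradient g F u := by
  have hd := fderiv_mulVec (differentiableAt_of_smoothOn hU hg.smoothOn_inv hu)
    (differentiableAt_of_smoothOn hU (smoothOn_differential hU hF) hu) X
  rw [fderiv_inv_metric hU hg hu] at hd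
  rw [← one_mulVec (hess g F u *ᵥ X), ← nonsing_inv_mul _ (hg.isUnit_det hu), ← mulVec_mulVec,
    metric_mulVec_hess hU hg hF hu]
  unfold gradient
  rw [hd]
  simp only [neg_mulVec, add_mulVec, mulVec_sub, mulVec_mulVec]
  abel

lemma smoothOn_hess (hU : IsOpen U) (hg : IsMetricOn U g) (hF : ContDiffOn ℝ ∞ F U) :
    ContDiffOn ℝ ∞ (hess g F) U :=
  contDiffOn_matrix.2 fun i j => ContDiffOn.sum (s := Finset.univ) fun s _ =>
    (contDiffOn_matrix.1 hg.smoothOn_inv i s).mul <|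
      (smoothOn_pd hU (smoothOn_pd hU hF j) s).sub <| ContDiffOn.sum fun m _ =>
        (smoothOn_christoffel hU hg m s j).mul (smoothOn_pd hU hF m)

lemma gradInner_comm (hg : IsMetricOn U g) (hu : u ∈ U) :
    gradInner g F G u = gradInner g G F u := by
  rw [gradInner_eq, gradInner_eq, ← metric_mulVec_gradient hg hu, hg.mulVec_dotProduct hu,
    metric_mulVec_gradient hg hu, dotProduct_comm]

lemma smoothOn_gradInner (hU : IsOpen U) (hg : IsMetricOn U g) (hF : ContDiffOn ℝ ∞ F U)
    (hG : ContDiffOn ℝ ∞ G U) : ContDiffOn ℝ ∞ (gradInner g F G) U := by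
  simp only [funext (gradInner_eq g F G)]
  exact contDiffOn_dotProduct (smoothOn_differential hU hF)
    (smoothOn_gradient hU hg hG)

lemma fderiv_gradInner (hU : IsOpen U) (hg : IsMetricOn U g) (hF : ContDiffOn ℝ ∞ F U)
    (hG : ContDiffOn ℝ ∞ G U) (hu : u ∈ U) (X : Fin n → ℝ) : fderiv ℝ (gradInner g F G) u X =
      differential F u ⬝ᵥ (hess g G u *ᵥ X) + differential G u ⬝ᵥ (hess g F u *ᵥ X) := by
  simp only [funext (gradInner_eq g F G)]
  rw [fderiv_dotProduct (differentiableAt_of_smoothOn hU (smoothOn_differential hU hF) hu)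
    (differentiableAt_of_smoothOn hU (smoothOn_gradient hU hg hG) hu), hess_mulVec hU hg hG hu,
    ← metric_mulVec_gradient hg hu (F := G), hg.mulVec_dotProduct hu,
    metric_mulVec_hess hU hg hF hu, dotProduct_sub, dotProduct_add,
    dotProduct_comm _ ((connectionForm g u X)ᵀ *ᵥ _), mulVec_transpose, ← dotProduct_mulVec,
    dotProduct_comm (gradient g G u)]
  ring

lemma smoothOn_half_gradInner (hU : IsOpen U)
    (hg : IsMetricOn U g) (hF : ContDiffOn ℝ ∞ F U) :
    ContDiffOn ℝ ∞ (fun u => 1 / 2 * gradInner g F F u) U :=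
  contDiffOn_const.mul (smoothOn_gradInner hU hg hF hF)

lemma isFlux_half_gradInner (hU : IsOpen U)
    (hg : IsMetricOn U g) (hF : ContDiffOn ℝ ∞ F U) :
    IsFlux U (hess g F) F (fun u => 1 / 2 * gradInner g F F u) :=
  isFlux_iff.2 fun u hu => dotProduct_eq _ _ fun X => by
    rw [differential_dotProduct, fderiv_const_mul (differentiableAt_of_smoothOn hU
      (smoothOn_gradInner hU hg hF hF) hu), _root_.smul_apply, fderiv_gradInner hU hg hF hF hu,
      ← dotProduct_mulVec, smul_eq_mul]
    ring

lemma extCovDeriv_hess (hU : IsOpen U) (hg : IsMetricOn U g) (hF : ContDiffOn ℝ ∞ F U)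
    (hu : u ∈ U) (X Y : Fin n → ℝ) : extCovDeriv (connectionForm g) (hess g F) u X Y =
      curvatureForm (connectionForm g) u X Y *ᵥ gradient g F u := by
  have hω := smoothOn_connectionForm hU hg
  have hgrad := smoothOn_gradient hU hg hF
  have fderiv_hess : ∀ X Y, fderiv ℝ (hess g F) u X *ᵥ Y =
      fderiv ℝ (fun y => fderiv ℝ (gradient g F) y Y) u X +
      (fderiv ℝ (connectionForm g) u X Y *ᵥ gradient g F u +
        connectionForm g u Y *ᵥ fderiv ℝ (gradient g F) u X) := fun X Y => by
    have hω' : DifferentiableAt ℝ (fun y => connectionForm g y Y) u :=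
      differentiableAt_of_smoothOn hU (contDiffOn_clm_apply.1 hω Y) hu
    have hgrad' := differentiableAt_of_smoothOn hU hgrad hu
    have h := fderiv_mulVec (differentiableAt_of_smoothOn hU (smoothOn_hess hU hg hF) hu)
      (differentiableAt_const Y) X
    rw [fderiv_fun_const, Pi.zero_apply, _root_.zero_apply, mulVec_zero, add_zero] at h
    rw [← h, fderiv_congr_of_eqOn hU (fun y hy => hess_mulVec hU hg hF hy Y) hu,
      fderiv_fun_add (differentiableAt_of_smoothOn hU (smoothOn_fderiv_apply hU hgrad Y) hu)
        (differentiableAt_of_smoothOn hU (contDiffOn_mulVec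
          (contDiffOn_clm_apply.1 hω Y) hgrad) hu), _root_.add_apply,
      fderiv_mulVec hω' hgrad', fderiv_form_apply (differentiableAt_of_smoothOn hU hω hu)]
  simp only [extCovDeriv, fderiv_hess, hess_mulVec hU hg hF hu, curvatureForm_apply, add_mulVec,
    sub_mulVec, mulVec_add, ← mulVec_mulVec, fderiv_fderiv_comm hU hgrad hu X Y]
  abel

/-- `W` is a smooth affinor which is self-adjoint with respect to the metric `g` and satisfies the
Codazzi equations `∇_i W^k_j = ∇_j W^k_i`. -/
structure IsCodazziOn (U : Set (Fin n → ℝ)) (g W : MatField n) : Prop where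
  smooth : ContDiffOn ℝ ∞ W U
  selfAdjoint : ∀ u ∈ U, (g u).IsSelfAdjoint (W u)
  extCovDeriv_eq_zero : ∀ u ∈ U, ∀ X Y, extCovDeriv (connectionForm g) W u X Y = 0

lemma isCodazziOn_one (hU : IsOpen U) (hg : IsMetricOn U g) : IsCodazziOn U g fun _ => 1 where
  smooth := contDiffOn_const
  selfAdjoint u _ := by simp [Matrix.IsSelfAdjoint, IsAdjointPair]
  extCovDeriv_eq_zero u hu X Y := by
    simp [extCovDeriv, connectionForm_mulVec_comm hU hg hu X Y]

lemma isCodazziOn_hess (hU : IsOpen U) (hg : IsMetricOn U g) (hflat : IsFlatOn U g)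
    (hF : ContDiffOn ℝ ∞ F U) : IsCodazziOn U g (hess g F) where
  smooth := smoothOn_hess hU hg hF
  selfAdjoint _ := hess_isSelfAdjoint hU hg hF
  extCovDeriv_eq_zero u hu X Y := by
    rw [extCovDeriv_hess hU hg hF hu, curvatureForm_eq_zero hU hg hflat hu, LinearMap.zero_apply,
      LinearMap.zero_apply, zero_mulVec]

lemma IsCodazziOn.commute_hess (hW : IsCodazziOn U g W) (hU : IsOpen U) (hg : IsMetricOn U g)
    (hF : ContDiffOn ℝ ∞ F U) (hE : ContDiffOn ℝ ∞ E U) (hFE : IsFlux U W F E) (hu : u ∈ U) :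
    Commute (hess g F u) (W u) := by
  have hd := differentiableAt_of_smoothOn hU (smoothOn_differential hU hF) hu
  have hWX : ∀ X, DifferentiableAt ℝ (fun y => W y *ᵥ X) u := fun X =>
    differentiableAt_of_smoothOn hU (contDiffOn_mulVec hW.smooth contDiffOn_const) hu
  have second : ∀ X Y, (g u *ᵥ (hess g F u *ᵥ X)) ⬝ᵥ (W u *ᵥ Y) + differential F u ⬝ᵥ
      (fderiv ℝ W u X *ᵥ Y + connectionForm g u X *ᵥ (W u *ᵥ Y)) =
        fderiv ℝ (differential E) u X ⬝ᵥ Y := fun X Y => by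
    have h := DFunLike.congr_fun (fderiv_congr_of_eqOn hU
      (fun y hy => hFE.differential_dotProduct_mulVec hy Y) hu) X
    rw [fderiv_dotProduct hd (hWX Y), fderiv_mulVec (differentiableAt_of_smoothOn hU hW.smooth hu)
      (differentiableAt_const Y), fderiv_dotProduct (differentiableAt_of_smoothOn hU
      (smoothOn_differential hU hE) hu) (differentiableAt_const Y)] at h
    simp only [fderiv_fun_const, Pi.zero_apply, _root_.zero_apply, mulVec_zero, add_zero,
      dotProduct_zero] at h
    rw [← h, metric_mulVec_hess hU hg hF hu, sub_dotProduct, mulVec_transpose,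
      ← dotProduct_mulVec, dotProduct_add]
    ring
  have symm : ∀ X Y, (g u *ᵥ (hess g F u *ᵥ X)) ⬝ᵥ (W u *ᵥ Y) =
      (g u *ᵥ (hess g F u *ᵥ Y)) ⬝ᵥ (W u *ᵥ X) := fun X Y => by
    have h := second X Y
    rw [sub_eq_zero.1 (hW.extCovDeriv_eq_zero u hu X Y), fderiv_differential_symm hU hE hu,
      ← second Y X] at h
    exact add_right_cancel h
  refine ext_iff_mulVec.2 fun X => ?_
  have h : g u *ᵥ (hess g F u *ᵥ (W u *ᵥ X)) = g u *ᵥ (W u *ᵥ (hess g F u *ᵥ X)) :=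
    dotProduct_eq _ _ fun Y => by
      rw [(isSelfAdjoint_iff (hg.symm u hu)).1 (hess_isSelfAdjoint hU hg hF hu), ← symm,
        hg.mulVec_dotProduct hu, dotProduct_comm,
        (isSelfAdjoint_iff (hg.symm u hu)).1 (hW.selfAdjoint u hu)]
  rw [← mulVec_mulVec, ← mulVec_mulVec]
  exact mulVec_injective_of_isUnit ((isUnit_iff_isUnit_det _).2 (hg.isUnit_det hu)) h

lemma extCovDeriv_gauge (hW : DifferentiableAt ℝ W u) (hK : DifferentiableAt ℝ K u)
    (gauge : ∀ X, K u * θ' u X = fderiv ℝ K u X + θ u X * K u) (X Y : Fin n → ℝ) :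
    extCovDeriv θ (fun y => K y * W y) u X Y = K u *ᵥ extCovDeriv θ' W u X Y := by
  simp only [extCovDeriv, fderiv_matrix_mul hK hW, mulVec_sub, mulVec_add, mulVec_mulVec,
    ← mul_assoc, gauge, add_mul, add_mulVec]
  abel

lemma curvatureForm_gauge (hU : IsOpen U) (hK : ContDiffOn ℝ ∞ K U) (hθ : ContDiffOn ℝ ∞ θ U)
    (hθ' : ContDiffOn ℝ ∞ θ' U)
    (gauge : ∀ u ∈ U, ∀ X, K u * θ' u X = fderiv ℝ K u X + θ u X * K u) (hu : u ∈ U)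
    (X Y : Fin n → ℝ) : K u * curvatureForm θ' u X Y = curvatureForm θ u X Y * K u := by
  have hK' := differentiableAt_of_smoothOn hU hK hu
  have fderiv_gauge : ∀ X Y, K u * fderiv ℝ θ' u X Y =
      fderiv ℝ (fun y => fderiv ℝ K y Y) u X + (fderiv ℝ θ u X Y * K u +
        θ u Y * fderiv ℝ K u X) - fderiv ℝ K u X * θ' u Y := fun X Y => by
    have hθY := contDiffOn_clm_apply.1 hθ Y
    have hθY' := contDiffOn_clm_apply.1 hθ' Y
    have h := DFunLike.congr_fun (fderiv_congr_of_eqOn hU (fun y hy => gauge y hy Y) hu) X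
    rw [fderiv_matrix_mul hK' (differentiableAt_of_smoothOn hU hθY' hu), fderiv_fun_add
      (differentiableAt_of_smoothOn hU (smoothOn_fderiv_apply hU hK Y) hu)
      (differentiableAt_of_smoothOn hU (contDiffOn_matrix_mul hθY hK) hu),
      _root_.add_apply, fderiv_matrix_mul (differentiableAt_of_smoothOn hU hθY hu) hK',
      ← fderiv_form_apply (differentiableAt_of_smoothOn hU hθ hu),
      ← fderiv_form_apply (differentiableAt_of_smoothOn hU hθ' hu)] at h
    exact eq_sub_of_add_eq' h
  simp only [curvatureForm_apply, mul_add, mul_sub, fderiv_gauge, ← mul_assoc, gauge u hu,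
    add_mul, sub_mul, fderiv_fderiv_comm hU hK hu X Y]
  simp only [mul_assoc, gauge u hu, mul_add]
  abel

end Hessian

section Wedge

variable {n : ℕ}

/-- The skew-adjoint endomorphism `X ↦ (c, X) a - (a, X) c` attached to the bivector `a ∧ c` by
the scalar product with the matrix `G`. -/
def wedge (G : Matrix (Fin n) (Fin n) ℝ) :
    (Fin n → ℝ) →ₗ[ℝ] (Fin n → ℝ) →ₗ[ℝ] Matrix (Fin n) (Fin n) ℝ :=
  LinearMap.compr₂ (vecMulVecBilin ℝ ℝ - (vecMulVecBilin ℝ ℝ).flip) (LinearMap.mulRight ℝ G)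

lemma wedge_apply (G : Matrix (Fin n) (Fin n) ℝ) (a c : Fin n → ℝ) :
    wedge G a c = (vecMulVec a c - vecMulVec c a) * G := rfl

lemma wedge_swap (G : Matrix (Fin n) (Fin n) ℝ) (a c : Fin n → ℝ) :
    wedge G a c = -wedge G c a := by
  rw [wedge_apply, wedge_apply, ← neg_mul, neg_sub]

lemma wedge_self (G : Matrix (Fin n) (Fin n) ℝ) (a : Fin n → ℝ) : wedge G a a = 0 := by
  rw [wedge_apply, sub_self, zero_mul]

lemma wedge_mulVec (G : Matrix (Fin n) (Fin n) ℝ) (a c X : Fin n → ℝ) :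
    wedge G a c *ᵥ X = (c ⬝ᵥ (G *ᵥ X)) • a - (a ⬝ᵥ (G *ᵥ X)) • c := by
  rw [wedge_apply, ← mulVec_mulVec, sub_mulVec, vecMulVec_mulVec, vecMulVec_mulVec,
    op_smul_eq_smul, op_smul_eq_smul]

lemma mul_wedge (G C : Matrix (Fin n) (Fin n) ℝ) (a c : Fin n → ℝ) :
    C * wedge (Cᵀ * G * C) a c = wedge G (C *ᵥ a) (C *ᵥ c) * C := by
  simp only [wedge_apply, ← mul_assoc, mul_sub, sub_mul, mul_vecMulVec, vecMulVec_mul,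
    vecMul_transpose]

lemma transpose_wedge_mul {G : Matrix (Fin n) (Fin n) ℝ} (hG : G.IsSymm) (a c : Fin n → ℝ) :
    (wedge G a c)ᵀ * G = -(G * wedge G a c) := by
  rw [wedge_apply, transpose_mul, transpose_sub, transpose_vecMulVec, transpose_vecMulVec, hG.eq,
    ← mul_assoc, ← neg_mul, ← mul_neg, neg_sub]

lemma commutator_wedge {G ρ : Matrix (Fin n) (Fin n) ℝ} (hρ : ρᵀ * G = -(G * ρ))
    (a c : Fin n → ℝ) :
    ρ * wedge G a c - wedge G a c * ρ = wedge G (ρ *ᵥ a) c + wedge G a (ρ *ᵥ c) := by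
  have h : ∀ x y, vecMulVec x (ρ *ᵥ y) * G = -(vecMulVec x y * G * ρ) := fun x y => by
    rw [mul_assoc, ← mul_neg, ← hρ, ← mul_assoc, vecMulVec_mul x y, vecMul_transpose]
  simp only [wedge_apply, sub_mul, mul_sub, ← mul_assoc, mul_vecMulVec, h]
  abel

lemma wedge_add_wedge_mulVec {G : Matrix (Fin n) (Fin n) ℝ} (hG : G.IsSymm)
    {a b x x' y y' : Fin n → ℝ} (h : y' ⬝ᵥ (G *ᵥ x) = y ⬝ᵥ (G *ᵥ x')) :
    wedge G ((wedge G a x + wedge G b x') *ᵥ a) y + wedge G ((wedge G a x + wedge G b x') *ᵥ b) y' +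
      (wedge G a ((wedge G a y + wedge G b y') *ᵥ x) +
        wedge G b ((wedge G a y + wedge G b y') *ᵥ x')) =
    -((a ⬝ᵥ (G *ᵥ a)) • wedge G x y + (a ⬝ᵥ (G *ᵥ b)) • (wedge G x' y + wedge G x y') +
      (b ⬝ᵥ (G *ᵥ b)) • wedge G x' y') := by
  have symm : ∀ p q : Fin n → ℝ, p ⬝ᵥ (G *ᵥ q) = q ⬝ᵥ (G *ᵥ p) := fun p q => by
    rw [dotProduct_mulVec, ← mulVec_transpose, hG.eq, dotProduct_comm]
  simp only [add_mulVec, wedge_mulVec, map_add, map_sub, map_smul, LinearMap.add_apply,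
    LinearMap.sub_apply, LinearMap.smul_apply, wedge_self, smul_zero, h, symm x a, symm x b,
    symm x' a, symm x' b, symm b a, wedge_swap G b a]
  module

variable {U : Set (Fin n → ℝ)} {g : MatField n} {u : Fin n → ℝ}

lemma smoothOn_wedge (hg : IsMetricOn U g) {a c : (Fin n → ℝ) → Fin n → ℝ}
    (ha : ContDiffOn ℝ ∞ a U) (hc : ContDiffOn ℝ ∞ c U) :
    ContDiffOn ℝ ∞ (fun u => wedge (g u) (a u) (c u)) U :=
  contDiffOn_matrix_mul ((contDiffOn_bilinear (vecMulVecBilin ℝ ℝ) ha hc).sub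
    (contDiffOn_bilinear (vecMulVecBilin ℝ ℝ) hc ha)) hg.smoothOn

lemma fderiv_wedge (hU : IsOpen U) (hg : IsMetricOn U g) (hu : u ∈ U)
    {a c : (Fin n → ℝ) → Fin n → ℝ} (ha : DifferentiableAt ℝ a u) (hc : DifferentiableAt ℝ c u)
    (X : Fin n → ℝ) :
    fderiv ℝ (fun y => wedge (g y) (a y) (c y)) u X +
        (connectionForm g u X * wedge (g u) (a u) (c u) -
          wedge (g u) (a u) (c u) * connectionForm g u X) =
      wedge (g u) (fderiv ℝ a u X + connectionForm g u X *ᵥ a u) (c u) +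
        wedge (g u) (a u) (fderiv ℝ c u X + connectionForm g u X *ᵥ c u) := by
  have hprod : ∀ {a c : (Fin n → ℝ) → Fin n → ℝ}, DifferentiableAt ℝ a u →
      DifferentiableAt ℝ c u → DifferentiableAt ℝ (fun y => vecMulVec (a y) (c y)) u :=
    fun ha hc => differentiableAt_bilinear (vecMulVecBilin ℝ ℝ) ha hc
  have h : ∀ x y : Fin n → ℝ, vecMulVec x y * (connectionForm g u X)ᵀ =
      vecMulVec x (connectionForm g u X *ᵥ y) := fun x y => by
    rw [vecMulVec_mul, vecMul_transpose]
  simp only [wedge_apply]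
  rw [fderiv_matrix_mul ((hprod ha hc).fun_sub (hprod hc ha))
    (differentiableAt_of_smoothOn hU hg.smoothOn hu), fderiv_fun_sub (hprod ha hc) (hprod hc ha),
    _root_.sub_apply, fderiv_vecMulVec ha hc, fderiv_vecMulVec hc ha, fderiv_metric hU hg hu]
  simp only [mul_add, ← mul_assoc, sub_mul, add_mul, mul_sub, h, mul_vecMulVec, vecMulVec_add,
    add_vecMulVec]
  abel

end Wedge

section Curvature

variable {n : ℕ} {U : Set (Fin n → ℝ)} {g W C : MatField n} {f : ScalarField n} {u : Fin n → ℝ}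
  {θ ρ : (Fin n → ℝ) → (Fin n → ℝ) →L[ℝ] Matrix (Fin n) (Fin n) ℝ}

lemma curvatureForm_add (hθ : DifferentiableAt ℝ θ u) (hρ : DifferentiableAt ℝ ρ u)
    (X Y : Fin n → ℝ) : curvatureForm (fun y => θ y + ρ y) u X Y = curvatureForm θ u X Y +
      ((fderiv ℝ (fun y => ρ y Y) u X + (θ u X * ρ u Y - ρ u Y * θ u X)) -
        (fderiv ℝ (fun y => ρ y X) u Y + (θ u Y * ρ u X - ρ u X * θ u Y))) +
      (ρ u X * ρ u Y - ρ u Y * ρ u X) := by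
  simp only [curvatureForm_apply, fderiv_fun_add hθ hρ, _root_.add_apply, ← fderiv_form_apply hρ,
    add_mul, mul_add]
  abel

lemma extCovDeriv_sub (hW : DifferentiableAt ℝ W u) (hC : DifferentiableAt ℝ C u)
    (X Y : Fin n → ℝ) : extCovDeriv θ (fun y => W y - C y) u X Y =
      extCovDeriv θ W u X Y - extCovDeriv θ C u X Y := by
  simp only [extCovDeriv, fderiv_fun_sub hW hC, _root_.sub_apply, sub_mulVec, mulVec_sub]
  abel

lemma extCovDeriv_smul (hf : DifferentiableAt ℝ f u) (hW : DifferentiableAt ℝ W u)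
    (X Y : Fin n → ℝ) : extCovDeriv θ (fun y => f y • W y) u X Y = f u • extCovDeriv θ W u X Y +
      (fderiv ℝ f u X • (W u *ᵥ Y) - fderiv ℝ f u Y • (W u *ᵥ X)) := by
  simp only [extCovDeriv, fderiv_fun_smul hf hW, _root_.add_apply, _root_.smul_apply,
    ContinuousLinearMap.smulRight_apply, add_mulVec, smul_mulVec, mulVec_smul, smul_sub, smul_add]
  abel

lemma curvature_eq (hU : IsOpen U) (hg : IsMetricOn U g) (hu : u ∈ U) (i j k l : Fin n) :
    curvature g i j k l u = (curvatureForm (connectionForm g) u (Pi.single k 1) (Pi.single l 1) *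
      (g u)⁻¹) i j := by
  rw [curvature, mul_apply]
  refine Finset.sum_congr rfl fun s _ => ?_
  rw [riemann_eq_curvatureForm hU hg hu, mul_comm, (hg.symm u hu).inv.apply]

end Curvature

/-! ### The transformed metric and its curvature -/

section ReciprocalTransformation

variable {n : ℕ}

/-- The data of a reciprocal transformation `dX = B dx + A dt`, `dT = N dx + M dt` of the system
`u_t = v u_x`, together with the metric `g` of its Hamiltonian operator. -/
structure Reciprocal (n : ℕ) where
  g : MatField n
  v : MatField n
  B : ScalarField n
  A : ScalarField n
  N : ScalarField n
  M : ScalarField n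

namespace Reciprocal

variable (D : Reciprocal n)

/-- The Jacobian `B M - A N` of the change of independent variables. -/
def delta : ScalarField n := fun u => D.B u * D.M u - D.A u * D.N u

/-- The affinor that expresses the new space derivative through the old one: `u_X = K u_x`. -/
def space : MatField n := fun u => (D.delta u)⁻¹ • (D.M u • 1 - D.N u • D.v u)

/-- The affinor that expresses the new time derivative through `u_x`: `u_T = L u_x`. -/
def time : MatField n := fun u => (D.delta u)⁻¹ • (D.B u • D.v u - D.A u • 1)

/-- The flow `u_s = w u_x` at constant `X` and `T`, where `dX = B dx + A dt + E ds` and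
`dT = N dx + M dt + G ds`, with its right-hand side still expressed through `u_x`. -/
def shifted (w : MatField n) (E G : ScalarField n) : MatField n := fun u =>
  w u - E u • D.space u - G u • D.time u

/-- The transformed metric. -/
abbrev metric : MatField n := newMetric D.B D.A D.N D.M D.v D.g

/-- The transform of `u_t = v u_x`. -/
abbrev velocity : MatField n := newVelocity D.B D.A D.N D.M D.v

/-- The transform of `u_s = w u_x`. -/
abbrev transform (w : MatField n) (E G : ScalarField n) : MatField n :=
  newFlow D.B D.N D.velocity w E G

/-- A flow `u_s = w u_x` to which the transformation extends, by `dX = B dx + A dt + E ds` and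
`dT = N dx + M dt + G ds`, and which keeps the Hamiltonian structure. -/
structure IsTransformable (U : Set (Fin n → ℝ)) (w : MatField n) (E G : ScalarField n) :
    Prop where
  isCodazziOn : IsCodazziOn U D.g w
  smooth_fst : ContDiffOn ℝ ∞ E U
  smooth_snd : ContDiffOn ℝ ∞ G U
  commute : ∀ u ∈ U, Commute (w u) (D.v u)
  isFlux_fst : IsFlux U w D.B E
  isFlux_snd : IsFlux U w D.N G

/-- The conditions under which the transformation is defined on `U`. -/
structure IsAdmissible (U : Set (Fin n → ℝ)) : Prop where
  isOpen : IsOpen U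
  isMetricOn : IsMetricOn U D.g
  smooth_B : ContDiffOn ℝ ∞ D.B U
  smooth_N : ContDiffOn ℝ ∞ D.N U
  delta_ne_zero : ∀ u ∈ U, D.delta u ≠ 0
  det_ne_zero : ∀ u ∈ U, (D.M u • 1 - D.N u • D.v u).det ≠ 0
  isTransformable : D.IsTransformable U D.v D.A D.M

variable {D} {U : Set (Fin n → ℝ)} {u : Fin n → ℝ} {w : MatField n} {E G : ScalarField n}

lemma IsAdmissible.space_time_one (hD : D.IsAdmissible U) (hu : u ∈ U) :
    D.B u • D.space u + D.N u • D.time u = 1 := by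
  calc D.B u • D.space u + D.N u • D.time u =
        ((D.delta u)⁻¹ * (D.B u * D.M u - D.A u * D.N u)) • 1 := by
        simp only [space, time]; module
    _ = 1 := by
        rw [← delta, inv_mul_cancel₀ (hD.delta_ne_zero u hu), one_smul]

lemma IsAdmissible.space_time_velocity (hD : D.IsAdmissible U) (hu : u ∈ U) :
    D.A u • D.space u + D.M u • D.time u = D.v u := by
  calc D.A u • D.space u + D.M u • D.time u =
        ((D.delta u)⁻¹ * (D.B u * D.M u - D.A u * D.N u)) • D.v u := by
        simp only [space, time]; module
    _ = D.v u := by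
        rw [← delta, inv_mul_cancel₀ (hD.delta_ne_zero u hu), one_smul]

lemma commute_space {C : Matrix (Fin n) (Fin n) ℝ} (h : Commute C (D.v u)) :
    Commute C (D.space u) :=
  (((Commute.one_right C).smul_right _).sub_right (h.smul_right _)).smul_right _

lemma commute_time {C : Matrix (Fin n) (Fin n) ℝ} (h : Commute C (D.v u)) :
    Commute C (D.time u) :=
  ((h.smul_right _).sub_right ((Commute.one_right C).smul_right _)).smul_right _

lemma commute_space_time : Commute (D.space u) (D.time u) :=
  commute_time (commute_space (Commute.refl _)).symm

lemma commute_shifted {C : Matrix (Fin n) (Fin n) ℝ} (hw : Commute C (w u))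
    (h : Commute C (D.v u)) : Commute C (D.shifted w E G u) :=
  (hw.sub_right ((commute_space h).smul_right _)).sub_right ((commute_time h).smul_right _)

lemma commute_transform {C : Matrix (Fin n) (Fin n) ℝ} (hw : Commute C (w u))
    (h : Commute C (D.velocity u)) : Commute C (D.transform w E G u) :=
  (((hw.smul_right _).sub_right ((Commute.one_right C).smul_right _)).add_right
    ((hw.mul_right h).smul_right _)).sub_right (h.smul_right _)

lemma IsAdmissible.isTransformable_one (hD : D.IsAdmissible U) :
    D.IsTransformable U (fun _ => 1) D.B D.N where
  isCodazziOn := isCodazziOn_one hD.isOpen hD.isMetricOn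
  smooth_fst := hD.smooth_B
  smooth_snd := hD.smooth_N
  commute _ _ := Commute.one_left _
  isFlux_fst := isFlux_iff.2 fun _ _ => vecMul_one _
  isFlux_snd := isFlux_iff.2 fun _ _ => vecMul_one _

lemma IsAdmissible.smoothOn_delta (hD : D.IsAdmissible U) :
    ContDiffOn ℝ ∞ (fun u => (D.delta u)⁻¹) U :=
  ((hD.smooth_B.mul hD.isTransformable.smooth_snd).sub
    (hD.isTransformable.smooth_fst.mul hD.smooth_N)).inv hD.delta_ne_zero

lemma IsAdmissible.smoothOn_space (hD : D.IsAdmissible U) : ContDiffOn ℝ ∞ D.space U :=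
  hD.smoothOn_delta.smul <| (hD.isTransformable.smooth_snd.smul contDiffOn_const).sub <|
    hD.smooth_N.smul hD.isTransformable.isCodazziOn.smooth

lemma IsAdmissible.smoothOn_time (hD : D.IsAdmissible U) : ContDiffOn ℝ ∞ D.time U :=
  hD.smoothOn_delta.smul <| (hD.smooth_B.smul hD.isTransformable.isCodazziOn.smooth).sub <|
    hD.isTransformable.smooth_fst.smul contDiffOn_const

lemma IsTransformable.smoothOn_shifted (hw : D.IsTransformable U w E G)
    (hD : D.IsAdmissible U) : ContDiffOn ℝ ∞ (D.shifted w E G) U :=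
  (hw.isCodazziOn.smooth.sub (hw.smooth_fst.smul hD.smoothOn_space)).sub
    (hw.smooth_snd.smul hD.smoothOn_time)

lemma IsAdmissible.space_isSelfAdjoint (hD : D.IsAdmissible U) (hu : u ∈ U) :
    (D.g u).IsSelfAdjoint (D.space u) := by
  have h := hD.isTransformable.isCodazziOn.selfAdjoint u hu
  have h1 := hD.isTransformable_one.isCodazziOn.selfAdjoint u hu
  rw [← mem_selfAdjointMatricesSubmodule] at *
  exact Submodule.smul_mem _ _ (Submodule.sub_mem _ (Submodule.smul_mem _ _ h1)
    (Submodule.smul_mem _ _ h))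

lemma IsAdmissible.time_isSelfAdjoint (hD : D.IsAdmissible U) (hu : u ∈ U) :
    (D.g u).IsSelfAdjoint (D.time u) := by
  have h := hD.isTransformable.isCodazziOn.selfAdjoint u hu
  have h1 := hD.isTransformable_one.isCodazziOn.selfAdjoint u hu
  rw [← mem_selfAdjointMatricesSubmodule] at *
  exact Submodule.smul_mem _ _ (Submodule.sub_mem _ (Submodule.smul_mem _ _ h)
    (Submodule.smul_mem _ _ h1))

lemma IsAdmissible.isUnit_space (hD : D.IsAdmissible U) (hu : u ∈ U) : IsUnit (D.space u).det := by
  rw [space, det_smul]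
  exact ((inv_ne_zero (hD.delta_ne_zero u hu)).isUnit.pow _).mul (hD.det_ne_zero u hu).isUnit

lemma metric_eq (D : Reciprocal n) (u : Fin n → ℝ) :
    D.metric u = (D.space u)ᵀ * D.g u * D.space u := by
  simp only [newMetric, space, delta, transpose_smul, smul_mul, mul_smul_comm, smul_smul, pow_two,
    mul_inv, Matrix.smul_mul]

lemma IsAdmissible.space_mul_velocity (hD : D.IsAdmissible U) (hu : u ∈ U) :
    D.space u * D.velocity u = D.time u := by
  have h : Commute (D.space u) (D.B u • D.v u - D.A u • 1) :=
    (((commute_space (Commute.refl (D.v u))).symm).smul_right _).sub_right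
      ((Commute.one_right _).smul_right _)
  rw [velocity, newVelocity, ← mul_assoc, h.eq, space, time, Matrix.mul_smul, Matrix.smul_mul,
    mul_nonsing_inv_cancel_right _ _ (hD.det_ne_zero u hu).isUnit]

lemma IsAdmissible.space_mul_injective (hD : D.IsAdmissible U) (hu : u ∈ U) :
    Function.Injective (D.space u * ·) := fun C C' h => by
  rw [← nonsing_inv_mul_cancel_left (D.space u) C (hD.isUnit_space hu),
    show D.space u * C = D.space u * C' from h,
    nonsing_inv_mul_cancel_left (D.space u) C' (hD.isUnit_space hu)]

lemma IsAdmissible.commute_velocity (hD : D.IsAdmissible U) (hu : u ∈ U)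
    {C : Matrix (Fin n) (Fin n) ℝ} (h : Commute C (D.v u)) : Commute C (D.velocity u) :=
  hD.space_mul_injective hu <| by
    simp only [← mul_assoc]
    rw [hD.space_mul_velocity hu, ← (commute_space h).eq, mul_assoc, hD.space_mul_velocity hu,
      (commute_time h).eq]

lemma IsTransformable.space_mul_transform (hw : D.IsTransformable U w E G)
    (hD : D.IsAdmissible U) (hu : u ∈ U) :
    D.space u * D.transform w E G u = D.shifted w E G u := by
  calc D.space u * D.transform w E G u = D.B u • (D.space u * w u) - E u • D.space u +
        D.N u • (D.space u * w u * D.velocity u) - G u • (D.space u * D.velocity u) := by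
        simp only [newFlow, mul_sub, mul_add, Matrix.mul_smul, mul_one, mul_assoc]
    _ = w u * (D.B u • D.space u + D.N u • D.time u) - E u • D.space u - G u • D.time u := by
        rw [← (commute_space (hw.commute u hu)).eq, mul_assoc (w u), hD.space_mul_velocity hu,
          mul_add, Matrix.mul_smul, Matrix.mul_smul]
        abel
    _ = D.shifted w E G u := by rw [hD.space_time_one hu, mul_one, shifted]

lemma IsAdmissible.isMetricOn_metric (hD : D.IsAdmissible U) : IsMetricOn U D.metric where
  smooth := by
    refine contDiffOn_matrix.1 ?_
    simp only [funext (metric_eq D)]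
    exact contDiffOn_matrix_mul (contDiffOn_matrix_mul (contDiffOn_transpose hD.smoothOn_space)
      hD.isMetricOn.smoothOn) hD.smoothOn_space
  symm u hu := by
    rw [metric_eq, Matrix.IsSymm, transpose_mul, transpose_mul, transpose_transpose,
      (hD.isMetricOn.symm u hu).eq, mul_assoc]
  nondeg u hu := by
    rw [metric_eq, det_mul, det_mul, det_transpose]
    exact mul_ne_zero (mul_ne_zero (hD.isUnit_space hu).ne_zero (hD.isMetricOn.nondeg u hu))
      (hD.isUnit_space hu).ne_zero

/-- The difference between the Levi-Civita connections of the transformed and of the original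
metric, in the frame given by `Reciprocal.space`. -/
def deformation (D : Reciprocal n) (u : Fin n → ℝ) :
    (Fin n → ℝ) →L[ℝ] Matrix (Fin n) (Fin n) ℝ :=
  LinearMap.toContinuousLinearMap <|
    wedge (D.g u) (gradient D.g D.B u) ∘ₗ (D.space u).mulVecLin +
      wedge (D.g u) (gradient D.g D.N u) ∘ₗ (D.time u).mulVecLin

lemma deformation_apply (D : Reciprocal n) (u X : Fin n → ℝ) : D.deformation u X =
    wedge (D.g u) (gradient D.g D.B u) (D.space u *ᵥ X) +
      wedge (D.g u) (gradient D.g D.N u) (D.time u *ᵥ X) := rfl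

/-- The Levi-Civita connection of the transformed metric in the frame given by
`Reciprocal.space`. -/
def frameConnection (D : Reciprocal n) (u : Fin n → ℝ) :
    (Fin n → ℝ) →L[ℝ] Matrix (Fin n) (Fin n) ℝ :=
  connectionForm D.g u + D.deformation u

lemma IsAdmissible.smoothOn_deformation (hD : D.IsAdmissible U) :
    ContDiffOn ℝ ∞ D.deformation U := by
  refine contDiffOn_clm_apply.2 fun X => ?_
  simp only [deformation_apply]
  exact (smoothOn_wedge hD.isMetricOn (smoothOn_gradient hD.isOpen hD.isMetricOn hD.smooth_B)
    (contDiffOn_mulVec hD.smoothOn_space contDiffOn_const)).add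
    (smoothOn_wedge hD.isMetricOn (smoothOn_gradient hD.isOpen hD.isMetricOn hD.smooth_N)
    (contDiffOn_mulVec hD.smoothOn_time contDiffOn_const))

lemma IsAdmissible.smoothOn_frameConnection (hD : D.IsAdmissible U) :
    ContDiffOn ℝ ∞ D.frameConnection U :=
  (smoothOn_connectionForm hD.isOpen hD.isMetricOn).add hD.smoothOn_deformation

lemma IsAdmissible.transpose_deformation_mul (hD : D.IsAdmissible U) (hu : u ∈ U)
    (X : Fin n → ℝ) : (D.deformation u X)ᵀ * D.g u = -(D.g u * D.deformation u X) := by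
  have hsymm := hD.isMetricOn.symm u hu
  rw [deformation_apply, transpose_add, add_mul, transpose_wedge_mul hsymm,
    transpose_wedge_mul hsymm, mul_add, neg_add]

lemma IsAdmissible.gradient_dotProduct (hD : D.IsAdmissible U) (hu : u ∈ U) (F : ScalarField n)
    (X : Fin n → ℝ) : gradient D.g F u ⬝ᵥ (D.g u *ᵥ X) = differential F u ⬝ᵥ X := by
  rw [← hD.isMetricOn.mulVec_dotProduct hu, metric_mulVec_gradient hD.isMetricOn hu]

lemma IsTransformable.deformation_mulVec (hw : D.IsTransformable U w E G)
    (hD : D.IsAdmissible U) (hu : u ∈ U) (X Y : Fin n → ℝ) :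
    D.deformation u X *ᵥ (w u *ᵥ Y) - D.deformation u Y *ᵥ (w u *ᵥ X) =
      fderiv ℝ E u X • (D.space u *ᵥ Y) - fderiv ℝ E u Y • (D.space u *ᵥ X) +
        (fderiv ℝ G u X • (D.time u *ᵥ Y) - fderiv ℝ G u Y • (D.time u *ᵥ X)) := by
  have symm : ∀ {C}, (D.g u).IsSelfAdjoint C → Commute (w u) C →
      (C *ᵥ X) ⬝ᵥ (D.g u *ᵥ (w u *ᵥ Y)) = (C *ᵥ Y) ⬝ᵥ (D.g u *ᵥ (w u *ᵥ X)) := fun hC hwC =>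
    isSelfAdjoint_dotProduct_comm (hD.isMetricOn.symm u hu) hC
      (hw.isCodazziOn.selfAdjoint u hu) hwC.symm X Y
  simp only [deformation_apply, add_mulVec, wedge_mulVec, hD.gradient_dotProduct hu,
    hw.isFlux_fst.differential_dotProduct_mulVec hu,
    hw.isFlux_snd.differential_dotProduct_mulVec hu, differential_dotProduct]
  rw [symm (hD.space_isSelfAdjoint hu) (commute_space (hw.commute u hu)),
    symm (hD.time_isSelfAdjoint hu) (commute_time (hw.commute u hu))]
  abel

/-- The differentials of the fluxes produced by the deformation of the connection cancel those of
the coefficients of `Reciprocal.shifted`. -/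
lemma IsTransformable.extCovDeriv_shifted (hw : D.IsTransformable U w E G)
    (hD : D.IsAdmissible U) (hu : u ∈ U) (X Y : Fin n → ℝ) :
    extCovDeriv D.frameConnection (D.shifted w E G) u X Y =
      -(E u • extCovDeriv D.frameConnection D.space u X Y) -
        G u • extCovDeriv D.frameConnection D.time u X Y := by
  have diff : ∀ {F : Type} [NormedAddCommGroup F] [NormedSpace ℝ F] {f : (Fin n → ℝ) → F},
      ContDiffOn ℝ ∞ f U → DifferentiableAt ℝ f u := fun hf =>
    differentiableAt_of_smoothOn hD.isOpen hf hu
  have hK := diff hD.smoothOn_space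
  have hL := diff hD.smoothOn_time
  have hE := diff hw.smooth_fst
  have hG := diff hw.smooth_snd
  have hw' := diff hw.isCodazziOn.smooth
  have extCovDeriv_w : extCovDeriv D.frameConnection w u X Y =
      D.deformation u X *ᵥ (w u *ᵥ Y) - D.deformation u Y *ᵥ (w u *ᵥ X) := by
    rw [← add_zero (_ - _), ← hw.isCodazziOn.extCovDeriv_eq_zero u hu X Y]
    simp only [extCovDeriv, frameConnection, _root_.add_apply, add_mulVec]
    abel
  unfold shifted
  rw [extCovDeriv_sub (hw'.fun_sub (hE.fun_smul hK)) (hG.fun_smul hL),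
    extCovDeriv_sub hw' (hE.fun_smul hK), extCovDeriv_smul hE hK, extCovDeriv_smul hG hL,
    extCovDeriv_w, hw.deformation_mulVec hD hu]
  abel

/-- The flows `u_x` and `v u_x` become stationary, so that `IsTransformable.extCovDeriv_shifted`
determines `extCovDeriv` of `space` and `time` by a linear system with the determinant `delta`. -/
lemma IsAdmissible.extCovDeriv_space_time (hD : D.IsAdmissible U) (hu : u ∈ U)
    (X Y : Fin n → ℝ) : extCovDeriv D.frameConnection D.space u X Y = 0 ∧
      extCovDeriv D.frameConnection D.time u X Y = 0 := by
  have stationary : ∀ {w E G}, Set.EqOn (D.shifted w E G) (fun _ => 0) U →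
      extCovDeriv D.frameConnection (D.shifted w E G) u X Y = 0 := fun {w E G} h => by
    simp [extCovDeriv, fderiv_congr_of_eqOn hD.isOpen h hu, h hu]
  have one : Set.EqOn (D.shifted (fun _ => 1) D.B D.N) (fun _ => 0) U := fun y hy => by
    rw [shifted, sub_sub, hD.space_time_one hy, sub_self]
  have velocity : Set.EqOn (D.shifted D.v D.A D.M) (fun _ => 0) U := fun y hy => by
    rw [shifted, sub_sub, hD.space_time_velocity hy, sub_self]
  have h₁ := stationary one
  have h₂ := stationary velocity
  rw [hD.isTransformable_one.extCovDeriv_shifted hD hu] at h₁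
  rw [hD.isTransformable.extCovDeriv_shifted hD hu] at h₂
  set k := extCovDeriv D.frameConnection D.space u X Y
  set l := extCovDeriv D.frameConnection D.time u X Y
  have hδ := hD.delta_ne_zero u hu
  constructor
  · refine (smul_eq_zero_iff_right hδ).1 ?_
    calc D.delta u • k = D.N u • (-(D.A u • k) - D.M u • l) -
          D.M u • (-(D.B u • k) - D.N u • l) := by simp only [delta]; module
      _ = 0 := by rw [h₁, h₂, smul_zero, smul_zero, sub_zero]
  · refine (smul_eq_zero_iff_right hδ).1 ?_
    calc D.delta u • l = D.A u • (-(D.B u • k) - D.N u • l) -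
          D.B u • (-(D.A u • k) - D.M u • l) := by simp only [delta]; module
      _ = 0 := by rw [h₁, h₂, smul_zero, smul_zero, sub_zero]

end Reciprocal

end ReciprocalTransformation

section TransformedConnection

namespace Reciprocal

variable {n : ℕ} {D : Reciprocal n} {U : Set (Fin n → ℝ)} {u : Fin n → ℝ} {w : MatField n}
  {E G : ScalarField n}

lemma IsTransformable.extCovDeriv_shifted_eq_zero (hw : D.IsTransformable U w E G)
    (hD : D.IsAdmissible U) (hu : u ∈ U) (X Y : Fin n → ℝ) :
    extCovDeriv D.frameConnection (D.shifted w E G) u X Y = 0 := by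
  obtain ⟨hK, hL⟩ := hD.extCovDeriv_space_time hu X Y
  rw [hw.extCovDeriv_shifted hD hu, hK, hL, smul_zero, smul_zero, neg_zero, sub_zero]

/-- The right-hand side, brought to the coordinate frame, is symmetric because `space` is a
Codazzi tensor of the frame connection, and metric because the deformation is skew-adjoint. -/
lemma IsAdmissible.space_mul_connectionForm (hD : D.IsAdmissible U) (hu : u ∈ U)
    (X : Fin n → ℝ) : D.space u * connectionForm D.metric u X =
      fderiv ℝ D.space u X + D.frameConnection u X * D.space u := by
  let θ' : (Fin n → ℝ) → Matrix (Fin n) (Fin n) ℝ := fun X =>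
    (D.space u)⁻¹ * (fderiv ℝ D.space u X + D.frameConnection u X * D.space u)
  have mul_θ' : ∀ X, D.space u * θ' X =
      fderiv ℝ D.space u X + D.frameConnection u X * D.space u := fun X =>
    mul_nonsing_inv_cancel_left _ _ (hD.isUnit_space hu)
  have torsion : ∀ X Y, θ' X *ᵥ Y = θ' Y *ᵥ X := fun X Y => by
    have h := sub_eq_zero.1 (hD.extCovDeriv_space_time hu X Y).1
    simp only [mulVec_mulVec, ← add_mulVec, ← mul_θ'] at h
    simp only [← mulVec_mulVec] at h
    exact mulVec_injective_of_isUnit ((isUnit_iff_isUnit_det _).2 (hD.isUnit_space hu)) h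
  have compat : ∀ X, fderiv ℝ D.metric u X = (θ' X)ᵀ * D.metric u + D.metric u * θ' X := by
    intro X
    have diff : ∀ {W : MatField n}, ContDiffOn ℝ ∞ W U → DifferentiableAt ℝ W u := fun hW =>
      differentiableAt_of_smoothOn hD.isOpen hW hu
    have hKt := contDiffOn_transpose hD.smoothOn_space
    have hg := hD.isMetricOn.smoothOn
    have hρ := congrArg ((D.space u)ᵀ * · * D.space u) (hD.transpose_deformation_mul hu X)
    calc fderiv ℝ D.metric u X = (D.space u * θ' X)ᵀ * D.g u * D.space u +
          (D.space u)ᵀ * D.g u * (D.space u * θ' X) := by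
          rw [funext (metric_eq D), fderiv_matrix_mul (diff (contDiffOn_matrix_mul hKt hg))
            (diff hD.smoothOn_space), fderiv_matrix_mul (diff hKt) (diff hg),
            fderiv_transpose (diff hD.smoothOn_space), fderiv_metric hD.isOpen hD.isMetricOn hu,
            mul_θ', frameConnection, _root_.add_apply, transpose_add, transpose_mul,
            transpose_add]
          linear_combination (norm := noncomm_ring) -hρ
      _ = (θ' X)ᵀ * D.metric u + D.metric u * θ' X := by
          simp only [metric_eq, transpose_mul, mul_assoc]
  rw [← eq_connectionForm hD.isOpen hD.isMetricOn_metric hu torsion compat, mul_θ']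

lemma IsAdmissible.isCodazziOn_metric (hD : D.IsAdmissible U) {W S : MatField n}
    (hWS : ∀ u ∈ U, D.space u * W u = S u) (smooth : ContDiffOn ℝ ∞ S U)
    (selfAdjoint : ∀ u ∈ U, (D.g u).IsSelfAdjoint (S u))
    (commute : ∀ u ∈ U, Commute (D.space u) (S u))
    (codazzi : ∀ u ∈ U, ∀ X Y, extCovDeriv D.frameConnection S u X Y = 0) :
    IsCodazziOn U D.metric W := by
  have hW : ContDiffOn ℝ ∞ W U :=
    (contDiffOn_matrix_mul (contDiffOn_matrix_inv hD.smoothOn_space fun u hu =>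
      (hD.isUnit_space hu).ne_zero) smooth).congr fun u hu => by
        rw [← hWS u hu, nonsing_inv_mul_cancel_left _ _ (hD.isUnit_space hu)]
  refine ⟨hW, fun u hu => ?_, fun u hu X Y => ?_⟩
  · have hK : (D.space u)ᵀ * D.g u = D.g u * D.space u := hD.space_isSelfAdjoint hu
    have hS : (S u)ᵀ * D.g u = D.g u * S u := selfAdjoint u hu
    calc (W u)ᵀ * D.metric u = (D.space u * W u)ᵀ * D.g u * D.space u := by
          simp only [metric_eq, transpose_mul, mul_assoc]
      _ = D.g u * (S u * D.space u) := by rw [hWS u hu, hS, mul_assoc]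
      _ = (D.space u)ᵀ * D.g u * (D.space u * W u) := by
          rw [← (commute u hu).eq, ← mul_assoc, ← hK, hWS u hu]
      _ = D.metric u * W u := by rw [metric_eq, mul_assoc _ (D.space u)]
  · have h := extCovDeriv_gauge (differentiableAt_of_smoothOn hD.isOpen hW hu)
      (differentiableAt_of_smoothOn hD.isOpen hD.smoothOn_space hu)
      (hD.space_mul_connectionForm hu) X Y
    have h' : extCovDeriv D.frameConnection (fun y => D.space y * W y) u X Y = 0 := by
      rw [← codazzi u hu X Y]
      simp only [extCovDeriv, fderiv_congr_of_eqOn hD.isOpen hWS hu, hWS u hu]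
    refine mulVec_injective_of_isUnit ((isUnit_iff_isUnit_det _).2 (hD.isUnit_space hu)) ?_
    rw [← h, h', mulVec_zero]

lemma IsAdmissible.isCodazziOn_velocity (hD : D.IsAdmissible U) :
    IsCodazziOn U D.metric D.velocity :=
  hD.isCodazziOn_metric (fun _ => hD.space_mul_velocity) hD.smoothOn_time
    (fun _ => hD.time_isSelfAdjoint) (fun _ _ => commute_space_time)
    fun _ hu X Y => (hD.extCovDeriv_space_time hu X Y).2

lemma IsTransformable.isCodazziOn_transform (hw : D.IsTransformable U w E G)
    (hD : D.IsAdmissible U) : IsCodazziOn U D.metric (D.transform w E G) := by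
  refine hD.isCodazziOn_metric (fun _ => hw.space_mul_transform hD) (hw.smoothOn_shifted hD)
    (fun u hu => ?_) (fun u hu => ?_) fun _ hu => hw.extCovDeriv_shifted_eq_zero hD hu
  · have hW := hw.isCodazziOn.selfAdjoint u hu
    have hK := hD.space_isSelfAdjoint hu
    have hL := hD.time_isSelfAdjoint hu
    rw [← mem_selfAdjointMatricesSubmodule] at *
    exact Submodule.sub_mem _ (Submodule.sub_mem _ hW (Submodule.smul_mem _ _ hK))
      (Submodule.smul_mem _ _ hL)
  · exact commute_shifted (commute_space (hw.commute u hu)).symm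
      (commute_space (Commute.refl _)).symm

lemma IsTransformable.commute_velocity_transform (hw : D.IsTransformable U w E G)
    (hD : D.IsAdmissible U) (hu : u ∈ U) : Commute (D.velocity u) (D.transform w E G u) :=
  commute_transform (hD.commute_velocity hu (hw.commute u hu)).symm (Commute.refl _)

end Reciprocal

end TransformedConnection

section TransformedCurvature

namespace Reciprocal

variable {n : ℕ} {D : Reciprocal n} {U : Set (Fin n → ℝ)} {u : Fin n → ℝ}

variable (D) in
/-- The extension of the transformation to the Hamiltonian flows with the densities `N` and `B`
by the fluxes `P`, `R` and `Q`, `S`. -/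
structure IsExtension (U : Set (Fin n → ℝ)) (P Q R S : ScalarField n) : Prop where
  smooth_P : ContDiffOn ℝ ∞ P U
  smooth_S : ContDiffOn ℝ ∞ S U
  isFlux_P : IsFlux U (hess D.g D.N) D.B P
  isFlux_S : IsFlux U (hess D.g D.B) D.N S
  add_eq : ∀ u ∈ U, P u + S u = gradInner D.g D.B D.N u
  eq_Q : ∀ u, Q u = 1 / 2 * gradInner D.g D.B D.B u
  eq_R : ∀ u, R u = 1 / 2 * gradInner D.g D.N D.N u

variable {P Q R S : ScalarField n}

lemma IsAdmissible.isTransformable_hess (hD : D.IsAdmissible U) (hflat : IsFlatOn U D.g)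
    {H F E G : ScalarField n} (hH : ContDiffOn ℝ ∞ H U) (hF : ContDiffOn ℝ ∞ F U)
    (hE : ContDiffOn ℝ ∞ E U) (hG : ContDiffOn ℝ ∞ G U) (hHF : IsFlux U D.v H F)
    (hBE : IsFlux U (hess D.g H) D.B E) (hNG : IsFlux U (hess D.g H) D.N G) :
    D.IsTransformable U (hess D.g H) E G where
  isCodazziOn := isCodazziOn_hess hD.isOpen hD.isMetricOn hflat hH
  smooth_fst := hE
  smooth_snd := hG
  commute _ := hD.isTransformable.isCodazziOn.commute_hess hD.isOpen hD.isMetricOn hH hF hHF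
  isFlux_fst := hBE
  isFlux_snd := hNG

lemma IsExtension.isTransformable_B (h : D.IsExtension U P Q R S) (hD : D.IsAdmissible U)
    (hflat : IsFlatOn U D.g) : D.IsTransformable U (hess D.g D.B) Q S :=
  hD.isTransformable_hess hflat hD.smooth_B hD.isTransformable.smooth_fst
    (funext h.eq_Q ▸ smoothOn_half_gradInner hD.isOpen hD.isMetricOn hD.smooth_B) h.smooth_S
    hD.isTransformable.isFlux_fst
    (funext h.eq_Q ▸ isFlux_half_gradInner hD.isOpen hD.isMetricOn hD.smooth_B) h.isFlux_S

lemma IsExtension.isTransformable_N (h : D.IsExtension U P Q R S) (hD : D.IsAdmissible U)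
    (hflat : IsFlatOn U D.g) : D.IsTransformable U (hess D.g D.N) P R :=
  hD.isTransformable_hess hflat hD.smooth_N hD.isTransformable.smooth_snd h.smooth_P
    (funext h.eq_R ▸ smoothOn_half_gradInner hD.isOpen hD.isMetricOn hD.smooth_N)
    hD.isTransformable.isFlux_snd h.isFlux_P
    (funext h.eq_R ▸ isFlux_half_gradInner hD.isOpen hD.isMetricOn hD.smooth_N)

lemma IsAdmissible.fderiv_deformation (hD : D.IsAdmissible U) (hu : u ∈ U) (X Y : Fin n → ℝ) :
    fderiv ℝ (fun y => D.deformation y Y) u X + (connectionForm D.g u X * D.deformation u Y -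
        D.deformation u Y * connectionForm D.g u X) =
      wedge (D.g u) (hess D.g D.B u *ᵥ X) (D.space u *ᵥ Y) +
      wedge (D.g u) (gradient D.g D.B u)
        (fderiv ℝ D.space u X *ᵥ Y + connectionForm D.g u X *ᵥ (D.space u *ᵥ Y)) +
      (wedge (D.g u) (hess D.g D.N u *ᵥ X) (D.time u *ᵥ Y) +
      wedge (D.g u) (gradient D.g D.N u)
        (fderiv ℝ D.time u X *ᵥ Y + connectionForm D.g u X *ᵥ (D.time u *ᵥ Y))) := by
  have diff : ∀ {f : (Fin n → ℝ) → Fin n → ℝ}, ContDiffOn ℝ ∞ f U → DifferentiableAt ℝ f u :=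
    fun hf => differentiableAt_of_smoothOn hD.isOpen hf hu
  have summand : ∀ {F : ScalarField n} {C : MatField n}, ContDiffOn ℝ ∞ F U →
      ContDiffOn ℝ ∞ C U →
      DifferentiableAt ℝ (fun y => wedge (D.g y) (gradient D.g F y) (C y *ᵥ Y)) u ∧
      fderiv ℝ (fun y => wedge (D.g y) (gradient D.g F y) (C y *ᵥ Y)) u X +
        (connectionForm D.g u X * wedge (D.g u) (gradient D.g F u) (C u *ᵥ Y) -
          wedge (D.g u) (gradient D.g F u) (C u *ᵥ Y) * connectionForm D.g u X) =
      wedge (D.g u) (hess D.g F u *ᵥ X) (C u *ᵥ Y) + wedge (D.g u) (gradient D.g F u)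
        (fderiv ℝ C u X *ᵥ Y + connectionForm D.g u X *ᵥ (C u *ᵥ Y)) := fun {F C} hF hC => by
    have ha := smoothOn_gradient hD.isOpen hD.isMetricOn hF
    have hc := contDiffOn_mulVec hC (contDiffOn_const (c := Y))
    refine ⟨differentiableAt_of_smoothOn hD.isOpen (smoothOn_wedge hD.isMetricOn ha hc) hu, ?_⟩
    rw [fderiv_wedge hD.isOpen hD.isMetricOn hu (diff ha) (diff hc),
      hess_mulVec hD.isOpen hD.isMetricOn hF hu,
      fderiv_mulVec (differentiableAt_of_smoothOn hD.isOpen hC hu) (differentiableAt_const Y)]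
    simp
  obtain ⟨hB, hB'⟩ := summand hD.smooth_B hD.smoothOn_space
  obtain ⟨hN, hN'⟩ := summand hD.smooth_N hD.smoothOn_time
  simp only [deformation_apply]
  rw [← hB', ← hN', fderiv_fun_add hB hN, _root_.add_apply]
  noncomm_ring

lemma IsAdmissible.deformation_commutator (hD : D.IsAdmissible U) (hu : u ∈ U)
    (X Y : Fin n → ℝ) :
    D.deformation u X * D.deformation u Y - D.deformation u Y * D.deformation u X =
      wedge (D.g u) (D.deformation u X *ᵥ gradient D.g D.B u) (D.space u *ᵥ Y) +
      wedge (D.g u) (gradient D.g D.B u) (D.deformation u X *ᵥ (D.space u *ᵥ Y)) +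
      (wedge (D.g u) (D.deformation u X *ᵥ gradient D.g D.N u) (D.time u *ᵥ Y) +
      wedge (D.g u) (gradient D.g D.N u) (D.deformation u X *ᵥ (D.time u *ᵥ Y))) := by
  have hρ := hD.transpose_deformation_mul hu X
  rw [deformation_apply D u Y, mul_add, add_mul, add_sub_add_comm, commutator_wedge hρ,
    commutator_wedge hρ]

lemma covDeriv_eq_of_extCovDeriv_eq_zero {C : MatField n} {X Y : Fin n → ℝ}
    (h : extCovDeriv D.frameConnection C u X Y = 0) :
    fderiv ℝ C u X *ᵥ Y + connectionForm D.g u X *ᵥ (C u *ᵥ Y) =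
      fderiv ℝ C u Y *ᵥ X + connectionForm D.g u Y *ᵥ (C u *ᵥ X) +
        (D.deformation u Y *ᵥ (C u *ᵥ X) - D.deformation u X *ᵥ (C u *ᵥ Y)) := by
  rw [← sub_eq_zero, ← h]
  simp only [extCovDeriv, frameConnection, _root_.add_apply, add_mulVec]
  abel

/-- The terms with `∇B ∧ ·` and `∇N ∧ ·` produced by the derivative of the deformation combine by
the Codazzi equations for `space` and `time` with those of its square. -/
lemma IsAdmissible.curvatureForm_frameConnection (hD : D.IsAdmissible U) (hflat : IsFlatOn U D.g)
    (hu : u ∈ U) (X Y : Fin n → ℝ) : curvatureForm D.frameConnection u X Y =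
      wedge (D.g u) (hess D.g D.B u *ᵥ X) (D.space u *ᵥ Y) +
      wedge (D.g u) (D.space u *ᵥ X) (hess D.g D.B u *ᵥ Y) +
      wedge (D.g u) (hess D.g D.N u *ᵥ X) (D.time u *ᵥ Y) +
      wedge (D.g u) (D.time u *ᵥ X) (hess D.g D.N u *ᵥ Y) -
      (gradInner D.g D.B D.B u • wedge (D.g u) (D.space u *ᵥ X) (D.space u *ᵥ Y) +
      gradInner D.g D.B D.N u • (wedge (D.g u) (D.time u *ᵥ X) (D.space u *ᵥ Y) +
        wedge (D.g u) (D.space u *ᵥ X) (D.time u *ᵥ Y)) +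
      gradInner D.g D.N D.N u • wedge (D.g u) (D.time u *ᵥ X) (D.time u *ᵥ Y)) := by
  have hsymm := hD.isMetricOn.symm u hu
  have flat : curvatureForm (connectionForm D.g) u X Y = 0 := by
    rw [curvatureForm_eq_zero hD.isOpen hD.isMetricOn hflat hu, LinearMap.zero_apply,
      LinearMap.zero_apply]
  have pairing : (D.time u *ᵥ Y) ⬝ᵥ (D.g u *ᵥ (D.space u *ᵥ X)) =
      (D.space u *ᵥ Y) ⬝ᵥ (D.g u *ᵥ (D.time u *ᵥ X)) := by
    rw [isSelfAdjoint_dotProduct_comm hsymm (hD.time_isSelfAdjoint hu)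
      (hD.space_isSelfAdjoint hu) commute_space_time.symm, ← hD.isMetricOn.mulVec_dotProduct hu,
      dotProduct_comm]
  have cancel := wedge_add_wedge_mulVec hsymm (a := gradient D.g D.B u)
    (b := gradient D.g D.N u) pairing
  rw [← deformation_apply, ← deformation_apply] at cancel
  simp only [gradInner_eq, ← hD.gradient_dotProduct hu]
  rw [sub_eq_add_neg, ← cancel]
  unfold frameConnection
  rw [curvatureForm_add (differentiableAt_of_smoothOn hD.isOpen
      (smoothOn_connectionForm hD.isOpen hD.isMetricOn) hu)
    (differentiableAt_of_smoothOn hD.isOpen hD.smoothOn_deformation hu), flat,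
    hD.deformation_commutator hu,
    hD.fderiv_deformation hu, hD.fderiv_deformation hu,
    covDeriv_eq_of_extCovDeriv_eq_zero (hD.extCovDeriv_space_time hu X Y).1,
    covDeriv_eq_of_extCovDeriv_eq_zero (hD.extCovDeriv_space_time hu X Y).2,
    wedge_swap _ (D.space u *ᵥ X) (hess _ _ u *ᵥ Y),
    wedge_swap _ (D.time u *ᵥ X) (hess _ _ u *ᵥ Y)]
  simp only [map_add, map_sub]
  abel

lemma IsExtension.curvatureForm_frameConnection (h : D.IsExtension U P Q R S)
    (hD : D.IsAdmissible U) (hflat : IsFlatOn U D.g) (hu : u ∈ U) (X Y : Fin n → ℝ) :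
    curvatureForm D.frameConnection u X Y =
      wedge (D.g u) (D.shifted (hess D.g D.B) Q S u *ᵥ X) (D.space u *ᵥ Y) +
      wedge (D.g u) (D.space u *ᵥ X) (D.shifted (hess D.g D.B) Q S u *ᵥ Y) +
      wedge (D.g u) (D.shifted (hess D.g D.N) P R u *ᵥ X) (D.time u *ᵥ Y) +
      wedge (D.g u) (D.time u *ᵥ X) (D.shifted (hess D.g D.N) P R u *ᵥ Y) := by
  rw [hD.curvatureForm_frameConnection hflat hu, ← h.add_eq u hu]
  simp only [shifted, sub_mulVec, smul_mulVec, map_sub, map_smul, LinearMap.sub_apply,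
    LinearMap.smul_apply, h.eq_Q, h.eq_R]
  module

lemma IsExtension.curvatureForm_metric (h : D.IsExtension U P Q R S)
    (hD : D.IsAdmissible U) (hflat : IsFlatOn U D.g) (hu : u ∈ U) (X Y : Fin n → ℝ) :
    curvatureForm (connectionForm D.metric) u X Y =
      wedge (D.metric u) (D.transform (hess D.g D.B) Q S u *ᵥ X) Y +
      wedge (D.metric u) X (D.transform (hess D.g D.B) Q S u *ᵥ Y) +
      wedge (D.metric u) (D.transform (hess D.g D.N) P R u *ᵥ X) (D.velocity u *ᵥ Y) +
      wedge (D.metric u) (D.velocity u *ᵥ X) (D.transform (hess D.g D.N) P R u *ᵥ Y) := by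
  refine hD.space_mul_injective hu ?_
  simp only [mul_add, metric_eq, mul_wedge, mulVec_mulVec, hD.space_mul_velocity hu,
    (h.isTransformable_B hD hflat).space_mul_transform hD hu,
    (h.isTransformable_N hD hflat).space_mul_transform hD hu]
  rw [← add_mul, ← add_mul, ← add_mul, ← h.curvatureForm_frameConnection hD hflat hu]
  exact curvatureForm_gauge hD.isOpen hD.smoothOn_space hD.smoothOn_frameConnection
    (smoothOn_connectionForm hD.isOpen hD.isMetricOn_metric)
    (fun u hu => hD.space_mul_connectionForm hu) hu X Y

lemma IsExtension.curvature_metric (h : D.IsExtension U P Q R S) (hD : D.IsAdmissible U)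
    (hflat : IsFlatOn U D.g) (hu : u ∈ U) (i j k l : Fin n) :
    curvature D.metric i j k l u =
      D.transform (hess D.g D.B) Q S u i k * (1 : Matrix (Fin n) (Fin n) ℝ) j l
        + D.transform (hess D.g D.B) Q S u j l * (1 : Matrix (Fin n) (Fin n) ℝ) i k
        - D.transform (hess D.g D.B) Q S u j k * (1 : Matrix (Fin n) (Fin n) ℝ) i l
        - D.transform (hess D.g D.B) Q S u i l * (1 : Matrix (Fin n) (Fin n) ℝ) j k
        + D.transform (hess D.g D.N) P R u i k * D.velocity u j l
        + D.transform (hess D.g D.N) P R u j l * D.velocity u i k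
        - D.transform (hess D.g D.N) P R u j k * D.velocity u i l
        - D.transform (hess D.g D.N) P R u i l * D.velocity u j k := by
  have wedge_mul_inv : ∀ a c : Fin n → ℝ, wedge (D.metric u) a c * (D.metric u)⁻¹ =
      vecMulVec a c - vecMulVec c a := fun a c =>
    mul_nonsing_inv_cancel_right _ _ (hD.isMetricOn_metric.isUnit_det hu)
  rw [curvature_eq hD.isOpen hD.isMetricOn_metric hu, h.curvatureForm_metric hD hflat hu]
  simp only [add_mul, wedge_mul_inv, mulVec_single_one, Matrix.add_apply, Matrix.sub_apply,
    vecMulVec_apply, col_apply, one_apply, Pi.single_apply]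
  ring

end Reciprocal

end TransformedCurvature

/-! ### The transformed flows and densities -/

section Flows

variable {n : ℕ} {U : Set (Fin n → ℝ)} {g v w : MatField n} {c V : ℝ → Fin n → ℝ}

lemma IsCurveIn.hasDerivAt (hc : IsCurveIn U c) (x : ℝ) : HasDerivAt c (deriv c x) x :=
  (hc.smooth.differentiable (by simp) x).hasDerivAt

lemma IsCurveIn.smooth_deriv (hc : IsCurveIn U c) : ContDiff ℝ ∞ (deriv c) :=
  (contDiff_infty_iff_deriv.1 hc.smooth).2

lemma IsCurveIn.smooth_flow (hc : IsCurveIn U c) (hw : ContDiffOn ℝ ∞ w U) :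
    ContDiff ℝ ∞ (flow w c) :=
  contDiffOn_univ.1 <| contDiffOn_mulVec
    (hw.comp hc.smooth.contDiffOn fun x _ => hc.mem x) hc.smooth_deriv.contDiffOn

lemma hasDerivAt_comp_curve {E : Type*} [NormedAddCommGroup E] [NormedSpace ℝ E]
    {f : (Fin n → ℝ) → E} {X : Fin n → ℝ} {x : ℝ} (hU : IsOpen U) (hf : ContDiffOn ℝ ∞ f U)
    (hx : c x ∈ U) (hc : HasDerivAt c X x) :
    HasDerivAt (fun y => f (c y)) (fderiv ℝ f (c x) X) x :=
  (differentiableAt_of_smoothOn hU hf hx).hasFDerivAt.comp_hasDerivAt x hc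

lemma IsCurveIn.hasDerivAt_flow (hc : IsCurveIn U c) (hU : IsOpen U) (hw : ContDiffOn ℝ ∞ w U)
    (x : ℝ) : HasDerivAt (flow w c)
      (fderiv ℝ w (c x) (deriv c x) *ᵥ deriv c x + w (c x) *ᵥ deriv (deriv c) x) x :=
  hasDerivAt_mulVec (hasDerivAt_comp_curve hU hw (hc.mem x) (hc.hasDerivAt x))
    (hc.smooth_deriv.differentiable (by simp) x).hasDerivAt

lemma hasDerivAt_add_smul {E : Type*} [NormedAddCommGroup E] [NormedSpace ℝ E] (a b : E) (t : ℝ) :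
    HasDerivAt (fun ε : ℝ => a + ε • b) b t := by
  simpa using ((hasDerivAt_id t).smul_const b).const_add a

lemma IsCurveIn.deriv_add_smul (hc : IsCurveIn U c) (hV : Differentiable ℝ V) (ε x : ℝ) :
    deriv (c + ε • V) x = deriv c x + ε • deriv V x :=
  ((hc.hasDerivAt x).add ((hV x).hasDerivAt.const_smul ε)).deriv

lemma IsCurveIn.hasDerivAt_comp_variation {E : Type*} [NormedAddCommGroup E] [NormedSpace ℝ E]
    {f : (Fin n → ℝ) → E} (hc : IsCurveIn U c) (hU : IsOpen U) (hf : ContDiffOn ℝ ∞ f U)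
    (V : ℝ → Fin n → ℝ) (x : ℝ) :
    HasDerivAt (fun ε : ℝ => f ((c + ε • V) x)) (fderiv ℝ f (c x) (V x)) 0 := by
  have h := hasDerivAt_comp_curve (c := fun ε : ℝ => c x + ε • V x) (x := 0) hU hf
    (by simpa using hc.mem x) (hasDerivAt_add_smul _ _ _)
  simpa using h

lemma IsCurveIn.hasDerivAt_flow_variation (hc : IsCurveIn U c) (hU : IsOpen U)
    (hV : Differentiable ℝ V) (hw : ContDiffOn ℝ ∞ w U) (x : ℝ) :
    HasDerivAt (fun ε : ℝ => flow w (c + ε • V) x)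
      (fderiv ℝ w (c x) (V x) *ᵥ deriv c x + w (c x) *ᵥ deriv V x) 0 := by
  simp only [flow, hc.deriv_add_smul hV]
  simpa using hasDerivAt_mulVec (hc.hasDerivAt_comp_variation hU hw V x)
    (hasDerivAt_add_smul (deriv c x) (deriv V x) 0)

lemma IsCodazziOn.flowsCommute (hv : IsCodazziOn U g v) (hw : IsCodazziOn U g w) (hU : IsOpen U)
    (hg : IsMetricOn U g) (commute : ∀ u ∈ U, Commute (v u) (w u)) : FlowsCommute U v w := by
  intro c hc x
  have hx := hc.mem x
  have differentiable_flow : ∀ {W : MatField n}, ContDiffOn ℝ ∞ W U →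
      Differentiable ℝ (flow W c) := fun hW => (hc.smooth_flow hW).differentiable (by simp)
  have hvw := hc.hasDerivAt_flow_variation hU (differentiable_flow hv.smooth) hw.smooth x
  have hwv := hc.hasDerivAt_flow_variation hU (differentiable_flow hw.smooth) hv.smooth x
  rw [(hc.hasDerivAt_flow hU hv.smooth x).deriv] at hvw
  rw [(hc.hasDerivAt_flow hU hw.smooth x).deriv] at hwv
  refine ⟨_, hvw, ?_⟩
  convert hwv using 1
  simp only [flow] at *
  set X := deriv c x
  have diff : ∀ {W : MatField n}, ContDiffOn ℝ ∞ W U → DifferentiableAt ℝ W (c x) := fun hW =>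
    differentiableAt_of_smoothOn hU hW hx
  have codazzi_w := hw.extCovDeriv_eq_zero _ hx (v (c x) *ᵥ X) X
  have codazzi_v := hv.extCovDeriv_eq_zero _ hx (w (c x) *ᵥ X) X
  have torsion := connectionForm_mulVec_comm hU hg hx (v (c x) *ᵥ X) (w (c x) *ᵥ X)
  have leibniz := DFunLike.congr_fun (fderiv_congr_of_eqOn hU
    (f := fun y => v y * w y) (f' := fun y => w y * v y) (fun y hy => (commute y hy).eq) hx) X
  rw [fderiv_matrix_mul (diff hv.smooth) (diff hw.smooth),
    fderiv_matrix_mul (diff hw.smooth) (diff hv.smooth)] at leibniz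
  replace leibniz := congrArg (· *ᵥ X) leibniz
  have commute_X : v (c x) *ᵥ (w (c x) *ᵥ X) = w (c x) *ᵥ (v (c x) *ᵥ X) := by
    rw [mulVec_mulVec, (commute _ hx).eq, ← mulVec_mulVec]
  simp only [extCovDeriv, add_mulVec, ← mulVec_mulVec, mulVec_add, commute_X] at *
  rw [mulVec_mulVec (deriv (deriv c) x), ← (commute _ hx).eq, ← mulVec_mulVec]
  linear_combination codazzi_w - codazzi_v - leibniz - torsion

namespace Reciprocal

variable {D : Reciprocal n} {u a b : Fin n → ℝ} {E G : ScalarField n}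

lemma transform_mulVec : D.transform w E G u *ᵥ a =
    w u *ᵥ (D.B u • a + D.N u • (D.velocity u *ᵥ a)) - E u • a - G u • (D.velocity u *ᵥ a) := by
  simp only [newFlow, add_mulVec, sub_mulVec, smul_mulVec, one_mulVec, mulVec_add, mulVec_smul,
    mulVec_mulVec]
  abel

lemma IsAdmissible.eq_velocity_mulVec (hD : D.IsAdmissible U) (hu : u ∈ U)
    (h : D.A u • a + D.M u • b = D.v u *ᵥ (D.B u • a + D.N u • b)) :
    b = D.velocity u *ᵥ a := by
  refine mulVec_injective_of_isUnit ((isUnit_iff_isUnit_det _).2 (hD.isUnit_space hu)) ?_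
  rw [mulVec_mulVec, hD.space_mul_velocity hu, space, time, smul_mulVec, smul_mulVec]
  congr 1
  simp only [sub_mulVec, smul_mulVec, one_mulVec, mulVec_add, mulVec_smul] at h ⊢
  linear_combination h

lemma pd_comp_reciprocal {Ω : Set (Fin 4 → ℝ)} {c ct : (Fin 4 → ℝ) → Fin n → ℝ}
    {X T : (Fin 4 → ℝ) → ℝ} (hΩ : IsOpen Ω) (hX : DifferentiableOn ℝ X Ω)
    (hT : DifferentiableOn ℝ T Ω)
    (h : ∀ p ∈ Ω, DifferentiableAt ℝ ct ![X p, T p, p 2, p 3] ∧ c p = ct ![X p, T p, p 2, p 3])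
    {p : Fin 4 → ℝ} (hp : p ∈ Ω) (k : Fin 4) :
    pd k c p = pd k X p • pd 0 ct ![X p, T p, p 2, p 3] +
      pd k T p • pd 1 ct ![X p, T p, p 2, p 3] +
      (Pi.single k 1 : Fin 4 → ℝ) 2 • pd 2 ct ![X p, T p, p 2, p 3] +
      (Pi.single k 1 : Fin 4 → ℝ) 3 • pd 3 ct ![X p, T p, p 2, p 3] := by
  have coordinate : ∀ i : Fin 4, HasFDerivAt (fun y : Fin 4 → ℝ => y i)
      (ContinuousLinearMap.proj i : (Fin 4 → ℝ) →L[ℝ] ℝ) p := fun i => hasFDerivAt_apply i p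
  have change : HasFDerivAt (fun y => (![X y, T y, y 2, y 3] : Fin 4 → ℝ))
      (ContinuousLinearMap.pi ![fderiv ℝ X p, fderiv ℝ T p, .proj 2, .proj 3]) p := by
    refine hasFDerivAt_pi.2 fun i => ?_
    fin_cases i
    exacts [((hX p hp).differentiableAt (hΩ.mem_nhds hp)).hasFDerivAt,
      ((hT p hp).differentiableAt (hΩ.mem_nhds hp)).hasFDerivAt, coordinate 2, coordinate 3]
  have comp := (h p hp).1.hasFDerivAt.comp p change
  have eqOn : Set.EqOn c (ct ∘ fun y => ![X y, T y, y 2, y 3]) Ω := fun y hy => (h y hy).2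
  rw [pd, (eqOn.eventuallyEq_of_mem (hΩ.mem_nhds hp)).fderiv_eq, comp.fderiv,
    ContinuousLinearMap.comp_apply, fderiv_eq_sum_pd, Fin.sum_univ_four]
  rfl

lemma IsAdmissible.transformsFlows (hD : D.IsAdmissible U) (w₁ w₂ : MatField n)
    (P Q R S : ScalarField n) : TransformsFlows U D.B D.A P Q D.N D.M R S D.v w₁ w₂ D.velocity
      (D.transform w₁ P R) (D.transform w₂ Q S) := by
  intro Ω c ct X T hΩ _ hX hT hU hflow hdX hdT h p hp q hq
  have chain := pd_comp_reciprocal hΩ hX hT h hp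
  rw [← hq] at chain
  have hct : ct q = c p := by rw [hq, (h p hp).2]
  obtain ⟨flow_t, flow_τ, flow_ζ⟩ := hflow p hp
  obtain ⟨dX_x, dX_t, dX_τ, dX_ζ⟩ := hdX p hp
  obtain ⟨dT_x, dT_t, dT_τ, dT_ζ⟩ := hdT p hp
  simp only [chain, dX_x, dX_t, dX_τ, dX_ζ, dT_x, dT_t, dT_τ, dT_ζ, Pi.single_apply, Fin.reduceEq,
    if_true, if_false, one_smul, zero_smul, add_zero] at flow_t flow_τ flow_ζ
  have velocity_eq := hD.eq_velocity_mulVec (hU p hp) flow_t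
  rw [velocity_eq] at flow_τ flow_ζ
  rw [hct, transform_mulVec, transform_mulVec, ← flow_τ, ← flow_ζ]
  exact ⟨velocity_eq, by abel, by abel⟩

end Reciprocal

end Flows

section Generation

variable {n m : ℕ} {U : Set (Fin n → ℝ)} {g : MatField n} {u : Fin n → ℝ} {c : ℝ → Fin n → ℝ}
  {H : ScalarField n}

lemma NonlocalOp.localPart_eq (J : NonlocalOp n m) (hU : IsOpen U) (hg : IsMetricOn U J.metric)
    (ξ : ℝ → Fin n → ℝ) {x : ℝ} (hx : c x ∈ U) : J.localPart c ξ x = (J.metric (c x))⁻¹ *ᵥ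
      (deriv ξ x - (connectionForm J.metric (c x) (deriv c x))ᵀ *ᵥ ξ x) := by
  ext i
  rw [mulVec_sub, Pi.sub_apply]
  simp only [localPart, mulVec, dotProduct, Finset.sum_sub_distrib, transpose_apply,
    connectionForm_apply, Finset.sum_mul, Finset.mul_sum]
  congr 1
  rw [Finset.sum_comm]
  refine Finset.sum_congr rfl fun s _ => Finset.sum_congr rfl fun j _ =>
    Finset.sum_congr rfl fun k _ => ?_
  rw [christoffel_symm hU hg hx j s k]
  ring

lemma NonlocalOp.localPart_differential (J : NonlocalOp n m) (hU : IsOpen U)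
    (hg : IsMetricOn U J.metric) (hc : IsCurveIn U c) (hH : ContDiffOn ℝ ∞ H U) (x : ℝ) :
    J.localPart c (fun y j => pd j H (c y)) x = flow (hess J.metric H) c x := by
  have h : HasDerivAt (fun y j => pd j H (c y)) (fderiv ℝ (differential H) (c x) (deriv c x)) x :=
    hasDerivAt_comp_curve hU (smoothOn_differential hU hH) (hc.mem x) (hc.hasDerivAt x)
  rw [J.localPart_eq hU hg _ (hc.mem x), h.deriv]
  change _ *ᵥ (_ - _ *ᵥ differential H (c x)) = _
  rw [← metric_mulVec_hess hU hg hH (hc.mem x), mulVec_mulVec,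
    nonsing_inv_mul _ (hg.isUnit_det (hc.mem x)), one_mulVec, flow]

lemma exists_isCurveIn (hU : IsOpen U) (hu : u ∈ U) (X : Fin n → ℝ) :
    ∃ (c : ℝ → Fin n → ℝ) (r : ℝ), r ≠ 0 ∧ IsCurveIn U c ∧ c 0 = u ∧ deriv c 0 = r • X := by
  have line : ∀ᶠ t : ℝ in nhds 0, u + t • X ∈ U :=
    (hasDerivAt_add_smul u X 0).continuousAt.eventually_mem (by simpa using hU.mem_nhds hu)
  obtain ⟨r, hr, h⟩ := Metric.eventually_nhds_iff.1 line
  refine ⟨fun t => u + (r / 2 * Real.sin t) • X, r / 2, by positivity, ⟨?_, fun t => h ?_⟩,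
    by simp, ?_⟩
  · exact contDiff_const.add ((contDiff_const.mul Real.contDiff_sin).smul contDiff_const)
  · rw [Real.dist_eq, sub_zero, abs_mul, abs_of_pos (by positivity)]
    nlinarith [Real.abs_sin_le_one t]
  · have := (((Real.hasDerivAt_sin 0).const_mul (r / 2)).smul_const X).const_add u
    simpa using this.deriv

lemma NonlocalOp.Generates.eq_hess {w : MatField n} (h : (localOp g).Generates U H w)
    (hU : IsOpen U) (hg : IsMetricOn U g) (hH : ContDiffOn ℝ ∞ H U) (hu : u ∈ U) :
    w u = hess g H u := by
  obtain ⟨φ, -, -, h⟩ := h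
  refine Matrix.ext_iff_mulVec.2 fun X => ?_
  obtain ⟨c, r, hr, hc, rfl, hX⟩ := exists_isCurveIn hU hu X
  have eq := h c hc 0
  rw [applyWith, (localOp g).localPart_differential hU hg hc hH, Finset.univ_eq_empty,
    Finset.sum_empty, add_zero, flow, flow, hX, mulVec_smul, mulVec_smul] at eq
  exact smul_right_injective _ hr eq

lemma IsFlux.congr {w w' : MatField n} (h : IsFlux U w F E) (hw : ∀ u ∈ U, w u = w' u) :
    IsFlux U w' F E := fun u hu => hw u hu ▸ h u hu

lemma NonlocalOp.Generates.congr {J : NonlocalOp n m} {w w' : MatField n}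
    (h : J.Generates U H w) (hw : ∀ u ∈ U, w' u = w u) : J.Generates U H w' := by
  obtain ⟨φ, smooth, isFlux, eq⟩ := h
  refine ⟨φ, smooth, isFlux, fun c hc x => ?_⟩
  rw [← eq c hc x, flow, flow, hw _ (hc.mem x)]

/-- A flux is determined up to a constant, which adds a multiple of the left factor of its tail
to the flow. -/
lemma NonlocalOp.Generates.add_left {J : NonlocalOp n m} {w : MatField n}
    (h : J.Generates U H w) (α : Fin m) : J.Generates U H fun u => w u + J.left α u := by
  obtain ⟨φ, smooth, isFlux, eq⟩ := h
  refine ⟨fun β u => φ β u + if β = α then 1 else 0, fun β => (smooth β).add contDiffOn_const,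
    fun β u hu j => ?_, fun c hc x => ?_⟩
  · rw [isFlux β u hu j, pd, pd, fderiv_add_const]
  · have eq := eq c hc x
    simp only [flow, applyWith, add_smul, Finset.sum_add_distrib, ite_smul, one_smul,
      zero_smul, Finset.sum_ite_eq', Finset.mem_univ, if_true] at eq ⊢
    rw [add_mulVec, eq, add_assoc]

end Generation

section TransformedDensity

namespace Reciprocal

variable {n : ℕ}

/-- The density `H̃` of the transform `H̃ dX + F̃ dT` of the conservation law `H dx + F dt`. -/
def density (D : Reciprocal n) (H F : ScalarField n) : ScalarField n := fun u =>
  (H u * D.M u - F u * D.N u) / D.delta u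

/-- The flux `F̃` of the transform `H̃ dX + F̃ dT` of the conservation law `H dx + F dt`. -/
def densityFlux (D : Reciprocal n) (H F : ScalarField n) : ScalarField n := fun u =>
  (D.B u * F u - D.A u * H u) / D.delta u

/-- The gradient of the transformed density, in the frame given by `Reciprocal.space`. -/
def frameGradient (D : Reciprocal n) (H F : ScalarField n) (u : Fin n → ℝ) : Fin n → ℝ :=
  gradient D.g H u - D.density H F u • gradient D.g D.B u -
    D.densityFlux H F u • gradient D.g D.N u

variable {D : Reciprocal n} {U : Set (Fin n → ℝ)} {u : Fin n → ℝ} {H F : ScalarField n}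

lemma IsAdmissible.smoothOn_density (hD : D.IsAdmissible U) (hH : ContDiffOn ℝ ∞ H U)
    (hF : ContDiffOn ℝ ∞ F U) : ContDiffOn ℝ ∞ (D.density H F) U :=
  ((hH.mul hD.isTransformable.smooth_snd).sub (hF.mul hD.smooth_N)).mul hD.smoothOn_delta

lemma IsAdmissible.smoothOn_densityFlux (hD : D.IsAdmissible U) (hH : ContDiffOn ℝ ∞ H U)
    (hF : ContDiffOn ℝ ∞ F U) : ContDiffOn ℝ ∞ (D.densityFlux H F) U :=
  ((hD.smooth_B.mul hF).sub (hD.isTransformable.smooth_fst.mul hH)).mul hD.smoothOn_delta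

lemma IsAdmissible.density_mul_add (hD : D.IsAdmissible U) (hu : u ∈ U) (H F : ScalarField n) :
    D.density H F u * D.B u + D.densityFlux H F u * D.N u = H u ∧
      D.density H F u * D.A u + D.densityFlux H F u * D.M u = F u := by
  have hδ := hD.delta_ne_zero u hu
  unfold density densityFlux
  constructor <;>
  · rw [div_mul_eq_mul_div, div_mul_eq_mul_div, ← add_div, div_eq_iff hδ, delta]
    ring

lemma IsAdmissible.frameGradient_dotProduct (hD : D.IsAdmissible U) (hu : u ∈ U)
    (H F : ScalarField n) (Y : Fin n → ℝ) : D.frameGradient H F u ⬝ᵥ (D.g u *ᵥ Y) =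
      differential H u ⬝ᵥ Y - D.density H F u * (differential D.B u ⬝ᵥ Y) -
        D.densityFlux H F u * (differential D.N u ⬝ᵥ Y) := by
  simp only [frameGradient, sub_dotProduct, smul_dotProduct, smul_eq_mul,
    hD.gradient_dotProduct hu]

lemma IsAdmissible.fderiv_density_mul_add (hD : D.IsAdmissible U) (hH : ContDiffOn ℝ ∞ H U)
    (hF : ContDiffOn ℝ ∞ F U) {a b f : ScalarField n} (ha : ContDiffOn ℝ ∞ a U)
    (hb : ContDiffOn ℝ ∞ b U)
    (h : ∀ u ∈ U, D.density H F u * a u + D.densityFlux H F u * b u = f u) (hu : u ∈ U)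
    (X : Fin n → ℝ) : D.density H F u * fderiv ℝ a u X + a u * fderiv ℝ (D.density H F) u X +
      (D.densityFlux H F u * fderiv ℝ b u X + b u * fderiv ℝ (D.densityFlux H F) u X) =
        fderiv ℝ f u X := by
  have diff : ∀ {f : ScalarField n}, ContDiffOn ℝ ∞ f U → DifferentiableAt ℝ f u := fun hf =>
    differentiableAt_of_smoothOn hD.isOpen hf hu
  have hd := diff (hD.smoothOn_density hH hF)
  have hφ := diff (hD.smoothOn_densityFlux hH hF)
  rw [← DFunLike.congr_fun (fderiv_congr_of_eqOn hD.isOpen h hu) X,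
    fderiv_fun_add (hd.fun_mul (diff ha)) (hφ.fun_mul (diff hb)), fderiv_fun_mul hd (diff ha),
    fderiv_fun_mul hφ (diff hb)]
  simp only [_root_.add_apply, _root_.smul_apply, smul_eq_mul]

/-- The differentials of `H` and `F` give a linear system for those of the transformed density
and flux, with the determinant `delta`. -/
lemma IsAdmissible.fderiv_density (hD : D.IsAdmissible U) (hH : ContDiffOn ℝ ∞ H U)
    (hF : ContDiffOn ℝ ∞ F U) (hHF : IsFlux U D.v H F) (hu : u ∈ U) (X : Fin n → ℝ) :
    fderiv ℝ (D.density H F) u X = D.frameGradient H F u ⬝ᵥ (D.g u *ᵥ (D.space u *ᵥ X)) ∧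
    fderiv ℝ (D.densityFlux H F) u X =
      D.frameGradient H F u ⬝ᵥ (D.g u *ᵥ (D.time u *ᵥ X)) := by
  have hv := hD.isTransformable
  have dH := hD.fderiv_density_mul_add hH hF hD.smooth_B hD.smooth_N
    (fun u hu => (hD.density_mul_add hu H F).1) hu X
  have dF := hD.fderiv_density_mul_add hH hF hv.smooth_fst hv.smooth_snd
    (fun u hu => (hD.density_mul_add hu H F).2) hu X
  simp only [space, time, smul_mulVec, sub_mulVec, one_mulVec, mulVec_smul, mulVec_sub,
    dotProduct_smul, dotProduct_sub, smul_eq_mul, hD.frameGradient_dotProduct hu,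
    hv.isFlux_fst.differential_dotProduct_mulVec hu,
    hv.isFlux_snd.differential_dotProduct_mulVec hu, hHF.differential_dotProduct_mulVec hu]
  simp only [differential_dotProduct]
  rw [eq_inv_mul_iff_mul_eq₀ (hD.delta_ne_zero u hu),
    eq_inv_mul_iff_mul_eq₀ (hD.delta_ne_zero u hu), delta]
  constructor
  · linear_combination D.M u * dH - D.N u * dF
  · linear_combination D.B u * dF - D.A u * dH

lemma IsAdmissible.space_mulVec_gradient_density (hD : D.IsAdmissible U)
    (hH : ContDiffOn ℝ ∞ H U) (hF : ContDiffOn ℝ ∞ F U) (hHF : IsFlux U D.v H F) (hu : u ∈ U) :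
    D.space u *ᵥ gradient D.metric (D.density H F) u = D.frameGradient H F u := by
  have hKg : IsUnit ((D.space u)ᵀ * D.g u) := (isUnit_iff_isUnit_det _).2 <| by
    rw [det_mul, det_transpose]
    exact (hD.isUnit_space hu).mul (hD.isMetricOn.isUnit_det hu)
  refine mulVec_injective_of_isUnit hKg ?_
  rw [mulVec_mulVec, ← metric_eq, metric_mulVec_gradient hD.isMetricOn_metric hu]
  refine dotProduct_eq _ _ fun X => ?_
  rw [differential_dotProduct, (hD.fderiv_density hH hF hHF hu X).1, ← mulVec_mulVec,
    mulVec_transpose, ← dotProduct_mulVec, hD.isMetricOn.mulVec_dotProduct hu]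

lemma IsAdmissible.fderiv_frameGradient (hD : D.IsAdmissible U) (hH : ContDiffOn ℝ ∞ H U)
    (hF : ContDiffOn ℝ ∞ F U) (hu : u ∈ U) (X : Fin n → ℝ) :
    fderiv ℝ (D.frameGradient H F) u X +
        connectionForm D.g u X *ᵥ D.frameGradient H F u =
      hess D.g H u *ᵥ X - D.density H F u • (hess D.g D.B u *ᵥ X) -
        D.densityFlux H F u • (hess D.g D.N u *ᵥ X) -
        fderiv ℝ (D.density H F) u X • gradient D.g D.B u -
        fderiv ℝ (D.densityFlux H F) u X • gradient D.g D.N u := by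
  have diff : ∀ {E : Type} [NormedAddCommGroup E] [NormedSpace ℝ E] {f : (Fin n → ℝ) → E},
      ContDiffOn ℝ ∞ f U → DifferentiableAt ℝ f u := fun hf =>
    differentiableAt_of_smoothOn hD.isOpen hf hu
  have grad : ∀ {f : ScalarField n}, ContDiffOn ℝ ∞ f U →
      DifferentiableAt ℝ (gradient D.g f) u := fun hf =>
    diff (smoothOn_gradient hD.isOpen hD.isMetricOn hf)
  have hd := diff (hD.smoothOn_density hH hF)
  have hφ := diff (hD.smoothOn_densityFlux hH hF)
  have hB := grad hD.smooth_B
  have hN := grad hD.smooth_N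
  unfold frameGradient
  rw [fderiv_fun_sub ((grad hH).fun_sub (hd.fun_smul hB)) (hφ.fun_smul hN),
    fderiv_fun_sub (grad hH) (hd.fun_smul hB), fderiv_fun_smul hd hB, fderiv_fun_smul hφ hN]
  simp only [hess_mulVec hD.isOpen hD.isMetricOn hH hu,
    hess_mulVec hD.isOpen hD.isMetricOn hD.smooth_B hu,
    hess_mulVec hD.isOpen hD.isMetricOn hD.smooth_N hu, mulVec_sub, mulVec_smul,
    _root_.add_apply, _root_.sub_apply, _root_.smul_apply, ContinuousLinearMap.smulRight_apply]
  module

lemma IsAdmissible.space_mulVec_hess_density (hD : D.IsAdmissible U) (hH : ContDiffOn ℝ ∞ H U)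
    (hF : ContDiffOn ℝ ∞ F U) (hHF : IsFlux U D.v H F) (hu : u ∈ U) (X : Fin n → ℝ) :
    D.space u *ᵥ (hess D.metric (D.density H F) u *ᵥ X) =
      hess D.g H u *ᵥ X - D.density H F u • (hess D.g D.B u *ᵥ X) -
        D.densityFlux H F u • (hess D.g D.N u *ᵥ X) -
        (differential D.B u ⬝ᵥ D.frameGradient H F u) • (D.space u *ᵥ X) -
        (differential D.N u ⬝ᵥ D.frameGradient H F u) • (D.time u *ᵥ X) := by
  have hd := hD.smoothOn_density hH hF
  have leibniz := fderiv_mulVec (differentiableAt_of_smoothOn hD.isOpen hD.smoothOn_space hu)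
    (differentiableAt_of_smoothOn hD.isOpen
      (smoothOn_gradient hD.isOpen hD.isMetricOn_metric hd) hu) X
  rw [DFunLike.congr_fun (fderiv_congr_of_eqOn hD.isOpen (fun y hy =>
    hD.space_mulVec_gradient_density hH hF hHF hy) hu) X] at leibniz
  have deformation : D.deformation u X *ᵥ D.frameGradient H F u =
      fderiv ℝ (D.density H F) u X • gradient D.g D.B u -
        (differential D.B u ⬝ᵥ D.frameGradient H F u) • (D.space u *ᵥ X) +
      (fderiv ℝ (D.densityFlux H F) u X • gradient D.g D.N u -
        (differential D.N u ⬝ᵥ D.frameGradient H F u) • (D.time u *ᵥ X)) := by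
    simp only [deformation_apply, add_mulVec, wedge_mulVec, hD.gradient_dotProduct hu,
      (hD.fderiv_density hH hF hHF hu X).1, (hD.fderiv_density hH hF hHF hu X).2]
    rw [← hD.isMetricOn.mulVec_dotProduct hu (D.space u *ᵥ X),
      ← hD.isMetricOn.mulVec_dotProduct hu (D.time u *ᵥ X), dotProduct_comm,
      dotProduct_comm (D.g u *ᵥ (D.time u *ᵥ X))]
  rw [hess_mulVec hD.isOpen hD.isMetricOn_metric hd hu, mulVec_add, mulVec_mulVec,
    hD.space_mul_connectionForm hu, add_mulVec, ← mulVec_mulVec,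
    hD.space_mulVec_gradient_density hH hF hHF hu, frameConnection, _root_.add_apply, add_mulVec,
    deformation]
  linear_combination hD.fderiv_frameGradient hH hF hu X - leibniz

end Reciprocal

end TransformedDensity

section GeneratedFlows

namespace Reciprocal

variable {n : ℕ} {D : Reciprocal n} {U : Set (Fin n → ℝ)} {u : Fin n → ℝ}
  {H F f e C C' P Q R S E G : ScalarField n}

variable (D) in
/-- The transform of the local Hamiltonian operator of `D.g`. -/
abbrev operator (P Q R S : ScalarField n) : NonlocalOp n 4 :=
  fourTailOp D.metric (D.transform (hess D.g D.B) Q S) (D.transform (hess D.g D.N) P R) D.velocity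

variable (D) in
/-- The flux of the transformed density along the transform of the Hamiltonian flow with the
density `f`, where `e` is the flux of `f` along the flow with the density `H`, and `C`, `C'` are
the fluxes of `B`, `N` along the flow with the density `f`. -/
def tailFlux (H F f e C C' : ScalarField n) : ScalarField n := fun u =>
  gradInner D.g f H u - e u - D.density H F u * C u - D.densityFlux H F u * C' u

lemma isFlux_of_fderiv {w : MatField n}
    (h : ∀ u ∈ U, ∀ X, fderiv ℝ F u (w u *ᵥ X) = fderiv ℝ E u X) : IsFlux U w F E :=
  isFlux_iff.2 fun u hu => dotProduct_eq _ _ fun X => by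
    rw [← dotProduct_mulVec, differential_dotProduct, differential_dotProduct, h u hu]

lemma IsAdmissible.isFlux_density_velocity (hD : D.IsAdmissible U) (hH : ContDiffOn ℝ ∞ H U)
    (hF : ContDiffOn ℝ ∞ F U) (hHF : IsFlux U D.v H F) :
    IsFlux U D.velocity (D.density H F) (D.densityFlux H F) :=
  isFlux_of_fderiv fun u hu X => by
    rw [(hD.fderiv_density hH hF hHF hu _).1, (hD.fderiv_density hH hF hHF hu X).2,
      mulVec_mulVec _ (D.space u), hD.space_mul_velocity hu]

lemma IsAdmissible.smoothOn_tailFlux (hD : D.IsAdmissible U) (hH : ContDiffOn ℝ ∞ H U)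
    (hF : ContDiffOn ℝ ∞ F U) (hf : ContDiffOn ℝ ∞ f U) (he : ContDiffOn ℝ ∞ e U)
    (hC : ContDiffOn ℝ ∞ C U) (hC' : ContDiffOn ℝ ∞ C' U) :
    ContDiffOn ℝ ∞ (D.tailFlux H F f e C C') U :=
  (((smoothOn_gradInner hD.isOpen hD.isMetricOn hf hH).sub he).sub
    ((hD.smoothOn_density hH hF).mul hC)).sub ((hD.smoothOn_densityFlux hH hF).mul hC')

lemma IsTransformable.isFlux_tailFlux (hw : D.IsTransformable U (hess D.g f) C C')
    (hD : D.IsAdmissible U) (hH : ContDiffOn ℝ ∞ H U) (hF : ContDiffOn ℝ ∞ F U)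
    (hHF : IsFlux U D.v H F) (hf : ContDiffOn ℝ ∞ f U) (he : ContDiffOn ℝ ∞ e U)
    (hfe : IsFlux U (hess D.g H) f e) :
    IsFlux U (D.transform (hess D.g f) C C') (D.density H F) (D.tailFlux H F f e C C') := by
  refine isFlux_of_fderiv fun u hu X => ?_
  have diff : ∀ {f : ScalarField n}, ContDiffOn ℝ ∞ f U → DifferentiableAt ℝ f u := fun hf =>
    differentiableAt_of_smoothOn hD.isOpen hf hu
  have hfH := diff (smoothOn_gradInner hD.isOpen hD.isMetricOn hf hH)
  have hd := diff (hD.smoothOn_density hH hF)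
  have hφ := diff (hD.smoothOn_densityFlux hH hF)
  have hC := diff hw.smooth_fst
  have hC' := diff hw.smooth_snd
  rw [(hD.fderiv_density hH hF hHF hu _).1, mulVec_mulVec _ (D.space u),
    hw.space_mul_transform hD hu]
  unfold tailFlux
  rw [fderiv_fun_sub ((hfH.fun_sub (diff he)).fun_sub (hd.fun_mul hC)) (hφ.fun_mul hC'),
    fderiv_fun_sub (hfH.fun_sub (diff he)) (hd.fun_mul hC), fderiv_fun_sub hfH (diff he),
    fderiv_fun_mul hd hC, fderiv_fun_mul hφ hC']
  simp only [_root_.sub_apply, _root_.add_apply, _root_.smul_apply, smul_eq_mul,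
    fderiv_gradInner hD.isOpen hD.isMetricOn hf hH hu, (hD.fderiv_density hH hF hHF hu X).1,
    (hD.fderiv_density hH hF hHF hu X).2]
  rw [hfe.differential_dotProduct_mulVec hu]
  have frame := hD.frameGradient_dotProduct hu H F (hess D.g f u *ᵥ X)
  rw [hw.isFlux_fst.differential_dotProduct_mulVec hu,
    hw.isFlux_snd.differential_dotProduct_mulVec hu] at frame
  simp only [shifted, sub_mulVec, smul_mulVec, mulVec_sub, mulVec_smul, dotProduct_sub,
    dotProduct_smul, smul_eq_mul, differential_dotProduct] at frame ⊢
  linear_combination frame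

lemma differential_dotProduct_frameGradient (D : Reciprocal n) (H F f : ScalarField n)
    (u : Fin n → ℝ) : differential f u ⬝ᵥ D.frameGradient H F u = gradInner D.g f H u -
      D.density H F u * gradInner D.g f D.B u - D.densityFlux H F u * gradInner D.g f D.N u := by
  simp only [frameGradient, gradInner_eq, dotProduct_sub, dotProduct_smul, smul_eq_mul]

lemma IsExtension.transform_eq (h : D.IsExtension U P Q R S) (hD : D.IsAdmissible U)
    (hflat : IsFlatOn U D.g) (hH : ContDiffOn ℝ ∞ H U) (hF : ContDiffOn ℝ ∞ F U)
    (hHF : IsFlux U D.v H F) (hw : D.IsTransformable U (hess D.g H) E G) (hu : u ∈ U) :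
    D.transform (hess D.g H) E G u = hess D.metric (D.density H F) u +
      D.density H F u • D.transform (hess D.g D.B) Q S u +
      D.tailFlux H F D.B E Q S u • 1 +
      D.densityFlux H F u • D.transform (hess D.g D.N) P R u +
      D.tailFlux H F D.N G P R u • D.velocity u := by
  refine hD.space_mul_injective hu (Matrix.ext_iff_mulVec.2 fun X => ?_)
  have hess_density := hD.space_mulVec_hess_density hH hF hHF hu X
  simp only [mul_add, Matrix.mul_smul, mul_one, hw.space_mul_transform hD hu,
    (h.isTransformable_B hD hflat).space_mul_transform hD hu,
    (h.isTransformable_N hD hflat).space_mul_transform hD hu, hD.space_mul_velocity hu,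
    shifted, tailFlux, add_mulVec, sub_mulVec, smul_mulVec]
  rw [← mulVec_mulVec, hess_density, differential_dotProduct_frameGradient,
    differential_dotProduct_frameGradient, gradInner_comm (F := D.N) (G := D.B) hD.isMetricOn hu,
    ← h.add_eq u hu, h.eq_Q, h.eq_R]
  module

lemma IsExtension.generates_transform (h : D.IsExtension U P Q R S) (hD : D.IsAdmissible U)
    (hflat : IsFlatOn U D.g) (hH : ContDiffOn ℝ ∞ H U) (hF : ContDiffOn ℝ ∞ F U)
    (hHF : IsFlux U D.v H F) (hw : D.IsTransformable U (hess D.g H) E G) :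
    (D.operator P Q R S).Generates U (D.density H F) (D.transform (hess D.g H) E G) := by
  have hwB := h.isTransformable_B hD hflat
  have hwN := h.isTransformable_N hD hflat
  refine ⟨![D.density H F, D.tailFlux H F D.B E Q S, D.densityFlux H F,
    D.tailFlux H F D.N G P R], fun α => ?_, fun α => ?_, fun c hc x => ?_⟩
  · fin_cases α
    · exact hD.smoothOn_density hH hF
    · exact hD.smoothOn_tailFlux hH hF hD.smooth_B hw.smooth_fst hwB.smooth_fst hwB.smooth_snd
    · exact hD.smoothOn_densityFlux hH hF
    · exact hD.smoothOn_tailFlux hH hF hD.smooth_N hw.smooth_snd hwN.smooth_fst hwN.smooth_snd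
  · fin_cases α
    · exact isFlux_of_fderiv fun u _ X => congrArg _ (one_mulVec X)
    · exact hwB.isFlux_tailFlux hD hH hF hHF hD.smooth_B hw.smooth_fst hw.isFlux_fst
    · exact hD.isFlux_density_velocity hH hF hHF
    · exact hwN.isFlux_tailFlux hD hH hF hHF hD.smooth_N hw.smooth_snd hw.isFlux_snd
  · rw [NonlocalOp.applyWith, NonlocalOp.localPart_differential _ hD.isOpen
      hD.isMetricOn_metric hc (hD.smoothOn_density hH hF), flow,
      h.transform_eq hD hflat hH hF hHF hw (hc.mem x)]
    simp only [add_mulVec, smul_mulVec, flow, fourTailOp, Fin.sum_univ_four, add_assoc]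
    rfl

lemma IsAdmissible.transform_v (hD : D.IsAdmissible U) (hu : u ∈ U) :
    D.transform D.v D.A D.M u = 0 :=
  hD.space_mul_injective hu <| by
    change D.space u * _ = D.space u * 0
    rw [hD.isTransformable.space_mul_transform hD hu, shifted, sub_sub,
      hD.space_time_velocity hu, sub_self, mul_zero]

/-- The system itself becomes stationary, and `D.velocity` arises from the constant of
integration in its last tail. -/
lemma IsExtension.generates_velocity (h : D.IsExtension U P Q R S) (hD : D.IsAdmissible U)
    (hflat : IsFlatOn U D.g) (hH : ContDiffOn ℝ ∞ H U) (hv : D.v = hess D.g H) :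
    (D.operator P Q R S).Generates U
      (D.density H fun u => 1 / 2 * gradInner D.g H H u) D.velocity :=
  ((h.generates_transform hD hflat hH (smoothOn_half_gradInner hD.isOpen hD.isMetricOn hH)
    (hv ▸ isFlux_half_gradInner hD.isOpen hD.isMetricOn hH)
    (hv ▸ hD.isTransformable)).add_left 3).congr fun u hu => by
      rw [← hv, hD.transform_v hu, zero_add]
      rfl

end Reciprocal

end GeneratedFlows

/-! ### The skew-symmetric antiderivative -/

section Variation

lemma integrable_of_continuousOn_of_eq_zero {X : Type*} [NormedAddCommGroup X] [MeasurableSpace X]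
    [OpensMeasurableSpace X] {C : Set X} {μ : Measure X} [IsFiniteMeasureOnCompacts μ]
    {g : X → ℝ} (hC : IsCompact C) (hg : ContinuousOn g C) (h0 : ∀ x ∉ C, g x = 0) :
    Integrable g μ := by
  rw [← integrableOn_iff_integrable_of_support_subset (s := C)
    fun x hx => by_contra fun hxC => hx (h0 x hxC)]
  exact hg.integrableOn_compact' hC hC.measurableSet

variable {X Y : Type*} [NormedAddCommGroup X] [NormedSpace ℝ X] [NormedAddCommGroup Y]
  [NormedSpace ℝ Y]

/-- A one-parameter family `f ε` of functions which vanish outside the compact set `C` and depend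
smoothly on `(ε, x)` in a neighbourhood `O` of `{0} × C`. These are the densities that are
differentiated at `ε = 0` under the integral sign. -/
structure IsVariation (O : Set (ℝ × X)) (C : Set X) (f : ℝ → X → ℝ) : Prop where
  isOpen : IsOpen O
  isCompact : IsCompact C
  mem : ∀ x ∈ C, ((0 : ℝ), x) ∈ O
  smooth : ContDiffOn ℝ ∞ (fun p : ℝ × X => f p.1 p.2) O
  eq_zero : ∀ ε, ∀ x ∉ C, f ε x = 0

variable {O : Set (ℝ × X)} {C : Set X} {f : ℝ → X → ℝ} {f' : X → ℝ}

namespace IsVariation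

lemma exists_closedBall_prod_subset (h : IsVariation O C f) :
    ∃ δ > 0, Metric.closedBall (0 : ℝ) δ ×ˢ C ⊆ O := by
  obtain ⟨V, W, hV, -, h0V, hCW, hVW⟩ :=
    generalized_tube_lemma (isCompact_singleton (x := (0 : ℝ))) h.isCompact h.isOpen (by
      rintro ⟨ε, x⟩ ⟨rfl, hx⟩
      exact h.mem x hx)
  obtain ⟨δ, hδ, hδV⟩ := Metric.nhds_basis_closedBall.mem_iff.1 (hV.mem_nhds (h0V rfl))
  exact ⟨δ, hδ, (Set.prod_mono hδV hCW).trans hVW⟩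

lemma continuousOn_slice (h : IsVariation O C f) {ε : ℝ} (hε : ∀ x ∈ C, (ε, x) ∈ O) :
    ContinuousOn (f ε) C :=
  h.smooth.continuousOn.comp (f := fun x => (ε, x)) (by fun_prop) hε

lemma hasDerivAt_fderiv (h : IsVariation O C f) {ε : ℝ} {x : X} (hx : (ε, x) ∈ O) :
    HasDerivAt (fun e => f e x) (fderiv ℝ (fun p : ℝ × X => f p.1 p.2) (ε, x) (1, 0)) ε :=
  (differentiableAt_of_smoothOn h.isOpen h.smooth hx).hasFDerivAt.comp_hasDerivAt (f := (·, x)) ε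
    ((hasDerivAt_id ε).prodMk (hasDerivAt_const ε x))

lemma derivative_eq_zero (h : IsVariation O C f) {x : X}
    (hf' : HasDerivAt (fun ε => f ε x) (f' x) 0) (hx : x ∉ C) : f' x = 0 := by
  simp only [h.eq_zero _ x hx] at hf'
  exact hf'.unique (hasDerivAt_const 0 0)

lemma exists_norm_deriv_le (h : IsVariation O C f) :
    ∃ δ > 0, ∃ b : ℝ, ∀ ε ∈ Metric.closedBall 0 δ, ∀ x ∈ C,
      DifferentiableAt ℝ (fun e => f e x) ε ∧ ‖deriv (fun e => f e x) ε‖ ≤ b := by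
  obtain ⟨δ, hδ, hO⟩ := h.exists_closedBall_prod_subset
  obtain ⟨b, hb⟩ := ((isCompact_closedBall 0 δ).prod h.isCompact).exists_bound_of_continuousOn
    ((smoothOn_fderiv_apply h.isOpen h.smooth (1, 0)).continuousOn.mono hO)
  refine ⟨δ, hδ, b, fun ε hε x hx => ?_⟩
  have hder := h.hasDerivAt_fderiv (hO ⟨hε, hx⟩)
  exact ⟨hder.differentiableAt, hder.deriv ▸ hb (ε, x) ⟨hε, hx⟩⟩

lemma prod_mul {O' : Set (ℝ × Y)} {C' : Set Y} {g : ℝ → Y → ℝ} (hf : IsVariation O C f)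
    (hg : IsVariation O' C' g) :
    IsVariation {q : ℝ × X × Y | (q.1, q.2.1) ∈ O ∧ (q.1, q.2.2) ∈ O'} (C ×ˢ C')
      fun ε p => f ε p.1 * g ε p.2 where
  isOpen := (hf.isOpen.preimage (by fun_prop)).inter (hg.isOpen.preimage (by fun_prop))
  isCompact := hf.isCompact.prod hg.isCompact
  mem p hp := ⟨hf.mem _ hp.1, hg.mem _ hp.2⟩
  smooth := (hf.smooth.comp (f := fun q : ℝ × X × Y => (q.1, q.2.1)) (by fun_prop)
      fun q hq => hq.1).mul (hg.smooth.comp (f := fun q : ℝ × X × Y => (q.1, q.2.2)) (by fun_prop)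
      fun q hq => hq.2)
  eq_zero ε p hp := by
    rcases not_and_or.1 hp with hp | hp
    · rw [hf.eq_zero ε _ hp, zero_mul]
    · rw [hg.eq_zero ε _ hp, mul_zero]

variable [MeasurableSpace X] [OpensMeasurableSpace X] {μ : Measure X}
  [IsFiniteMeasureOnCompacts μ]

lemma eventually_integrable (h : IsVariation O C f) : ∀ᶠ ε in nhds 0, Integrable (f ε) μ := by
  obtain ⟨δ, hδ, hO⟩ := h.exists_closedBall_prod_subset
  filter_upwards [Metric.closedBall_mem_nhds 0 hδ] with ε hε
  exact integrable_of_continuousOn_of_eq_zero h.isCompact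
    (h.continuousOn_slice fun x hx => hO ⟨hε, hx⟩) (h.eq_zero ε)

lemma integrable_derivative (h : IsVariation O C f)
    (hf' : ∀ x, HasDerivAt (fun ε => f ε x) (f' x) 0) : Integrable f' μ := by
  refine integrable_of_continuousOn_of_eq_zero h.isCompact ?_
    fun x hx => h.derivative_eq_zero (hf' x) hx
  refine ((smoothOn_fderiv_apply h.isOpen h.smooth (1, 0)).continuousOn.comp
    (f := fun x => ((0 : ℝ), x)) (by fun_prop) h.mem).congr fun x hx => ?_
  exact (hf' x).unique (h.hasDerivAt_fderiv (h.mem x hx))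

lemma hasDerivAt_integral_mul (h : IsVariation O C f)
    (hf' : ∀ x, HasDerivAt (fun ε => f ε x) (f' x) 0) {k : X → ℝ} (hk : Measurable k)
    (hk1 : ∀ x, ‖k x‖ ≤ 1) :
    HasDerivAt (fun ε => ∫ x, k x * f ε x ∂μ) (∫ x, k x * f' x ∂μ) 0 := by
  obtain ⟨δ, hδ, b, hb⟩ := h.exists_norm_deriv_le
  have hInt : ∀ᶠ ε in nhds 0, Integrable (fun x => k x * f ε x) μ :=
    h.eventually_integrable.mono fun ε hε =>
      hε.bdd_mul hk.aestronglyMeasurable (Filter.Eventually.of_forall hk1)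
  have hf'0 : ∀ x, deriv (fun e => f e x) 0 = f' x := fun x => (hf' x).deriv
  simp only [← hf'0]
  refine (hasDerivAt_integral_of_dominated_loc_of_deriv_le
    (F' := fun ε x => k x * deriv (fun e => f e x) ε) (bound := C.indicator fun _ => b)
    (Metric.closedBall_mem_nhds 0 hδ) (hInt.mono fun ε hε => hε.aestronglyMeasurable)
    hInt.self_of_nhds ?_ ?_ ?_ ?_).2
  · simp only [hf'0]
    exact hk.aestronglyMeasurable.mul (h.integrable_derivative hf').aestronglyMeasurable
  · refine Filter.Eventually.of_forall fun x ε hε => ?_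
    by_cases hx : x ∈ C
    · rw [Set.indicator_of_mem hx, norm_mul]
      exact (mul_le_of_le_one_left (norm_nonneg _) (hk1 x)).trans (hb ε hε x hx).2
    · simp [h.eq_zero _ x hx, hx]
  · exact (integrable_indicator_iff h.isCompact.measurableSet).2
      (integrableOn_const h.isCompact.measure_lt_top.ne)
  · refine Filter.Eventually.of_forall fun x ε hε => ?_
    by_cases hx : x ∈ C
    · exact (hb ε hε x hx).1.hasDerivAt.const_mul _
    · simpa [h.eq_zero _ x hx] using hasDerivAt_const ε (0 : ℝ)

end IsVariation

end Variation

namespace NonlocalOp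

/-- The kernel `½ (1_{y ≤ x} - 1_{x ≤ y})` at `(x, y)` of the skew-symmetric antiderivative. -/
def kernel (p : ℝ × ℝ) : ℝ :=
  1 / 2 * ((if p.2 ≤ p.1 then 1 else 0) - if p.1 ≤ p.2 then 1 else 0)

lemma kernel_swap (p : ℝ × ℝ) : kernel p.swap = -kernel p := by
  simp only [kernel, Prod.fst_swap, Prod.snd_swap]
  ring

lemma measurable_kernel : Measurable kernel :=
  ((measurable_const.ite (measurableSet_le measurable_snd measurable_fst) measurable_const).sub
    (measurable_const.ite (measurableSet_le measurable_fst measurable_snd)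
      measurable_const)).const_mul _

lemma norm_kernel_le (p : ℝ × ℝ) : ‖kernel p‖ ≤ 1 := by
  rw [kernel]
  split_ifs <;> norm_num

variable {a b : ℝ → ℝ}

lemma antideriv_eq_integral_kernel (hb : Integrable b) (x : ℝ) :
    antideriv b x = ∫ y, kernel (x, y) * b y := by
  rw [antideriv, ← integral_indicator measurableSet_Iic, ← integral_indicator measurableSet_Ici,
    ← integral_sub (hb.indicator measurableSet_Iic) (hb.indicator measurableSet_Ici),
    ← integral_const_mul]
  refine integral_congr_ae (Filter.Eventually.of_forall fun y => ?_)
  simp only [kernel, Set.indicator_apply, Set.mem_Iic, Set.mem_Ici]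
  split_ifs <;> ring

lemma mul_antideriv_eq (a : ℝ → ℝ) (hb : Integrable b) :
    (fun x => a x * antideriv b x) = fun x => ∫ y, kernel (x, y) * (a x * b y) := by
  funext x
  rw [antideriv_eq_integral_kernel hb, ← integral_const_mul]
  simp only [mul_left_comm]

lemma integrable_kernel_mul (ha : Integrable a) (hb : Integrable b) :
    Integrable (fun p : ℝ × ℝ => kernel p * (a p.1 * b p.2)) (volume.prod volume) :=
  (ha.mul_prod hb).bdd_mul measurable_kernel.aestronglyMeasurable
    (Filter.Eventually.of_forall norm_kernel_le)

lemma integrable_mul_antideriv (ha : Integrable a) (hb : Integrable b) :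
    Integrable fun x => a x * antideriv b x := by
  rw [mul_antideriv_eq a hb]
  exact (integrable_kernel_mul ha hb).integral_prod_left

lemma integral_mul_antideriv (ha : Integrable a) (hb : Integrable b) :
    ∫ x, a x * antideriv b x = ∫ p : ℝ × ℝ, kernel p * (a p.1 * b p.2) ∂(volume.prod volume) := by
  rw [mul_antideriv_eq a hb, integral_prod _ (integrable_kernel_mul ha hb)]

lemma integral_mul_antideriv_comm (ha : Integrable a) (hb : Integrable b) :
    ∫ x, a x * antideriv b x = -∫ x, b x * antideriv a x := by
  rw [integral_mul_antideriv ha hb, integral_mul_antideriv hb ha, ← integral_prod_swap,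
    ← integral_neg]
  simp only [kernel_swap, Prod.fst_swap, Prod.snd_swap, neg_mul, mul_comm (a _)]

lemma hasDerivAt_antideriv (hb : Integrable b) (hc : Continuous b) (x : ℝ) :
    HasDerivAt (antideriv b) (b x) x := by
  have hIic : ∀ y, ∫ z in Set.Iic y, b z =
      (∫ z in Set.Iic (0 : ℝ), b z) + ∫ z in (0 : ℝ)..y, b z := fun y => by
    rw [← intervalIntegral.integral_Iic_sub_Iic hb.integrableOn hb.integrableOn]
    ring
  have hantideriv : antideriv b = fun y =>
      (∫ z in Set.Iic (0 : ℝ), b z) + (∫ z in (0 : ℝ)..y, b z) - 1 / 2 * ∫ z, b z := by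
    funext y
    rw [antideriv, integral_Ici_eq_integral_Ioi,
      ← intervalIntegral.integral_Iic_add_Ioi (b := y) hb.integrableOn hb.integrableOn, ← hIic]
    ring
  rw [hantideriv]
  exact ((intervalIntegral.integral_hasDerivAt_right (hc.intervalIntegrable _ _)
    (hc.stronglyMeasurableAtFilter _ _) hc.continuousAt).const_add _).sub_const _

lemma contDiff_antideriv (hb : Integrable b) (hc : ContDiff ℝ ∞ b) :
    ContDiff ℝ ∞ (antideriv b) := by
  have h := hasDerivAt_antideriv hb hc.continuous
  rw [contDiff_infty_iff_deriv]
  exact ⟨fun x => (h x).differentiableAt, by rwa [funext fun x => (h x).deriv]⟩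

lemma hasDerivAt_integral_mul_antideriv {O O' : Set (ℝ × ℝ)} {C C' : Set ℝ} {a b : ℝ → ℝ → ℝ}
    {a' b' : ℝ → ℝ} (ha : IsVariation O C a) (hb : IsVariation O' C' b)
    (ha' : ∀ x, HasDerivAt (fun ε => a ε x) (a' x) 0)
    (hb' : ∀ x, HasDerivAt (fun ε => b ε x) (b' x) 0) :
    HasDerivAt (fun ε => ∫ x, a ε x * antideriv (b ε) x)
      ((∫ x, a' x * antideriv (b 0) x) + ∫ x, a 0 x * antideriv b' x) 0 := by
  have hia' : Integrable a' := ha.integrable_derivative ha'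
  have hib' : Integrable b' := hb.integrable_derivative hb'
  have hia : ∀ᶠ ε in nhds 0, Integrable (a ε) := ha.eventually_integrable
  have hib : ∀ᶠ ε in nhds 0, Integrable (b ε) := hb.eventually_integrable
  rw [integral_mul_antideriv hia' hib.self_of_nhds, integral_mul_antideriv hia.self_of_nhds hib',
    ← integral_add (integrable_kernel_mul hia' hib.self_of_nhds)
      (integrable_kernel_mul hia.self_of_nhds hib')]
  simp only [← mul_add]
  refine ((ha.prod_mul hb).hasDerivAt_integral_mul (μ := volume.prod volume)
    (fun p => (ha' p.1).mul (hb' p.2)) measurable_kernel norm_kernel_le).congr_of_eventuallyEq ?_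
  filter_upwards [hia, hib] with ε h₁ h₂ using integral_mul_antideriv h₁ h₂

end NonlocalOp

lemma integral_eq_zero_of_hasDerivAt_of_hasCompactSupport {f f' : ℝ → ℝ}
    (hf : ∀ x, HasDerivAt f (f' x) x) (hf' : Integrable f') (hs : HasCompactSupport f) :
    ∫ x, f' x = 0 :=
  integral_eq_zero_of_hasDerivAt_of_integrable hf hf' <|
    (continuous_iff_continuousAt.2 fun x => (hf x).continuousAt).integrable_of_hasCompactSupport hs

/-! ### Nonlocal operators built from Codazzi tensors -/

section CodazziFamily

variable {n m : ℕ} {U : Set (Fin n → ℝ)} {g W : MatField n} {J : NonlocalOp n m}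
  {σ : Fin m → Fin m} {c y z ξ η ζ V : ℝ → Fin n → ℝ} {u : Fin n → ℝ}

lemma IsMetricOn.inv_mulVec_dotProduct (hg : IsMetricOn U g) (hu : u ∈ U) (X Y : Fin n → ℝ) :
    ((g u)⁻¹ *ᵥ X) ⬝ᵥ Y = X ⬝ᵥ ((g u)⁻¹ *ᵥ Y) := by
  rw [dotProduct_mulVec, ← mulVec_transpose, transpose_nonsing_inv, (hg.symm u hu).eq]

lemma contDiff_dotProduct (hy : ContDiff ℝ ∞ y) (hz : ContDiff ℝ ∞ z) :
    ContDiff ℝ ∞ fun x => y x ⬝ᵥ z x :=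
  contDiffOn_univ.1 (contDiffOn_dotProduct hy.contDiffOn hz.contDiffOn)

lemma IsCurveIn.smooth_mulVec (hc : IsCurveIn U c) (hW : ContDiffOn ℝ ∞ W U)
    (hy : ContDiff ℝ ∞ y) : ContDiff ℝ ∞ fun x => W (c x) *ᵥ y x :=
  contDiffOn_univ.1 <| contDiffOn_mulVec
    (hW.comp hc.smooth.contDiffOn fun x _ => hc.mem x) hy.contDiffOn

lemma IsCurveIn.smooth_connectionForm (hc : IsCurveIn U c) (hU : IsOpen U) (hg : IsMetricOn U g)
    (hz : ContDiff ℝ ∞ z) : ContDiff ℝ ∞ fun x => connectionForm g (c x) (z x) :=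
  contDiffOn_univ.1 <| ((smoothOn_connectionForm hU hg).comp hc.smooth.contDiffOn
    fun x _ => hc.mem x).clm_apply hz.contDiffOn

namespace NonlocalOp

lemma IsTest.hasDerivAt (hξ : IsTest ξ) (x : ℝ) : HasDerivAt ξ (deriv ξ x) x :=
  (hξ.smooth.differentiable (by simp) x).hasDerivAt

lemma IsTest.hasCompactSupport_dotProduct (hξ : IsTest ξ) (y : ℝ → Fin n → ℝ) :
    HasCompactSupport fun x => ξ x ⬝ᵥ y x :=
  hξ.compact.mono fun x hx hξx => hx (by simp only [hξx, zero_dotProduct])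

lemma IsTest.integrable_dotProduct (hξ : IsTest ξ) (hy : ContDiff ℝ ∞ y) :
    Integrable fun x => ξ x ⬝ᵥ y x :=
  (contDiff_dotProduct hξ.smooth hy).continuous.integrable_of_hasCompactSupport
    (hξ.hasCompactSupport_dotProduct y)

/-- The covariant derivative of the covector field `ξ` along the curve `c`. -/
def covDeriv (J : NonlocalOp n m) (c ξ : ℝ → Fin n → ℝ) (x : ℝ) : Fin n → ℝ :=
  deriv ξ x - (connectionForm J.metric (c x) (deriv c x))ᵀ *ᵥ ξ x

/-- The nonlocal functions `(d/dx)⁻¹ b_{(α)l}^j u^l_x ξ_j` which occur in `J ξ`. -/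
def tail (J : NonlocalOp n m) (c ξ : ℝ → Fin n → ℝ) (α : Fin m) : ℝ → ℝ :=
  antideriv (J.tailDensity c ξ α)

lemma covDeriv_dotProduct (J : NonlocalOp n m) (c ξ : ℝ → Fin n → ℝ) (x : ℝ) (Y : Fin n → ℝ) :
    J.covDeriv c ξ x ⬝ᵥ Y =
      deriv ξ x ⬝ᵥ Y - ξ x ⬝ᵥ (connectionForm J.metric (c x) (deriv c x) *ᵥ Y) := by
  rw [covDeriv, sub_dotProduct, mulVec_transpose, ← dotProduct_mulVec]

lemma isTest_covDeriv (hU : IsOpen U) (hg : IsMetricOn U J.metric) (hc : IsCurveIn U c)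
    (hξ : IsTest ξ) : IsTest (J.covDeriv c ξ) where
  smooth := (contDiff_infty_iff_deriv.1 hξ.smooth).2.sub <| contDiffOn_univ.1 <|
    contDiffOn_mulVec
      (contDiffOn_transpose (hc.smooth_connectionForm hU hg hc.smooth_deriv).contDiffOn)
      hξ.smooth.contDiffOn
  compact := hξ.compact.deriv.sub <| hξ.compact.mono fun x hx hξx =>
    hx (by simp only [hξx, mulVec_zero])

lemma dotProduct_localPart (hU : IsOpen U) (hg : IsMetricOn U J.metric) {x : ℝ} (hx : c x ∈ U)
    (ξ ζ : ℝ → Fin n → ℝ) :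
    ξ x ⬝ᵥ J.localPart c ζ x = J.covDeriv c ζ x ⬝ᵥ ((J.metric (c x))⁻¹ *ᵥ ξ x) := by
  rw [J.localPart_eq hU hg ζ hx, dotProduct_comm, hg.inv_mulVec_dotProduct hx, covDeriv]

lemma hasDerivAt_inv_metric_mulVec (hU : IsOpen U) (hg : IsMetricOn U J.metric)
    (hc : IsCurveIn U c) (hξ : IsTest ξ) (x : ℝ) :
    HasDerivAt (fun x => (J.metric (c x))⁻¹ *ᵥ ξ x)
      ((J.metric (c x))⁻¹ *ᵥ J.covDeriv c ξ x -
        connectionForm J.metric (c x) (deriv c x) *ᵥ ((J.metric (c x))⁻¹ *ᵥ ξ x)) x := by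
  refine (hasDerivAt_mulVec (hasDerivAt_comp_curve hU hg.smoothOn_inv (hc.mem x) (hc.hasDerivAt x))
    (hξ.hasDerivAt x)).congr_deriv ?_
  rw [fderiv_inv_metric hU hg (hc.mem x), covDeriv]
  simp only [neg_mulVec, add_mulVec, mulVec_sub, ← mulVec_mulVec]
  abel

lemma bracket_eq (h_local : Integrable fun x => ξ x ⬝ᵥ J.localPart c ζ x)
    (h_left : ∀ α, Integrable fun x => flow (J.left α) c x ⬝ᵥ ξ x)
    (h_right : ∀ α, Integrable (J.tailDensity c ζ α)) :
    J.bracket c ξ ζ = (∫ x, ξ x ⬝ᵥ J.localPart c ζ x) +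
      ∑ α, ∫ x, (flow (J.left α) c x ⬝ᵥ ξ x) * J.tail c ζ α x := by
  have h_tail : ∀ α ∈ Finset.univ, Integrable fun x =>
      (flow (J.left α) c x ⬝ᵥ ξ x) * J.tail c ζ α x :=
    fun α _ => integrable_mul_antideriv (h_left α) (h_right α)
  rw [← integral_finsetSum _ h_tail, ← integral_add h_local (integrable_finsetSum _ h_tail),
    bracket]
  simp only [NonlocalOp.apply, applyWith, dotProduct_add, dotProduct_sum, dotProduct_smul,
    smul_eq_mul, dotProduct_comm (ξ _) (flow _ _ _), mul_comm (antideriv _ _), tail]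

/-- The tails of `J` form a family of pairwise commuting Codazzi tensors, which the involution `σ`
of the tails exchanges, and the metric has the curvature `∑_α b_{(α)} ∧ a_{(α)}` prescribed by
them. By the criterion `IsCodazziFamily.isHamiltonian` such operators are Hamiltonian. -/
structure IsCodazziFamily (J : NonlocalOp n m) (U : Set (Fin n → ℝ)) (σ : Fin m → Fin m) :
    Prop where
  isOpen : IsOpen U
  isMetricOn : IsMetricOn U J.metric
  involutive : Function.Involutive σ
  right_eq : ∀ α, J.right α = J.left (σ α)
  isCodazziOn : ∀ α, IsCodazziOn U J.metric (J.left α)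
  commute : ∀ α β, ∀ u ∈ U, Commute (J.left α u) (J.left β u)
  curvatureForm_eq : ∀ u ∈ U, ∀ X Y, curvatureForm (connectionForm J.metric) u X Y =
    ∑ α, wedge (J.metric u) (J.left α u *ᵥ X) (J.right α u *ᵥ Y)

namespace IsCodazziFamily

lemma smoothOn_right (hJ : J.IsCodazziFamily U σ) (α : Fin m) : ContDiffOn ℝ ∞ (J.right α) U :=
  hJ.right_eq α ▸ (hJ.isCodazziOn (σ α)).smooth

lemma left_eq (hJ : J.IsCodazziFamily U σ) (α : Fin m) : J.left α = J.right (σ α) := by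
  rw [hJ.right_eq, hJ.involutive]

lemma sum_comp (hJ : J.IsCodazziFamily U σ) (f : Fin m → ℝ) : ∑ α, f (σ α) = ∑ α, f α :=
  Equiv.sum_comp hJ.involutive.toPerm f

lemma dotProduct_comm_left (hJ : J.IsCodazziFamily U σ) (hu : u ∈ U) (α β : Fin m)
    (X Y : Fin n → ℝ) : (J.metric u *ᵥ (J.left α u *ᵥ X)) ⬝ᵥ (J.left β u *ᵥ Y) =
      (J.metric u *ᵥ (J.left β u *ᵥ X)) ⬝ᵥ (J.left α u *ᵥ Y) := by
  rw [hJ.isMetricOn.mulVec_dotProduct hu, isSelfAdjoint_dotProduct_comm (hJ.isMetricOn.symm u hu)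
    ((hJ.isCodazziOn α).selfAdjoint u hu) ((hJ.isCodazziOn β).selfAdjoint u hu)
    (hJ.commute α β u hu), dotProduct_comm]

variable (hJ : J.IsCodazziFamily U σ) (hc : IsCurveIn U c)
include hJ hc

lemma smooth_tailDensity (hξ : IsTest ξ) (α : Fin m) : ContDiff ℝ ∞ (J.tailDensity c ξ α) :=
  contDiff_dotProduct (hc.smooth_flow (hJ.smoothOn_right α)) hξ.smooth

lemma integrable_flow_dotProduct (hξ : IsTest ξ) (α : Fin m) :
    Integrable fun x => flow (J.left α) c x ⬝ᵥ ξ x := by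
  simpa only [dotProduct_comm] using
    hξ.integrable_dotProduct (hc.smooth_flow (hJ.isCodazziOn α).smooth)

lemma integrable_tailDensity (hξ : IsTest ξ) (α : Fin m) : Integrable (J.tailDensity c ξ α) := by
  have h := hJ.integrable_flow_dotProduct hc hξ (σ α)
  rwa [← hJ.right_eq] at h

lemma smooth_tail (hξ : IsTest ξ) (α : Fin m) : ContDiff ℝ ∞ (J.tail c ξ α) :=
  contDiff_antideriv (hJ.integrable_tailDensity hc hξ α) (hJ.smooth_tailDensity hc hξ α)

lemma hasDerivAt_tail (hξ : IsTest ξ) (α : Fin m) (x : ℝ) :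
    HasDerivAt (J.tail c ξ α) (J.tailDensity c ξ α x) x :=
  hasDerivAt_antideriv (hJ.integrable_tailDensity hc hξ α)
    (hJ.smooth_tailDensity hc hξ α).continuous x

lemma apply_eq (ξ : ℝ → Fin n → ℝ) (x : ℝ) :
    J.apply c ξ x = (J.metric (c x))⁻¹ *ᵥ J.covDeriv c ξ x +
      ∑ α, J.tail c ξ α x • flow (J.left α) c x := by
  rw [NonlocalOp.apply, applyWith, J.localPart_eq hJ.isOpen hJ.isMetricOn _ (hc.mem x)]
  rfl

lemma smooth_apply (hξ : IsTest ξ) : ContDiff ℝ ∞ (J.apply c ξ) := by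
  rw [funext (hJ.apply_eq hc ξ)]
  exact (hc.smooth_mulVec hJ.isMetricOn.smoothOn_inv
    (isTest_covDeriv hJ.isOpen hJ.isMetricOn hc hξ).smooth).add (ContDiff.sum fun α _ =>
      (hJ.smooth_tail hc hξ α).smul (hc.smooth_flow (hJ.isCodazziOn α).smooth))

lemma covDeriv_eq (ξ : ℝ → Fin n → ℝ) (x : ℝ) :
    J.covDeriv c ξ x = J.metric (c x) *ᵥ J.apply c ξ x -
      ∑ α, J.tail c ξ α x • (J.metric (c x) *ᵥ flow (J.left α) c x) := by
  rw [hJ.apply_eq hc, mulVec_add, mulVec_mulVec,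
    mul_nonsing_inv _ (hJ.isMetricOn.isUnit_det (hc.mem x)), one_mulVec, mulVec_sum]
  simp only [mulVec_smul, add_sub_cancel_right]

lemma integrable_localPart (hξ : IsTest ξ) (hζ : IsTest ζ) :
    Integrable fun x => ξ x ⬝ᵥ J.localPart c ζ x := by
  simp only [dotProduct_localPart hJ.isOpen hJ.isMetricOn (hc.mem _)]
  exact (isTest_covDeriv hJ.isOpen hJ.isMetricOn hc hζ).integrable_dotProduct
    (hc.smooth_mulVec hJ.isMetricOn.smoothOn_inv hξ.smooth)

lemma integral_localPart_comm (hξ : IsTest ξ) (hζ : IsTest ζ) :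
    ∫ x, ξ x ⬝ᵥ J.localPart c ζ x = -∫ x, ζ x ⬝ᵥ J.localPart c ξ x := by
  have hξζ := hJ.integrable_localPart hc hξ hζ
  have hζξ := hJ.integrable_localPart hc hζ hξ
  rw [eq_neg_iff_add_eq_zero, ← integral_add hξζ hζξ]
  refine integral_eq_zero_of_hasDerivAt_of_hasCompactSupport
    (f := fun x => ζ x ⬝ᵥ ((J.metric (c x))⁻¹ *ᵥ ξ x)) (fun x => ?_) (hξζ.add hζξ)
    (hζ.hasCompactSupport_dotProduct _)
  refine (hasDerivAt_dotProduct (hζ.hasDerivAt x) (hasDerivAt_inv_metric_mulVec hJ.isOpen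
    hJ.isMetricOn hc hξ x)).congr_deriv ?_
  have h_symm := hJ.isMetricOn.inv_mulVec_dotProduct (hc.mem x) (J.covDeriv c ξ x) (ζ x)
  rw [dotProduct_localPart hJ.isOpen hJ.isMetricOn (hc.mem x),
    dotProduct_localPart hJ.isOpen hJ.isMetricOn (hc.mem x), covDeriv_dotProduct J c ζ,
    dotProduct_sub, ← h_symm, dotProduct_comm _ (ζ x)]
  ring

lemma integral_tail_comm (hξ : IsTest ξ) (hζ : IsTest ζ) (α : Fin m) :
    ∫ x, (flow (J.left α) c x ⬝ᵥ ξ x) * J.tail c ζ α x =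
      -∫ x, (flow (J.left (σ α)) c x ⬝ᵥ ζ x) * J.tail c ξ (σ α) x := by
  rw [tail, integral_mul_antideriv_comm (hJ.integrable_flow_dotProduct hc hξ α)
    (hJ.integrable_tailDensity hc hζ α), hJ.left_eq α, ← hJ.right_eq α]
  rfl

lemma bracket_comm (hξ : IsTest ξ) (hζ : IsTest ζ) : J.bracket c ξ ζ = -J.bracket c ζ ξ := by
  rw [bracket_eq (hJ.integrable_localPart hc hξ hζ) (hJ.integrable_flow_dotProduct hc hξ)
      (hJ.integrable_tailDensity hc hζ), bracket_eq (hJ.integrable_localPart hc hζ hξ)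
      (hJ.integrable_flow_dotProduct hc hζ) (hJ.integrable_tailDensity hc hξ),
    hJ.integral_localPart_comm hc hξ hζ, neg_add,
    ← hJ.sum_comp fun α => ∫ x, (flow (J.left α) c x ⬝ᵥ ζ x) * J.tail c ξ α x,
    ← Finset.sum_neg_distrib]
  simp only [hJ.integral_tail_comm hc hξ hζ]

end IsCodazziFamily

end NonlocalOp

end CodazziFamily

section Jacobi

variable {n m : ℕ} {U : Set (Fin n → ℝ)} {g W : MatField n} {J : NonlocalOp n m}
  {σ : Fin m → Fin m} {c y ξ η ζ V : ℝ → Fin n → ℝ} {u : Fin n → ℝ}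

lemma smooth_variation (hc : ContDiff ℝ ∞ c) (hV : ContDiff ℝ ∞ V) :
    ContDiff ℝ ∞ fun p : ℝ × ℝ => (c + p.1 • V) p.2 :=
  (hc.comp contDiff_snd).add (contDiff_fst.smul (hV.comp contDiff_snd))

lemma smooth_deriv_variation (hc : IsCurveIn U c) (hV : ContDiff ℝ ∞ V) :
    ContDiff ℝ ∞ fun p : ℝ × ℝ => deriv (c + p.1 • V) p.2 := by
  simp only [hc.deriv_add_smul (hV.differentiable (by simp))]
  exact smooth_variation hc.smooth_deriv (contDiff_infty_iff_deriv.1 hV).2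

namespace NonlocalOp

/-- The derivative at `ε = 0` of the density `ξ_i J^{ij} ζ_j` of the local part of `J` along the
variation `c + ε V`. -/
def localVariation (J : NonlocalOp n m) (c V ξ ζ : ℝ → Fin n → ℝ) (x : ℝ) : ℝ :=
  J.covDeriv c ζ x ⬝ᵥ (fderiv ℝ (fun u => (J.metric u)⁻¹) (c x) (V x) *ᵥ ξ x) -
    ζ x ⬝ᵥ ((fderiv ℝ (connectionForm J.metric) (c x) (V x) (deriv c x) +
      connectionForm J.metric (c x) (deriv V x)) *ᵥ ((J.metric (c x))⁻¹ *ᵥ ξ x))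

/-- The derivative at `ε = 0` of `a_{(α)k}^i u^k_x ξ_i` along the variation `c + ε V`. -/
def flowVariation (J : NonlocalOp n m) (c V ξ : ℝ → Fin n → ℝ) (α : Fin m) (x : ℝ) : ℝ :=
  (fderiv ℝ (J.left α) (c x) (V x) *ᵥ deriv c x + J.left α (c x) *ᵥ deriv V x) ⬝ᵥ ξ x

lemma IsTest.isVariation_dotProduct (hξ : IsTest ξ) (hc : IsCurveIn U c) (hU : IsOpen U)
    (hV : ContDiff ℝ ∞ V) {y : ℝ → ℝ → Fin n → ℝ}
    (hy : ContDiffOn ℝ ∞ (fun p : ℝ × ℝ => y p.1 p.2) {p | (c + p.1 • V) p.2 ∈ U}) :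
    IsVariation {p : ℝ × ℝ | (c + p.1 • V) p.2 ∈ U} (tsupport ξ) fun ε x => ξ x ⬝ᵥ y ε x where
  isOpen := hU.preimage (smooth_variation hc.smooth hV).continuous
  isCompact := hξ.compact.isCompact
  mem x _ := by simpa using hc.mem x
  smooth := contDiffOn_dotProduct (hξ.smooth.comp contDiff_snd).contDiffOn hy
  eq_zero ε x hx := by rw [image_eq_zero_of_notMem_tsupport hx, zero_dotProduct]

lemma IsTest.isVariation_flow (hξ : IsTest ξ) (hc : IsCurveIn U c) (hU : IsOpen U)
    (hV : ContDiff ℝ ∞ V) (hW : ContDiffOn ℝ ∞ W U) :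
    IsVariation {p : ℝ × ℝ | (c + p.1 • V) p.2 ∈ U} (tsupport ξ)
      fun ε x => flow W (c + ε • V) x ⬝ᵥ ξ x := by
  simp only [dotProduct_comm _ (ξ _)]
  exact hξ.isVariation_dotProduct hc hU hV <| contDiffOn_mulVec
    (hW.comp (smooth_variation hc.smooth hV).contDiffOn fun p hp => hp)
    (smooth_deriv_variation hc hV).contDiffOn

lemma IsTest.isVariation_localPart (hξ : IsTest ξ) (hζ : IsTest ζ) (hc : IsCurveIn U c)
    (hU : IsOpen U) (hg : IsMetricOn U J.metric) (hV : ContDiff ℝ ∞ V) :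
    IsVariation {p : ℝ × ℝ | (c + p.1 • V) p.2 ∈ U} (tsupport ξ)
      fun ε x => ξ x ⬝ᵥ J.localPart (c + ε • V) ζ x := by
  refine hξ.isVariation_dotProduct hc hU hV <| ContDiffOn.congr ?_
    fun p hp => J.localPart_eq hU hg ζ hp
  have hvar := (smooth_variation hc.smooth hV).contDiffOn (s := {p | (c + p.1 • V) p.2 ∈ U})
  exact contDiffOn_mulVec (hg.smoothOn_inv.comp hvar fun p hp => hp)
    (((contDiff_infty_iff_deriv.1 hζ.smooth).2.comp contDiff_snd).contDiffOn.sub <|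
      contDiffOn_mulVec (contDiffOn_transpose <|
        ((smoothOn_connectionForm hU hg).comp hvar fun p hp => hp).clm_apply
          (smooth_deriv_variation hc hV).contDiffOn) (hζ.smooth.comp contDiff_snd).contDiffOn)

lemma hasDerivAt_flow_dotProduct (hc : IsCurveIn U c) (hU : IsOpen U) (hV : ContDiff ℝ ∞ V)
    {α : Fin m} (hα : ContDiffOn ℝ ∞ (J.left α) U) (ξ : ℝ → Fin n → ℝ) (x : ℝ) :
    HasDerivAt (fun ε : ℝ => flow (J.left α) (c + ε • V) x ⬝ᵥ ξ x)
      (J.flowVariation c V ξ α x) 0 := by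
  simpa [flowVariation] using hasDerivAt_dotProduct (hc.hasDerivAt_flow_variation hU
    (hV.differentiable (by simp)) hα x) (hasDerivAt_const 0 (ξ x))

lemma hasDerivAt_dotProduct_localPart (hc : IsCurveIn U c) (hU : IsOpen U)
    (hg : IsMetricOn U J.metric) (hV : ContDiff ℝ ∞ V) (ξ ζ : ℝ → Fin n → ℝ) (x : ℝ) :
    HasDerivAt (fun ε : ℝ => ξ x ⬝ᵥ J.localPart (c + ε • V) ζ x)
      (J.localVariation c V ξ ζ x) 0 := by
  have h_mem : ∀ᶠ ε : ℝ in nhds 0, (c + ε • V) x ∈ U :=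
    (hasDerivAt_add_smul (c x) (V x) 0).continuousAt.eventually_mem
      (hU.mem_nhds (by simpa using hc.mem x))
  refine HasDerivAt.congr_of_eventuallyEq ?_
    (h_mem.mono fun ε hε => dotProduct_localPart hU hg hε ξ ζ)
  simp only [covDeriv_dotProduct, hc.deriv_add_smul (hV.differentiable (by simp))]
  have h_metric := hasDerivAt_mulVec (hc.hasDerivAt_comp_variation hU hg.smoothOn_inv V x)
    (hasDerivAt_const 0 (ξ x))
  have h_connection := (hc.hasDerivAt_comp_variation hU (smoothOn_connectionForm hU hg) V
    x).clm_apply (hasDerivAt_add_smul (deriv c x) (deriv V x) 0)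
  refine ((hasDerivAt_dotProduct (hasDerivAt_const 0 (deriv ζ x)) h_metric).sub
    (hasDerivAt_dotProduct (hasDerivAt_const 0 (ζ x))
      (hasDerivAt_mulVec h_connection h_metric))).congr_deriv ?_
  simp only [localVariation, covDeriv_dotProduct, zero_smul, add_zero, mulVec_zero,
    zero_dotProduct, zero_add, dotProduct_add]
  ring

namespace IsCodazziFamily

lemma hasDerivAt_bracket_of_variations (hJ : J.IsCodazziFamily U σ) (hc : IsCurveIn U c)
    (hV : ContDiff ℝ ∞ V) (hξ : IsTest ξ) (hζ : IsTest ζ) :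
    HasDerivAt (fun ε : ℝ => J.bracket (c + ε • V) ξ ζ)
      ((∫ x, J.localVariation c V ξ ζ x) + ∑ α,
        ((∫ x, J.flowVariation c V ξ α x * J.tail c ζ α x) +
          ∫ x, (flow (J.left α) c x ⬝ᵥ ξ x) * antideriv (J.flowVariation c V ζ (σ α)) x)) 0 := by
  have h_local := hξ.isVariation_localPart hζ hc hJ.isOpen hJ.isMetricOn hV
  have h_left := fun α => hξ.isVariation_flow hc hJ.isOpen hV (hJ.isCodazziOn α).smooth
  have h_right := fun α => hζ.isVariation_flow hc hJ.isOpen hV (hJ.smoothOn_right α)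
  have deriv_local := h_local.hasDerivAt_integral_mul (μ := volume)
    (hasDerivAt_dotProduct_localPart hc hJ.isOpen hJ.isMetricOn hV ξ ζ) (k := fun _ => 1)
    measurable_const (by simp)
  have deriv_tail := fun α => hasDerivAt_integral_mul_antideriv (h_left α) (h_right α)
    (hasDerivAt_flow_dotProduct hc hJ.isOpen hV (hJ.isCodazziOn α).smooth ξ)
    (hJ.right_eq α ▸
      hasDerivAt_flow_dotProduct hc hJ.isOpen hV (hJ.isCodazziOn (σ α)).smooth ζ)
  simp only [one_mul] at deriv_local
  have deriv_sum := deriv_local.add (HasDerivAt.fun_sum (u := Finset.univ)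
    fun α _ => deriv_tail α)
  simp only [zero_smul, add_zero] at deriv_sum
  refine deriv_sum.congr_of_eventuallyEq ?_
  filter_upwards [h_local.eventually_integrable (μ := volume),
    Filter.eventually_all.2 fun α => (h_left α).eventually_integrable (μ := volume),
    Filter.eventually_all.2 fun α => (h_right α).eventually_integrable (μ := volume)]
    with ε i_local i_left i_right using bracket_eq i_local i_left i_right

end IsCodazziFamily

/-- The density of the derivative of the bracket of `ξ` and `ζ` along `V`, up to a total
derivative. -/
def variationDensity (J : NonlocalOp n m) (c ξ ζ V : ℝ → Fin n → ℝ) (x : ℝ) : ℝ :=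
  -(ξ x ⬝ᵥ (connectionForm J.metric (c x) (V x) *ᵥ J.apply c ζ x)) +
    ζ x ⬝ᵥ (connectionForm J.metric (c x) (V x) *ᵥ J.apply c ξ x) +
    ∑ α, ((J.covDeriv c ζ x ⬝ᵥ (J.left α (c x) *ᵥ V x)) * J.tail c ξ α x -
      (J.covDeriv c ξ x ⬝ᵥ (J.left α (c x) *ᵥ V x)) * J.tail c ζ α x)

namespace IsCodazziFamily

variable (hJ : J.IsCodazziFamily U σ) (hc : IsCurveIn U c)
include hJ hc

-- The terms quadratic in the tails cancel, since `g_{ij} a_{(β)k}^i a_{(α)l}^j` is symmetric in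
-- `α` and `β`.
lemma variationDensity_eq (ξ ζ V : ℝ → Fin n → ℝ) (x : ℝ) :
    J.variationDensity c ξ ζ V x =
      -(ξ x ⬝ᵥ (connectionForm J.metric (c x) (V x) *ᵥ J.apply c ζ x)) +
      ζ x ⬝ᵥ (connectionForm J.metric (c x) (V x) *ᵥ J.apply c ξ x) +
      ∑ α, (((J.metric (c x) *ᵥ J.apply c ζ x) ⬝ᵥ (J.left α (c x) *ᵥ V x)) * J.tail c ξ α x -
        ((J.metric (c x) *ᵥ J.apply c ξ x) ⬝ᵥ (J.left α (c x) *ᵥ V x)) * J.tail c ζ α x) := by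
  have h_quadratic : ∑ α, ∑ β, J.tail c ζ β x * ((J.metric (c x) *ᵥ flow (J.left β) c x) ⬝ᵥ
      (J.left α (c x) *ᵥ V x)) * J.tail c ξ α x = ∑ α, ∑ β, J.tail c ξ β x *
        ((J.metric (c x) *ᵥ flow (J.left β) c x) ⬝ᵥ (J.left α (c x) *ᵥ V x)) *
          J.tail c ζ α x := by
    rw [Finset.sum_comm]
    refine Finset.sum_congr rfl fun α _ => Finset.sum_congr rfl fun β _ => ?_
    rw [flow, flow, hJ.dotProduct_comm_left (hc.mem x)]
    ring
  simp only [variationDensity, hJ.covDeriv_eq hc, sub_dotProduct, sum_dotProduct, smul_dotProduct,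
    smul_eq_mul, sub_mul, Finset.sum_mul, Finset.sum_sub_distrib, h_quadratic]
  ring

lemma variationDensity_cyclic (ξ η ζ : ℝ → Fin n → ℝ) (x : ℝ) :
    J.variationDensity c ξ ζ (J.apply c η) x + J.variationDensity c η ξ (J.apply c ζ) x +
      J.variationDensity c ζ η (J.apply c ξ) x = 0 := by
  have h_torsion := connectionForm_mulVec_comm hJ.isOpen hJ.isMetricOn (hc.mem x)
  have h_symm : ∀ α X Y, (J.metric (c x) *ᵥ X) ⬝ᵥ (J.left α (c x) *ᵥ Y) =
      (J.metric (c x) *ᵥ Y) ⬝ᵥ (J.left α (c x) *ᵥ X) := fun α X Y => by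
    rw [hJ.isMetricOn.mulVec_dotProduct (hc.mem x), hJ.isMetricOn.mulVec_dotProduct (hc.mem x),
      dotProduct_comm, (isSelfAdjoint_iff (hJ.isMetricOn.symm _ (hc.mem x))).1
        ((hJ.isCodazziOn α).selfAdjoint _ (hc.mem x)), dotProduct_comm]
  simp only [hJ.variationDensity_eq hc]
  rw [h_torsion (J.apply c η x) (J.apply c ζ x), h_torsion (J.apply c ζ x) (J.apply c ξ x),
    h_torsion (J.apply c η x) (J.apply c ξ x)]
  simp only [Finset.sum_sub_distrib, h_symm _ (J.apply c ζ x) (J.apply c η x),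
    h_symm _ (J.apply c ξ x) (J.apply c ζ x), h_symm _ (J.apply c η x) (J.apply c ξ x)]
  ring

lemma integrable_variationDensity (hV : ContDiff ℝ ∞ V) (hξ : IsTest ξ) (hζ : IsTest ζ) :
    Integrable (J.variationDensity c ξ ζ V) := by
  have h_conn : ∀ {ξ ζ : ℝ → Fin n → ℝ}, IsTest ξ → IsTest ζ → Integrable fun x =>
      ξ x ⬝ᵥ (connectionForm J.metric (c x) (V x) *ᵥ J.apply c ζ x) := fun hξ hζ =>
    hξ.integrable_dotProduct <| contDiffOn_univ.1 <| contDiffOn_mulVec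
      (hc.smooth_connectionForm hJ.isOpen hJ.isMetricOn hV).contDiffOn
      (hJ.smooth_apply hc hζ).contDiffOn
  have h_tail : ∀ {ξ ζ : ℝ → Fin n → ℝ}, IsTest ξ → IsTest ζ → ∀ α, Integrable fun x =>
      (J.covDeriv c ζ x ⬝ᵥ (J.left α (c x) *ᵥ V x)) * J.tail c ξ α x := fun {ξ ζ} hξ hζ α => by
    have h_smooth : ContDiff ℝ ∞ fun x => J.tail c ξ α x • (J.left α (c x) *ᵥ V x) :=
      (hJ.smooth_tail hc hξ α).smul (hc.smooth_mulVec (hJ.isCodazziOn α).smooth hV)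
    simpa only [dotProduct_smul, smul_eq_mul, mul_comm (J.tail _ _ _ _)] using
      (isTest_covDeriv hJ.isOpen hJ.isMetricOn hc hζ).integrable_dotProduct h_smooth
  exact ((h_conn hξ hζ).neg.add (h_conn hζ hξ)).add
    (integrable_finsetSum _ fun α _ => (h_tail hξ hζ α).sub (h_tail hζ hξ α))

lemma hasDerivAt_dotProduct_connectionForm (hV : ContDiff ℝ ∞ V) (hξ : IsTest ξ)
    (hζ : IsTest ζ) (x : ℝ) :
    HasDerivAt
      (fun x => ζ x ⬝ᵥ (connectionForm J.metric (c x) (V x) *ᵥ ((J.metric (c x))⁻¹ *ᵥ ξ x)))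
      (-J.localVariation c V ξ ζ x -
        ξ x ⬝ᵥ (connectionForm J.metric (c x) (V x) *ᵥ
          ((J.metric (c x))⁻¹ *ᵥ J.covDeriv c ζ x)) +
        ζ x ⬝ᵥ (connectionForm J.metric (c x) (V x) *ᵥ
          ((J.metric (c x))⁻¹ *ᵥ J.covDeriv c ξ x)) -
        ζ x ⬝ᵥ (curvatureForm (connectionForm J.metric) (c x) (V x) (deriv c x) *ᵥ
          ((J.metric (c x))⁻¹ *ᵥ ξ x))) x := by
  have h_connection := (hasDerivAt_comp_curve hJ.isOpen
    (smoothOn_connectionForm hJ.isOpen hJ.isMetricOn) (hc.mem x) (hc.hasDerivAt x)).clm_apply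
      (hV.differentiable (by simp) x).hasDerivAt
  refine (hasDerivAt_dotProduct (hζ.hasDerivAt x) (hasDerivAt_mulVec h_connection
    (hasDerivAt_inv_metric_mulVec hJ.isOpen hJ.isMetricOn hc hξ x))).congr_deriv ?_
  have h_transpose : ξ x ⬝ᵥ (connectionForm J.metric (c x) (V x) *ᵥ
      ((J.metric (c x))⁻¹ *ᵥ J.covDeriv c ζ x)) = J.covDeriv c ζ x ⬝ᵥ ((J.metric (c x))⁻¹ *ᵥ
        ((connectionForm J.metric (c x) (V x))ᵀ *ᵥ ξ x)) := by
    rw [dotProduct_mulVec, ← mulVec_transpose, dotProduct_comm,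
      hJ.isMetricOn.inv_mulVec_dotProduct (hc.mem x)]
  rw [h_transpose, localVariation, fderiv_inv_metric hJ.isOpen hJ.isMetricOn (hc.mem x),
    curvatureForm_apply]
  simp only [covDeriv_dotProduct, add_mulVec, sub_mulVec, neg_mulVec, mulVec_sub,
    dotProduct_add, dotProduct_sub, dotProduct_neg, ← mulVec_mulVec]
  ring

lemma dotProduct_curvatureForm (X Y ξ ζ : Fin n → ℝ) (x : ℝ) :
    ζ ⬝ᵥ (curvatureForm (connectionForm J.metric) (c x) X Y *ᵥ ((J.metric (c x))⁻¹ *ᵥ ξ)) =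
      ∑ α, (((J.left α (c x) *ᵥ X) ⬝ᵥ ζ) * ((J.right α (c x) *ᵥ Y) ⬝ᵥ ξ) -
        ((J.left α (c x) *ᵥ X) ⬝ᵥ ξ) * ((J.right α (c x) *ᵥ Y) ⬝ᵥ ζ)) := by
  rw [hJ.curvatureForm_eq _ (hc.mem x), sum_mulVec, dotProduct_sum]
  refine Finset.sum_congr rfl fun α _ => ?_
  rw [wedge_mulVec, mulVec_mulVec, mul_nonsing_inv _ (hJ.isMetricOn.isUnit_det (hc.mem x)),
    one_mulVec, dotProduct_sub, dotProduct_smul, dotProduct_smul, dotProduct_comm ζ,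
    dotProduct_comm ζ, smul_eq_mul, smul_eq_mul]
  ring

lemma hasDerivAt_dotProduct_mul_tail (hV : ContDiff ℝ ∞ V) (hξ : IsTest ξ) (hζ : IsTest ζ)
    (α : Fin m) (x : ℝ) :
    HasDerivAt (fun x => ((J.left α (c x) *ᵥ V x) ⬝ᵥ ξ x) * J.tail c ζ α x)
      ((J.flowVariation c V ξ α x + J.covDeriv c ξ x ⬝ᵥ (J.left α (c x) *ᵥ V x) +
        ξ x ⬝ᵥ (connectionForm J.metric (c x) (V x) *ᵥ flow (J.left α) c x)) * J.tail c ζ α x +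
        ((J.left α (c x) *ᵥ V x) ⬝ᵥ ξ x) * J.tailDensity c ζ α x) x := by
  have h_left := hasDerivAt_mulVec (hasDerivAt_comp_curve hJ.isOpen (hJ.isCodazziOn α).smooth
    (hc.mem x) (hc.hasDerivAt x)) (hV.differentiable (by simp) x).hasDerivAt
  refine ((hasDerivAt_dotProduct h_left (hξ.hasDerivAt x)).mul
    (hJ.hasDerivAt_tail hc hζ α x)).congr_deriv ?_
  have h_codazzi := congrArg (ξ x ⬝ᵥ ·)
    ((hJ.isCodazziOn α).extCovDeriv_eq_zero _ (hc.mem x) (V x) (deriv c x))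
  simp only [extCovDeriv, dotProduct_sub, dotProduct_add, dotProduct_zero] at h_codazzi
  simp only [flowVariation, flow, covDeriv_dotProduct, dotProduct_add,
    dotProduct_comm _ (ξ x), dotProduct_comm _ (deriv ξ x)]
  linear_combination -J.tail c ζ α x * h_codazzi

end IsCodazziFamily

/-- The density of the derivative of the bracket along `V`, with the antiderivatives moved to the
factors which are not varied. -/
def bracketVariation (J : NonlocalOp n m) (c V ξ ζ : ℝ → Fin n → ℝ) (x : ℝ) : ℝ :=
  J.localVariation c V ξ ζ x + ∑ α, (J.flowVariation c V ξ α x * J.tail c ζ α x -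
    J.flowVariation c V ζ α x * J.tail c ξ α x)

/-- The function whose `x`-derivative is the difference of `bracketVariation` and
`variationDensity`. -/
def variationPotential (J : NonlocalOp n m) (c V ξ ζ : ℝ → Fin n → ℝ) (x : ℝ) : ℝ :=
  -(ζ x ⬝ᵥ (connectionForm J.metric (c x) (V x) *ᵥ ((J.metric (c x))⁻¹ *ᵥ ξ x))) +
    ∑ α, (((J.left α (c x) *ᵥ V x) ⬝ᵥ ξ x) * J.tail c ζ α x -
      ((J.left α (c x) *ᵥ V x) ⬝ᵥ ζ x) * J.tail c ξ α x)

lemma hasCompactSupport_variationPotential (J : NonlocalOp n m) (c V : ℝ → Fin n → ℝ)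
    (hξ : IsTest ξ) (hζ : IsTest ζ) : HasCompactSupport (J.variationPotential c V ξ ζ) := by
  refine HasCompactSupport.intro (hξ.compact.isCompact.union hζ.compact.isCompact)
    fun x hx => ?_
  rw [Set.mem_union, not_or] at hx
  simp only [variationPotential, image_eq_zero_of_notMem_tsupport hx.1,
    image_eq_zero_of_notMem_tsupport hx.2, zero_dotProduct, dotProduct_zero, zero_mul, sub_self,
    neg_zero, Finset.sum_const_zero, add_zero]

namespace IsCodazziFamily

variable (hJ : J.IsCodazziFamily U σ) (hc : IsCurveIn U c)
include hJ hc

lemma hasDerivAt_variationPotential (hV : ContDiff ℝ ∞ V) (hξ : IsTest ξ) (hζ : IsTest ζ)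
    (x : ℝ) : HasDerivAt (J.variationPotential c V ξ ζ)
      (J.bracketVariation c V ξ ζ x - J.variationDensity c ξ ζ V x) x := by
  refine ((hJ.hasDerivAt_dotProduct_connectionForm hc hV hξ hζ x).neg.add
    (HasDerivAt.fun_sum (u := Finset.univ) fun α _ =>
      (hJ.hasDerivAt_dotProduct_mul_tail hc hV hξ hζ α x).sub
        (hJ.hasDerivAt_dotProduct_mul_tail hc hV hζ hξ α x))).congr_deriv ?_
  rw [bracketVariation, variationDensity, hJ.dotProduct_curvatureForm hc, hJ.apply_eq hc,
    hJ.apply_eq hc]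
  simp only [mulVec_add, dotProduct_add, mulVec_sum, dotProduct_sum, mulVec_smul, dotProduct_smul,
    smul_eq_mul, tailDensity, flow, Finset.sum_add_distrib, Finset.sum_sub_distrib, add_mul,
    mul_comm (J.tail c _ _ _)]
  ring

lemma integrable_flowVariation (hV : ContDiff ℝ ∞ V) (hξ : IsTest ξ) (α : Fin m) :
    Integrable (J.flowVariation c V ξ α) :=
  (hξ.isVariation_flow hc hJ.isOpen hV (hJ.isCodazziOn α).smooth).integrable_derivative
    (hasDerivAt_flow_dotProduct hc hJ.isOpen hV (hJ.isCodazziOn α).smooth ξ)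

lemma integrable_localVariation (hV : ContDiff ℝ ∞ V) (hξ : IsTest ξ) (hζ : IsTest ζ) :
    Integrable (J.localVariation c V ξ ζ) :=
  (hξ.isVariation_localPart hζ hc hJ.isOpen hJ.isMetricOn hV).integrable_derivative
    (hasDerivAt_dotProduct_localPart hc hJ.isOpen hJ.isMetricOn hV ξ ζ)

lemma integrable_flowVariation_mul_tail (hV : ContDiff ℝ ∞ V) (hξ : IsTest ξ) (hζ : IsTest ζ)
    (α : Fin m) : Integrable fun x => J.flowVariation c V ξ α x * J.tail c ζ α x :=
  integrable_mul_antideriv (hJ.integrable_flowVariation hc hV hξ α)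
    (hJ.integrable_tailDensity hc hζ α)

lemma integrable_sum_flowVariation (hV : ContDiff ℝ ∞ V) (hξ : IsTest ξ) (hζ : IsTest ζ) :
    Integrable fun x => ∑ α, (J.flowVariation c V ξ α x * J.tail c ζ α x -
      J.flowVariation c V ζ α x * J.tail c ξ α x) :=
  integrable_finsetSum _ fun α _ => (hJ.integrable_flowVariation_mul_tail hc hV hξ hζ α).sub
    (hJ.integrable_flowVariation_mul_tail hc hV hζ hξ α)

lemma integral_bracketVariation (hV : ContDiff ℝ ∞ V) (hξ : IsTest ξ) (hζ : IsTest ζ) :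
    ∫ x, J.bracketVariation c V ξ ζ x = ∫ x, J.variationDensity c ξ ζ V x := by
  have h_density := hJ.integrable_variationDensity hc hV hξ hζ
  have h_bracket : Integrable (J.bracketVariation c V ξ ζ) :=
    (hJ.integrable_localVariation hc hV hξ hζ).add
      (hJ.integrable_sum_flowVariation hc hV hξ hζ)
  rw [← sub_eq_zero, ← integral_sub h_bracket h_density]
  exact integral_eq_zero_of_hasDerivAt_of_hasCompactSupport
    (hJ.hasDerivAt_variationPotential hc hV hξ hζ) (h_bracket.sub h_density)
    (hasCompactSupport_variationPotential J c V hξ hζ)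

lemma integral_flow_mul_antideriv_flowVariation (hV : ContDiff ℝ ∞ V) (hξ : IsTest ξ)
    (hζ : IsTest ζ) (α : Fin m) :
    ∫ x, (flow (J.left α) c x ⬝ᵥ ξ x) * antideriv (J.flowVariation c V ζ (σ α)) x =
      -∫ x, J.flowVariation c V ζ (σ α) x * J.tail c ξ (σ α) x := by
  rw [integral_mul_antideriv_comm (hJ.integrable_flow_dotProduct hc hξ α)
    (hJ.integrable_flowVariation hc hV hζ (σ α)), hJ.left_eq α]
  rfl

lemma hasDerivAt_bracket (hV : ContDiff ℝ ∞ V) (hξ : IsTest ξ) (hζ : IsTest ζ) :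
    HasDerivAt (fun ε : ℝ => J.bracket (c + ε • V) ξ ζ)
      (∫ x, J.variationDensity c ξ ζ V x) 0 := by
  have h_sub : ∀ α ∈ Finset.univ, Integrable fun x => J.flowVariation c V ξ α x *
      J.tail c ζ α x - J.flowVariation c V ζ α x * J.tail c ξ α x := fun α _ =>
    (hJ.integrable_flowVariation_mul_tail hc hV hξ hζ α).sub
      (hJ.integrable_flowVariation_mul_tail hc hV hζ hξ α)
  refine (hJ.hasDerivAt_bracket_of_variations hc hV hξ hζ).congr_deriv ?_
  simp only [← hJ.integral_bracketVariation hc hV hξ hζ, bracketVariation]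
  rw [integral_add (hJ.integrable_localVariation hc hV hξ hζ)
    (hJ.integrable_sum_flowVariation hc hV hξ hζ), integral_finsetSum _ h_sub]
  simp only [hJ.integral_flow_mul_antideriv_flowVariation hc hV hξ hζ,
    integral_sub (hJ.integrable_flowVariation_mul_tail hc hV hξ hζ _)
      (hJ.integrable_flowVariation_mul_tail hc hV hζ hξ _), Finset.sum_add_distrib,
    Finset.sum_sub_distrib, Finset.sum_neg_distrib]
  rw [hJ.sum_comp fun α => ∫ x, J.flowVariation c V ζ α x * J.tail c ξ α x, ← sub_eq_add_neg]

omit hc in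
theorem isHamiltonian : J.IsHamiltonian U where
  skew _ _ _ hc hξ hη := hJ.bracket_comm hc hξ hη
  jacobi c ξ η ζ hc hξ hη hζ := by
    have hVξ := hJ.smooth_apply hc hξ
    have hVη := hJ.smooth_apply hc hη
    have hVζ := hJ.smooth_apply hc hζ
    refine ⟨_, _, _, hJ.hasDerivAt_bracket hc hVη hξ hζ, hJ.hasDerivAt_bracket hc hVζ hη hξ,
      hJ.hasDerivAt_bracket hc hVξ hζ hη, ?_⟩
    have i_η := hJ.integrable_variationDensity hc hVη hξ hζ
    have i_ζ := hJ.integrable_variationDensity hc hVζ hη hξ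
    have i_ξ := hJ.integrable_variationDensity hc hVξ hζ hη
    rw [← integral_add' i_η i_ζ, ← integral_add' (i_η.add i_ζ) i_ξ]
    simp only [Pi.add_apply, hJ.variationDensity_cyclic hc, integral_zero]

end IsCodazziFamily

end NonlocalOp

end Jacobi

section TransformedOperator

namespace Reciprocal

variable {n : ℕ} {D : Reciprocal n} {U : Set (Fin n → ℝ)} {u : Fin n → ℝ}
  {P Q R S : ScalarField n}

lemma IsExtension.commute_transform (h : D.IsExtension U P Q R S) (hD : D.IsAdmissible U)
    (hflat : IsFlatOn U D.g) (hu : u ∈ U) :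
    Commute (D.transform (hess D.g D.B) Q S u) (D.transform (hess D.g D.N) P R u) := by
  have hwB := h.isTransformable_B hD hflat
  have hwN := h.isTransformable_N hD hflat
  have h_hess : Commute (hess D.g D.B u) (hess D.g D.N u) :=
    hwN.isCodazziOn.commute_hess hD.isOpen hD.isMetricOn hD.smooth_B h.smooth_P h.isFlux_P hu
  exact Reciprocal.commute_transform
    (Reciprocal.commute_transform h_hess.symm (hD.commute_velocity hu (hwN.commute u hu))).symm
    (hwB.commute_velocity_transform hD hu).symm

lemma IsExtension.isCodazziFamily (h : D.IsExtension U P Q R S) (hD : D.IsAdmissible U)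
    (hflat : IsFlatOn U D.g) : (D.operator P Q R S).IsCodazziFamily U ![1, 0, 3, 2] where
  isOpen := hD.isOpen
  isMetricOn := hD.isMetricOn_metric
  involutive α := by fin_cases α <;> rfl
  right_eq α := by fin_cases α <;> rfl
  isCodazziOn α := by
    fin_cases α
    · exact (h.isTransformable_B hD hflat).isCodazziOn_transform hD
    · exact isCodazziOn_one hD.isOpen hD.isMetricOn_metric
    · exact (h.isTransformable_N hD hflat).isCodazziOn_transform hD
    · exact hD.isCodazziOn_velocity
  commute α β u hu := by
    have h_BN := h.commute_transform hD hflat hu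
    have h_vB := (h.isTransformable_B hD hflat).commute_velocity_transform hD hu
    have h_vN := (h.isTransformable_N hD hflat).commute_velocity_transform hD hu
    fin_cases α <;> fin_cases β
    exacts [.refl _, .one_right _, h_BN, h_vB.symm, .one_left _, .one_left _, .one_left _,
      .one_left _, h_BN.symm, .one_right _, .refl _, h_vN.symm, h_vB, .one_right _, h_vN, .refl _]
  curvatureForm_eq u hu X Y := by
    refine (h.curvatureForm_metric hD hflat hu X Y).trans ?_
    simp [fourTailOp, Fin.sum_univ_four]

end Reciprocal

end TransformedOperator

end HydroType

end

theorem theorem3 (n : ℕ) (U : Set (Fin n → ℝ)) (hU : IsOpen U)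
    -- the flat metric, and the Hamiltonian system `u_t = v u_x` with the density `h`
    (g : HydroType.MatField n) (hg : HydroType.IsMetricOn U g) (hflat : HydroType.IsFlatOn U g)
    (h : HydroType.ScalarField n) (hh : ContDiffOn ℝ ∞ h U)
    (v : HydroType.MatField n) (hv : v = HydroType.hess g h)
    -- the reciprocal transformation, given by two conservation laws of the system
    (B A N M : HydroType.ScalarField n)
    (hB : ContDiffOn ℝ ∞ B U) (hA : ContDiffOn ℝ ∞ A U)
    (hN : ContDiffOn ℝ ∞ N U) (hM : ContDiffOn ℝ ∞ M U)
    (hBA : HydroType.IsFlux U v B A) (hNM : HydroType.IsFlux U v N M)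
    (hdelta : ∀ u ∈ U, B u * M u - A u * N u ≠ 0)
    (hdet : ∀ u ∈ U, (M u • (1 : Matrix (Fin n) (Fin n) ℝ) - N u • v u).det ≠ 0)
    -- the fluxes of `B` and `N` along the Hamiltonian flows with the densities `N` and `B`
    (P Q R S : HydroType.ScalarField n)
    (hP : ContDiffOn ℝ ∞ P U) (hS : ContDiffOn ℝ ∞ S U)
    (hBP : HydroType.IsFlux U (HydroType.hess g N) B P)
    (hNS : HydroType.IsFlux U (HydroType.hess g B) N S)
    (hPS : ∀ u ∈ U, P u + S u = HydroType.gradInner g B N u)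
    (hQ : ∀ u, Q u = (1 / 2) * HydroType.gradInner g B B u)
    (hR : ∀ u, R u = (1 / 2) * HydroType.gradInner g N N u)
    -- the transformed objects
    (gt vt lam mu : HydroType.MatField n)
    (hgt : gt = HydroType.newMetric B A N M v g)
    (hvt : vt = HydroType.newVelocity B A N M v)
    (hlam : lam = HydroType.newFlow B N vt (HydroType.hess g B) Q S)
    (hmu : mu = HydroType.newFlow B N vt (HydroType.hess g N) P R) :
    -- `gt` is a metric
    HydroType.IsMetricOn U gt ∧
    -- `vt`, `mu`, `lam` are the matrices of the transformed flows, and the last two commute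
    -- with the first one
    HydroType.TransformsFlows U B A P Q N M R S v (HydroType.hess g N) (HydroType.hess g B)
      vt mu lam ∧
    HydroType.FlowsCommute U vt lam ∧ HydroType.FlowsCommute U vt mu ∧
    -- the transformed operator is Hamiltonian
    (HydroType.fourTailOp gt lam mu vt).IsHamiltonian U ∧
    -- the transformed system is Hamiltonian with respect to it
    (HydroType.fourTailOp gt lam mu vt).Generates U
      (fun u => (h u * M u - (1 / 2) * HydroType.gradInner g h h u * N u) /
        (B u * M u - A u * N u)) vt ∧
    -- more generally, it is the transform of the local operator of `g`: if `u_s = w u_x` is the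
    -- flow generated by the local operator and a density `H`, and if `F`, `E`, `G` are the fluxes
    -- of `H` along `v` and of `B`, `N` along `w`, then the transformed flow is generated by the
    -- transformed operator and the transformed density
    (∀ (H F E G : HydroType.ScalarField n) (w : HydroType.MatField n),
      ContDiffOn ℝ ∞ H U → ContDiffOn ℝ ∞ F U → ContDiffOn ℝ ∞ E U → ContDiffOn ℝ ∞ G U →
      (HydroType.localOp g).Generates U H w → HydroType.IsFlux U v H F →
      HydroType.IsFlux U w B E → HydroType.IsFlux U w N G →
      (HydroType.fourTailOp gt lam mu vt).Generates U
        (fun u => (H u * M u - F u * N u) / (B u * M u - A u * N u))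
        (HydroType.newFlow B N vt w E G)) ∧
    -- the expansion of the curvature tensor
    ∀ u ∈ U, ∀ i j k l : Fin n,
      HydroType.curvature gt i j k l u =
        lam u i k * (1 : Matrix (Fin n) (Fin n) ℝ) j l
          + lam u j l * (1 : Matrix (Fin n) (Fin n) ℝ) i k
          - lam u j k * (1 : Matrix (Fin n) (Fin n) ℝ) i l
          - lam u i l * (1 : Matrix (Fin n) (Fin n) ℝ) j k
          + mu u i k * vt u j l + mu u j l * vt u i k
          - mu u j k * vt u i l - mu u i l * vt u j k := by
  subst hlam hmu hvt hgt hv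
  let D : HydroType.Reciprocal n := ⟨g, HydroType.hess g h, B, A, N, M⟩
  have hv : D.IsTransformable U (HydroType.hess g h) A M :=
    ⟨HydroType.isCodazziOn_hess hU hg hflat hh, hA, hM, fun _ _ => Commute.refl _, hBA, hNM⟩
  have hD : D.IsAdmissible U := ⟨hU, hg, hB, hN, hdelta, hdet, hv⟩
  have hE : D.IsExtension U P Q R S := ⟨hP, hS, hBP, hNS, hPS, hQ, hR⟩
  have hcomm : ∀ {w E G}, D.IsTransformable U w E G →
      HydroType.FlowsCommute U D.velocity (D.transform w E G) := fun hw =>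
    hD.isCodazziOn_velocity.flowsCommute (hw.isCodazziOn_transform hD) hU hD.isMetricOn_metric
      fun _ => hw.commute_velocity_transform hD
  refine ⟨hD.isMetricOn_metric, hD.transformsFlows _ _ P Q R S,
    hcomm (hE.isTransformable_B hD hflat), hcomm (hE.isTransformable_N hD hflat),
    (hE.isCodazziFamily hD hflat).isHamiltonian, hE.generates_velocity hD hflat hh rfl,
    fun H F E G w hH hF hE' hG hw hHF hBE hNG => ?_, fun _ => hE.curvature_metric hD hflat⟩
  have w_eq : ∀ u ∈ U, w u = HydroType.hess g H u := fun u hu => hw.eq_hess hU hg hH hu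
  have hwH : D.IsTransformable U (HydroType.hess g H) E G :=
    hD.isTransformable_hess hflat hH hF hE' hG hHF (hBE.congr w_eq) (hNG.congr w_eq)
  exact (hE.generates_transform hD hflat hH hF hHF hwH).congr fun u hu => by
    rw [HydroType.newFlow, w_eq u hu]; rfl
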